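/- Let $n\ge 1$ and $i\ge 1$, and let $\mathrm{BO}\langle n\rangle\to\mathrm{BSO}$ be the $n$-connected cover. An $\langle n\rangle$-structure on a manifold is a lift of its stable tangent bundle along $\mathrm{BO}\langle n\rangle\to\mathrm{BSO}$; on an oriented manifold it is required to induce the given orientation. Let $\Omega^{\langle n\rangle}_d$ be the bordism group of closed $d$-manifolds with $\langle n\rangle$-structure. The external sum $\mathrm{BSO}\times\mathrm{BSO}\to\mathrm{BSO}$ is covered by a map $\mathrm{BO}\langle n\rangle\times\mathrm{BO}\langle n\rangle\to\mathrm{BO}\langle n\rangle$, and this defines products $\Omega^{\langle n\rangle}_d\times\Omega^{\langle n\rangle}_e\to\Omega^{\langle n\rangle}_{d+e}$. Let $M$ be a closed oriented $(n-1)$-connected $2n$-manifold that admits an $\langle n\rangle$-structure $\ell_M$ (that is, $M$ is $n$-parallelisable), and let $D^{2n}\subset M$ be an embedded disc, compatible with the orientation, with centre $*$. (a) Let $t\colon \mathrm{SO}(2n)\to \mathrm{BDiff}(M,D^{2n})$ be the map obtained by looping once the fibre sequence $\mathrm{BDiff}(M,D^{2n})\to\mathrm{BDiff}^+(M,*)\to\mathrm{BSO}(2n)$,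 whose second map is induced by taking the derivative at $*$ (the collar twist). (b) A class $[\varphi]\in\pi_i\mathrm{BDiff}(M,D^{2n})$ classifies a smooth bundle $M\to E_\varphi\to S^i$ together with a trivialised disc subbundle $S^i\times D^{2n}\subset E_\varphi$, which trivialises the normal bundle of $S^i=S^i\times\{0\}$ in $E_\varphi$. Let $\Phi_i[\varphi]\in\Omega^{\langle n\rangle}_{2n+i}$ be the bordism class of $E_\varphi$ with an $\langle n\rangle$-structure that induces on $S^i$, via this trivialisation, the $\langle n\rangle$-structure of the standard stable framing of $S^i$ (the one that bounds). (c) Let $J\colon\pi_i\mathrm{SO}(2n)\to\Omega^{\langle n\rangle}_i$ be the $J$-homomorphism followed by the map from framed to $\langle n\rangle$-bordism: it sends $[\varphi]$ to $S^i$ with the $\langle n\rangle$-structure given by the standard stable normal framing twisted by $\varphi$. Then $\Phi_i$ has exactly one value on every class in the image of $t_*$, and for all $x\in\pi_i\mathrm{SO}(2n)$ $$\Phi_i(t_*x)=J(x)\cdot[M,\ell_M]\in\Omega^{\langle n\rangle}_{2n+i}.$$ -/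

import Mathlib

open Function Topology Metric
open scoped Manifold ContDiff

noncomputable section

/-- The linear isomorphism `ℝ^ℕ ⊕ ℝ^ℕ ≅ ℝ^ℕ` that interleaves coordinates. -/
def interleave : ((ℕ → ℝ) × (ℕ → ℝ)) ≃ₗ[ℝ] (ℕ → ℝ) :=
  (LinearEquiv.sumArrowLequivProdArrow ℕ ℕ ℝ ℝ).symm.trans
    (LinearEquiv.funCongrLeft ℝ ℝ Equiv.natSumNatEquivNat.symm)

theorem continuous_interleave : Continuous interleave := by
  refine continuous_pi fun k => ?_
  change Continuous fun p : (ℕ → ℝ) × (ℕ → ℝ) =>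
    Sum.elim p.1 p.2 (Equiv.natSumNatEquivNat.symm k)
  cases Equiv.natSumNatEquivNat.symm k with
  | inl j => exact (continuous_apply j).comp continuous_fst
  | inr j => exact (continuous_apply j).comp continuous_snd

/-- The splitting `ℝ^{a+b} = ℝ^a ⊕ ℝ^b`; the equality `h` relabels the index set. -/
def splitFin {a b m : ℕ} (h : a + b = m) :
    (Fin m → ℝ) ≃ₗ[ℝ] (Fin a → ℝ) × (Fin b → ℝ) :=
  (LinearEquiv.funCongrLeft ℝ ℝ (finSumFinEquiv.trans (finCongr h))).trans
    (LinearEquiv.sumArrowLequivProdArrow (Fin a) (Fin b) ℝ ℝ)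

/-- `ℝ^{1+c} = ℝ ⊕ ℝ^c`. -/
def splitOne (c : ℕ) : (Fin (1 + c) → ℝ) ≃ₗ[ℝ] ℝ × (Fin c → ℝ) :=
  (splitFin rfl).trans
    ((LinearEquiv.funUnique (Fin 1) ℝ ℝ).prodCongr (LinearEquiv.refl ℝ _))

/-- An `m`-frame in `ℝ^ℕ`: an injective linear map `ℝ^m → ℝ^ℕ`. -/
def Frame (m : ℕ) : Type :=
  {L : (Fin m → ℝ) →ₗ[ℝ] (ℕ → ℝ) // Injective L}

/-- The topology on frames is that of pointwise convergence. -/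
instance (m : ℕ) : TopologicalSpace (Frame m) :=
  TopologicalSpace.induced (fun L => (L.1 : (Fin m → ℝ) → (ℕ → ℝ))) inferInstance

namespace Frame

theorem continuous_apply {m : ℕ} (x : Fin m → ℝ) : Continuous fun L : Frame m => L.1 x :=
  (_root_.continuous_apply x).comp continuous_induced_dom

theorem ext_apply {m : ℕ} {L L' : Frame m} (h : ∀ x, L.1 x = L'.1 x) : L = L' :=
  Subtype.ext (LinearMap.ext h)

/-- Change of basis. -/
def comp {m : ℕ} (L : Frame m) (A : (Fin m → ℝ) ≃ₗ[ℝ] (Fin m → ℝ)) : Frame m :=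
  ⟨L.1 ∘ₗ A.toLinearMap, L.2.comp A.injective⟩

/-- The linear map `ℝ^ℕ ⊕ ℝ → ℝ^ℕ`, `(w, t) ↦ (t, w₀, w₁, …)`. -/
def shift : ((ℕ → ℝ) × ℝ) →ₗ[ℝ] (ℕ → ℝ) where
  toFun p := fun k => Nat.casesOn k p.2 fun j => p.1 j
  map_add' p q := by funext k; cases k <;> rfl
  map_smul' r p := by funext k; cases k <;> rfl

theorem shift_injective : Injective shift := by
  intro p q h
  refine Prod.ext (funext fun j => ?_) ?_
  · exact congrFun h (j + 1)
  · exact congrFun h 0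

/-- Stabilisation `L ↦ L ⊕ id_ℝ`. -/
def stab {m : ℕ} (L : Frame m) : Frame (m + 1) :=
  ⟨shift ∘ₗ (L.1.prodMap (LinearEquiv.funUnique (Fin 1) ℝ ℝ).toLinearMap) ∘ₗ
      (splitFin rfl).toLinearMap,
    shift_injective.comp ((Prod.map_injective.2
      ⟨L.2, (LinearEquiv.funUnique (Fin 1) ℝ ℝ).injective⟩).comp
        (splitFin (rfl : m + 1 = m + 1)).injective)⟩

/-- The direct sum of two frames. -/
def sum {m m' m'' : ℕ} (h : m + m' = m'') (L : Frame m) (L' : Frame m') : Frame m'' :=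
  ⟨interleave.toLinearMap ∘ₗ (L.1.prodMap L'.1) ∘ₗ (splitFin h).toLinearMap,
    interleave.injective.comp
      ((Prod.map_injective.2 ⟨L.2, L'.2⟩).comp (LinearEquiv.injective _))⟩

/-- The standard frames: stabilisations of the empty frame. -/
def std : (m : ℕ) → Frame m
  | 0 => ⟨0, fun _ _ _ => Subsingleton.elim _ _⟩
  | m + 1 => (std m).stab

end Frame

/-- `BSO(m)`: the Grassmannian of oriented `m`-dimensional subspaces of `ℝ^ℕ`, as the quotient of
the space of `m`-frames by the invertible matrices of positive determinant. -/
def BSOm (m : ℕ) : Type :=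
  Quot fun L L' : Frame m =>
    ∃ A : (Fin m → ℝ) ≃ₗ[ℝ] (Fin m → ℝ), 0 < LinearMap.det A.toLinearMap ∧ L' = L.comp A

instance (m : ℕ) : TopologicalSpace (BSOm m) := inferInstanceAs (TopologicalSpace (Quot _))

namespace BSOm

/-- The oriented subspace spanned by a frame. -/
def mk {m : ℕ} (L : Frame m) : BSOm m := Quot.mk _ L

theorem continuous_mk {m : ℕ} : Continuous (mk (m := m)) := continuous_quot_mk

theorem equivalence (m : ℕ) : Equivalence fun L L' : Frame m =>
    ∃ A : (Fin m → ℝ) ≃ₗ[ℝ] (Fin m → ℝ), 0 < LinearMap.det A.toLinearMap ∧ L' = L.comp A := by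
  refine ⟨fun L => ⟨LinearEquiv.refl ℝ _, by simp, rfl⟩, ?_, ?_⟩
  · rintro L _ ⟨A, hA, rfl⟩
    refine ⟨A.symm, ?_, ?_⟩
    · have h : LinearMap.det A.symm.toLinearMap * LinearMap.det A.toLinearMap = 1 := by
        rw [← LinearMap.det_comp]; simp
      by_contra hc
      nlinarith
    · exact Frame.ext_apply fun x => by simp [Frame.comp]
  · rintro L _ _ ⟨A, hA, rfl⟩ ⟨A', hA', rfl⟩
    refine ⟨A'.trans A, ?_, rfl⟩
    rw [LinearEquiv.coe_trans, LinearMap.det_comp]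
    positivity

theorem isOpenQuotientMap_mk (m : ℕ) : IsOpenQuotientMap (mk (m := m)) := by
  refine ⟨Quot.mk_surjective, continuous_mk, fun U hU => ?_⟩
  change IsOpen (Quot.mk _ ⁻¹' (mk '' U))
  have key : (Quot.mk _ ⁻¹' (mk '' U) : Set (Frame m)) =
      ⋃ A ∈ {A : (Fin m → ℝ) ≃ₗ[ℝ] (Fin m → ℝ) | 0 < LinearMap.det A.toLinearMap},
        {L : Frame m | L.comp A ∈ U} := by
    ext L
    simp only [Set.mem_preimage, Set.mem_iUnion, Set.mem_ofPred_eq, exists_prop]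
    constructor
    · rintro ⟨L', hL', h⟩
      obtain ⟨A, hA, rfl⟩ := (equivalence m).quot_mk_eq_iff _ _ |>.1 h.symm
      exact ⟨A, hA, hL'⟩
    · rintro ⟨A, hA, h⟩
      exact ⟨_, h, (Quot.sound ⟨A, hA, rfl⟩).symm⟩
  rw [key]
  refine isOpen_biUnion fun A _ => ?_
  refine hU.preimage (continuous_induced_rng.2 ?_)
  exact continuous_pi fun x => Frame.continuous_apply (A x)

/-- The map `BSO(m) × BSO(m') → BSO(m + m')` given by the direct sum of oriented subspaces. -/
def sum {m m' m'' : ℕ} (h : m + m' = m'') : BSOm m → BSOm m' → BSOm m'' :=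
  Quot.map₂ (fun L L' => L.sum h L')
    (by
      rintro L L' _ ⟨A, hA, rfl⟩
      refine ⟨(splitFin h).trans
        (((LinearEquiv.refl ℝ _).prodCongr A).trans (splitFin h).symm), ?_, ?_⟩
      · have h1 := LinearMap.det_conj (LinearMap.id.prodMap A.toLinearMap) (splitFin h).symm
        refine lt_of_lt_of_eq ?_ h1.symm
        rw [LinearMap.det_prodMap]
        simpa using hA
      · exact Frame.ext_apply fun x => by simp [Frame.sum, Frame.comp])
    (by
      rintro L _ L' ⟨A, hA, rfl⟩
      refine ⟨(splitFin h).trans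
        ((A.prodCongr (LinearEquiv.refl ℝ _)).trans (splitFin h).symm), ?_, ?_⟩
      · have h1 := LinearMap.det_conj (A.toLinearMap.prodMap LinearMap.id) (splitFin h).symm
        refine lt_of_lt_of_eq ?_ h1.symm
        rw [LinearMap.det_prodMap]
        simpa using hA
      · exact Frame.ext_apply fun x => by simp [Frame.sum, Frame.comp])

theorem continuous_sum {m m' m'' : ℕ} (h : m + m' = m'') :
    Continuous fun p : BSOm m × BSOm m' => sum h p.1 p.2 := by
  refine ((isOpenQuotientMap_mk m).prodMap (isOpenQuotientMap_mk m')).continuous_comp_iff.1 ?_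
  change Continuous fun p : Frame m × Frame m' => mk (p.1.sum h p.2)
  refine continuous_mk.comp (continuous_induced_rng.2 ?_)
  change Continuous fun p : Frame m × Frame m' => fun x =>
    interleave (p.1.1 (splitFin h x).1, p.2.1 (splitFin h x).2)
  exact continuous_pi fun x => continuous_interleave.comp
    (((Frame.continuous_apply _).comp continuous_fst).prodMk
      ((Frame.continuous_apply _).comp continuous_snd))

end BSOm

/-- The identifications defining `BSO = colim BSO(m)`. -/
inductive BSO.Rel : (Σ m, Frame m) → (Σ m, Frame m) → Prop
  | basis {m : ℕ} (L : Frame m) (A : (Fin m → ℝ) ≃ₗ[ℝ] (Fin m → ℝ))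
      (hA : 0 < LinearMap.det A.toLinearMap) : Rel ⟨m, L⟩ ⟨m, L.comp A⟩
  | stab {m : ℕ} (L : Frame m) : Rel ⟨m, L⟩ ⟨m + 1, L.stab⟩

/-- `BSO`, the colimit of the oriented Grassmannians `BSO(m)` under stabilisation. -/
def BSO : Type := Quot BSO.Rel

instance : TopologicalSpace BSO := inferInstanceAs (TopologicalSpace (Quot _))

namespace BSO

/-- The canonical map `BSO(m) → BSO`. -/
def of {m : ℕ} : BSOm m → BSO :=
  Quot.lift (fun L => Quot.mk _ ⟨m, L⟩) (by
    rintro L _ ⟨A, hA, rfl⟩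
    exact Quot.sound (Rel.basis L A hA))

/-- The base point of `BSO`. -/
def base : BSO := of (BSOm.mk (Frame.std 0))

theorem of_std (m : ℕ) : of (BSOm.mk (Frame.std m)) = base := by
  induction m with
  | zero => rfl
  | succ m ih => rw [← ih]; exact (Quot.sound (Rel.stab (Frame.std m))).symm

end BSO

/-- The map on homotopy groups (sets, in degree `0`) induced by a continuous map. -/
def piMap (k : ℕ) {X Y : Type} [TopologicalSpace X] [TopologicalSpace Y] (f : C(X, Y)) (x : X) :
    HomotopyGroup.Pi k X x → HomotopyGroup.Pi k Y (f x) :=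
  Quotient.map'
    (fun p => ⟨f.comp p.1, fun y hy => congrArg f (p.2 y hy)⟩)
    (fun _ _ h => ContinuousMap.HomotopicRel.comp_continuousMap h f)

/-- An `n`-connected cover `θ : BO⟨n⟩ → BSO` (a model of it, as a pointed Serre fibration):
`BO⟨n⟩` is `n`-connected and `θ` induces isomorphisms on `π_k` for `k > n`. -/
structure ConnectedCover (n : ℕ) : Type 1 where
  B : Type
  [top : TopologicalSpace B]
  θ : C(B, BSO)
  pt : B
  θ_pt : θ pt = BSO.base
  /-- The homotopy lifting property for cubes. -/
  fibration : ∀ (k : ℕ) (f : C(Fin k → unitInterval, B))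
      (H : C(unitInterval × (Fin k → unitInterval), BSO)),
    (∀ x, H (0, x) = θ (f x)) →
      ∃ G : C(unitInterval × (Fin k → unitInterval), B), (∀ x, G (0, x) = f x) ∧ ∀ z, θ (G z) = H z
  connected : ∀ k ≤ n, Subsingleton (HomotopyGroup.Pi k B pt)
  iso : ∀ k, n < k → Bijective (piMap k θ pt)

attribute [instance] ConnectedCover.top


namespace ConnectedCover

variable {n : ℕ} (𝔅 : ConnectedCover n)

/-- The pullback `BO⟨n⟩_m` of `BO⟨n⟩` along `BSO(m) → BSO`. -/
def Pull (m : ℕ) : Type := {p : 𝔅.B × BSOm m // 𝔅.θ p.1 = BSO.of p.2}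

instance (m : ℕ) : TopologicalSpace (𝔅.Pull m) := instTopologicalSpaceSubtype

/-- The point of `BO⟨n⟩_m` over the standard subspace. -/
def stdPt (m : ℕ) : 𝔅.Pull m :=
  ⟨(𝔅.pt, BSOm.mk (Frame.std m)), by rw [BSO.of_std]; exact 𝔅.θ_pt⟩

/-- A map `BO⟨n⟩_m × BO⟨n⟩_{m'} → BO⟨n⟩` covering the external sum
`BSO(m) × BSO(m') → BSO(m + m') → BSO`. -/
structure SumLift (m m' : ℕ) where
  map : C(𝔅.Pull m × 𝔅.Pull m', 𝔅.B)
  covers : ∀ p q, 𝔅.θ (map (p, q)) = BSO.of (BSOm.sum rfl p.1.2 q.1.2)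

end ConnectedCover

/-- A smooth manifold of dimension `d` without boundary. -/
structure Mfd (d : ℕ) : Type 1 where
  {V H : Type}
  [normedGroup : NormedAddCommGroup V]
  [normedSpace : NormedSpace ℝ V]
  [finDim : FiniteDimensional ℝ V]
  [topModel : TopologicalSpace H]
  model : ModelWithCorners ℝ V H
  [boundaryless : model.Boundaryless]
  carrier : Type
  [top : TopologicalSpace carrier]
  [t2 : T2Space carrier]
  [charted : ChartedSpace H carrier]
  [smooth : IsManifold model ∞ carrier]
  dim : Module.finrank ℝ V = d

attribute [instance] Mfd.normedGroup Mfd.normedSpace Mfd.finDim Mfd.topModel Mfd.boundaryless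
  Mfd.top Mfd.t2 Mfd.charted Mfd.smooth

namespace Mfd

instance {d : ℕ} (X : Mfd d) : IsManifold X.model 1 X.carrier := IsManifold.of_le (n := ∞) (by simp)

/-- The tangent space. -/
abbrev T {d : ℕ} (X : Mfd d) (x : X.carrier) : Type := TangentSpace X.model x

/-- The product of manifolds. -/
abbrev prod {d e k : ℕ} (h : d + e = k) (X : Mfd d) (Y : Mfd e) : Mfd k where
  model := X.model.prod Y.model
  carrier := X.carrier × Y.carrier
  dim := by rw [Module.finrank_prod, X.dim, Y.dim, h]

/-- The sphere `S^i` in `ℝ^{i+1}`. -/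
abbrev sphere (i : ℕ) : Mfd i where
  model := 𝓡 i
  carrier := Metric.sphere (0 : EuclideanSpace ℝ (Fin (i + 1))) 1
  smooth := IsManifold.of_le (n := ω) (by simp)
  dim := by simp

instance (i : ℕ) : CompactSpace (sphere i).carrier :=
  inferInstanceAs (CompactSpace (Metric.sphere (0 : EuclideanSpace ℝ (Fin (i + 1))) 1))

/-- The base point of the sphere. -/
def basePt (i : ℕ) : (sphere i).carrier :=
  ⟨EuclideanSpace.single 0 1, by simp⟩

/-- Euclidean space. -/
abbrev euclid (k : ℕ) : Mfd k where
  model := 𝓡 k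
  carrier := EuclideanSpace ℝ (Fin k)
  smooth := IsManifold.of_le (n := ω) (by simp)
  dim := by simp

/-- The real line. -/
abbrev line : Mfd 1 where
  model := 𝓘(ℝ, ℝ)
  carrier := ℝ
  dim := by simp

end Mfd

/-- A tangential `⟨n⟩`-structure on the vector bundle `TX ⊕ U` of rank `m`, where `U` is a vector
space: a continuous fibrewise linear injective map `TX ⊕ U → ℝ^ℕ`, which exhibits `x ↦ im(gauss x)`
as a classifying map `X → BO(m)` of `TX ⊕ U`, and a lift of that map to
`BO⟨n⟩_m → BSO(m) → BO(m)`. As `BO⟨n⟩_m` is the pullback of `BO⟨n⟩`, this is a lift to `BO⟨n⟩` of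
the classifying map of the stable tangent bundle. It induces an orientation of `TX ⊕ U`. -/
structure TangStr {n : ℕ} (𝔅 : ConnectedCover n) {d : ℕ} (X : Mfd d) (U : Type)
    [AddCommGroup U] [Module ℝ U] [TopologicalSpace U] (m : ℕ) where
  lift : C(X.carrier, 𝔅.Pull m)
  gauss : ∀ x : X.carrier, (X.T x × U) →ₗ[ℝ] (ℕ → ℝ)
  continuous_gauss : Continuous fun p : TangentBundle X.model X.carrier × U =>
    gauss p.1.1 (p.1.2, p.2)
  injective_gauss : ∀ x, Injective (gauss x)
  lift_eq : ∀ x, ∃ F : (Fin m → ℝ) ≃ₗ[ℝ] (X.T x × U),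
    (lift x).1.2 = BSOm.mk ⟨gauss x ∘ₗ F.toLinearMap, (injective_gauss x).comp F.injective⟩

namespace TangStr

variable {n : ℕ} {𝔅 : ConnectedCover n} {d e k : ℕ} {X : Mfd d} {Y : Mfd e}
  {U U' U'' : Type} [AddCommGroup U] [Module ℝ U] [TopologicalSpace U]
  [AddCommGroup U'] [Module ℝ U'] [TopologicalSpace U']
  [AddCommGroup U''] [Module ℝ U''] [TopologicalSpace U''] {m m' m'' : ℕ}

/-- `T(X × Y) ⊕ U'' ≅ (TX ⊕ U) ⊕ (TY ⊕ U')` for `U'' ≅ U ⊕ U'`. -/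
def prodEquiv (hk : d + e = k) (ψ : U'' ≃L[ℝ] U × U') (x : X.carrier) (y : Y.carrier) :
    ((Mfd.prod hk X Y).T (x, y) × U'') ≃ₗ[ℝ] (X.T x × U) × (Y.T y × U') :=
  ((LinearEquiv.refl ℝ (X.T x × Y.T y)).prodCongr ψ.toLinearEquiv).trans
    (LinearEquiv.prodProdProdComm ℝ _ _ _ _)

/-- The product of `⟨n⟩`-structures. -/
def prod (hk : d + e = k) (μ : 𝔅.SumLift m m') (h : m + m' = m'') (ψ : U'' ≃L[ℝ] U × U')
    (s : TangStr 𝔅 X U m) (s' : TangStr 𝔅 Y U' m') : TangStr 𝔅 (Mfd.prod hk X Y) U'' m'' where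
  lift :=
    ⟨fun z => ⟨(μ.map (s.lift z.1, s'.lift z.2),
        BSOm.sum h (s.lift z.1).1.2 (s'.lift z.2).1.2), by subst h; exact μ.covers _ _⟩, by
      refine Continuous.subtype_mk (Continuous.prodMk ?_ ?_) _
      · exact μ.map.continuous.comp
          ((s.lift.continuous.comp continuous_fst).prodMk (s'.lift.continuous.comp continuous_snd))
      · exact (BSOm.continuous_sum h).comp
          (((continuous_snd.comp continuous_subtype_val).comp
            (s.lift.continuous.comp continuous_fst)).prodMk
          ((continuous_snd.comp continuous_subtype_val).comp
            (s'.lift.continuous.comp continuous_snd)))⟩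
  gauss z := interleave.toLinearMap ∘ₗ ((s.gauss z.1).prodMap (s'.gauss z.2)) ∘ₗ
    (prodEquiv hk ψ z.1 z.2).toLinearMap
  continuous_gauss := by
    have h1 : Continuous fun p : TangentBundle (Mfd.prod hk X Y).model (Mfd.prod hk X Y).carrier =>
        ((⟨p.1.1, p.2.1⟩, ⟨p.1.2, p.2.2⟩) :
          TangentBundle X.model X.carrier × TangentBundle Y.model Y.carrier) :=
      (contMDiff_equivTangentBundleProd (I := X.model) (I' := Y.model) (M := X.carrier)
        (M' := Y.carrier) (n := 0)).continuous
    refine continuous_interleave.comp (Continuous.prodMk ?_ ?_)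
    · exact s.continuous_gauss.comp
        (((continuous_fst.comp h1).comp continuous_fst).prodMk
          (continuous_fst.comp (ψ.continuous.comp continuous_snd)))
    · exact s'.continuous_gauss.comp
        (((continuous_snd.comp h1).comp continuous_fst).prodMk
          (continuous_snd.comp (ψ.continuous.comp continuous_snd)))
  injective_gauss z := interleave.injective.comp ((Prod.map_injective.2
    ⟨s.injective_gauss z.1, s'.injective_gauss z.2⟩).comp (prodEquiv hk ψ z.1 z.2).injective)
  lift_eq z := by
    obtain ⟨F, hF⟩ := s.lift_eq z.1
    obtain ⟨F', hF'⟩ := s'.lift_eq z.2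
    refine ⟨(splitFin h).trans ((F.prodCongr F').trans (prodEquiv hk ψ z.1 z.2).symm), ?_⟩
    change BSOm.sum h (s.lift z.1).1.2 (s'.lift z.2).1.2 = _
    rw [hF, hF']
    change BSOm.mk (Frame.sum h _ _) = _
    congr 1
    refine Frame.ext_apply fun x => ?_
    simp [Frame.sum]

/-- The `⟨n⟩`-structure underlying a framing `TX ⊕ U ≅ ℝ^m`. -/
def ofFraming (𝔅 : ConnectedCover n) {X : Mfd d} {m : ℕ}
    (τ : ∀ x : X.carrier, (X.T x × U) ≃ₗ[ℝ] (Fin m → ℝ))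
    (hτ : Continuous fun p : TangentBundle X.model X.carrier × U => τ p.1.1 (p.1.2, p.2)) :
    TangStr 𝔅 X U m where
  lift := ContinuousMap.const _ (𝔅.stdPt m)
  gauss x := (Frame.std m).1 ∘ₗ (τ x).toLinearMap
  continuous_gauss := (Frame.std m).1.continuous_of_finiteDimensional.comp hτ
  injective_gauss x := (Frame.std m).2.comp (τ x).injective
  lift_eq x := ⟨(τ x).symm, congrArg BSOm.mk (Frame.ext_apply fun y => by simp)⟩

/-- Homotopies of `⟨n⟩`-structures. -/
def IsHomotopy (h : unitInterval → TangStr 𝔅 X U m) : Prop :=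
  (Continuous fun p : unitInterval × X.carrier => (h p.1).lift p.2) ∧
    Continuous fun p : unitInterval × (TangentBundle X.model X.carrier × U) =>
      (h p.1).gauss p.2.1.1 (p.2.1.2, p.2.2)

end TangStr

/-- The rank of `TX ⊕ ℝ ⊕ ℝ^c` for a `d`-manifold `X`. -/
def rk (d c : ℕ) : ℕ := d + (1 + c)

/-- A closed `d`-manifold with a `⟨n⟩`-structure on `TX ⊕ ℝ ⊕ ℝ^c`. -/
structure ClosedStr {n : ℕ} (𝔅 : ConnectedCover n) (d c : ℕ) : Type 1 where
  X : Mfd d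
  [compact : CompactSpace X.carrier]
  str : TangStr 𝔅 X (ℝ × (Fin c → ℝ)) (rk d c)

attribute [instance] ClosedStr.compact

/-- The `⟨n⟩`-manifold `P` is the level set `f⁻¹(r)` in the `⟨n⟩`-manifold `W`, along which `f` is
regular: its structure is the restriction of the structure of `W`, where the summand `ℝ` of
`TP ⊕ ℝ ⊕ ℝ^c` is sent to a vector field `ν` along `P` on which `f` increases. -/
def IsLevel {n : ℕ} {𝔅 : ConnectedCover n} {d c : ℕ} {W : Mfd (d + 1)}
    (str : TangStr 𝔅 W (Fin c → ℝ) (rk d c)) (f : W.carrier → ℝ) (r : ℝ)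
    (P : ClosedStr 𝔅 d c) : Prop :=
  ∃ (j : P.X.carrier → W.carrier) (ν : ∀ x, W.T (j x)),
    ContMDiff P.X.model W.model ∞ j ∧ Injective j ∧ Set.range j = f ⁻¹' {r} ∧
    ∀ x, 0 < mvfderiv W.model f (j x) (ν x) ∧ str.lift (j x) = P.str.lift x ∧
      ∀ (v : P.X.T x) (s : ℝ) (u : Fin c → ℝ),
        P.str.gauss x (v, (s, u)) =
          str.gauss (j x) (mfderiv P.X.model W.model j x v + s • ν x, u)

/-- A `⟨n⟩`-bordism from `P` to `Q`: the compact manifold `f⁻¹[0, 1]` with boundary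
`f⁻¹(0) ∪ f⁻¹(1)`, extended beyond its boundary by open collars. On the boundary, `ν` points inward
at `P` and outward at `Q`. -/
structure Bordism {n : ℕ} {𝔅 : ConnectedCover n} {d c : ℕ} (P Q : ClosedStr 𝔅 d c) : Type 1 where
  W : Mfd (d + 1)
  str : TangStr 𝔅 W (Fin c → ℝ) (rk d c)
  f : W.carrier → ℝ
  smooth_f : ContMDiff W.model 𝓘(ℝ, ℝ) ∞ f
  isCompact : IsCompact (f ⁻¹' Set.Icc 0 1)
  source : IsLevel str f 0 P
  target : IsLevel str f 1 Q

/-- The bordism group `Ω_d^{⟨n⟩}`, formed with `⟨n⟩`-structures on `TX ⊕ ℝ ⊕ ℝ^c`. -/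
def Omega {n : ℕ} (𝔅 : ConnectedCover n) (d c : ℕ) : Type 1 :=
  Quot fun P Q : ClosedStr 𝔅 d c => Nonempty (Bordism P Q)

/-- The bordism class of a closed `⟨n⟩`-manifold. -/
def Omega.mk {n : ℕ} {𝔅 : ConnectedCover n} {d c : ℕ} (P : ClosedStr 𝔅 d c) : Omega 𝔅 d c :=
  Quot.mk _ P

/-- `ℝ^{c + (1 + c')} = ℝ^c ⊕ (ℝ ⊕ ℝ^{c'})`. -/
def splitRight (c c' : ℕ) :
    (Fin (c + (1 + c')) → ℝ) ≃L[ℝ] (Fin c → ℝ) × (ℝ × (Fin c' → ℝ)) :=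
  ((splitFin rfl).trans
    ((LinearEquiv.refl ℝ _).prodCongr (splitOne c'))).toContinuousLinearEquiv

/-- `ℝ ⊕ ℝ^{c + (1 + c')} = (ℝ ⊕ ℝ^c) ⊕ (ℝ ⊕ ℝ^{c'})`. -/
def splitBoth (c c' : ℕ) :
    (ℝ × (Fin (c + (1 + c')) → ℝ)) ≃L[ℝ] (ℝ × (Fin c → ℝ)) × (ℝ × (Fin c' → ℝ)) :=
  ((ContinuousLinearEquiv.refl ℝ ℝ).prodCongr (splitRight c c')).trans
    (ContinuousLinearEquiv.prodAssoc ℝ _ _ _).symm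

theorem rk_add (d e c c' : ℕ) : rk d c + rk e c' = rk (d + e) (c + (1 + c')) := by
  unfold rk; omega

namespace ClosedStr

variable {n : ℕ} {𝔅 : ConnectedCover n} {d e c c' : ℕ}

/-- The product of closed `⟨n⟩`-manifolds. -/
def prod (μ : 𝔅.SumLift (rk d c) (rk e c')) (P : ClosedStr 𝔅 d c) (Q : ClosedStr 𝔅 e c') :
    ClosedStr 𝔅 (d + e) (c + (1 + c')) where
  X := Mfd.prod rfl P.X Q.X
  compact := inferInstanceAs (CompactSpace (P.X.carrier × Q.X.carrier))
  str := TangStr.prod rfl μ (rk_add d e c c') (splitBoth c c') P.str Q.str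

theorem isLevel_prod (μ : 𝔅.SumLift (rk d c) (rk e c')) {W : Mfd (d + 1)}
    (str : TangStr 𝔅 W (Fin c → ℝ) (rk d c)) (f : W.carrier → ℝ)
    (hf : ContMDiff W.model 𝓘(ℝ, ℝ) ∞ f) (r : ℝ) (P : ClosedStr 𝔅 d c)
    (Q : ClosedStr 𝔅 e c') (h : IsLevel str f r P) :
    IsLevel (TangStr.prod (by omega) μ (rk_add d e c c') (splitRight c c') str Q.str)
      (fun z => f z.1) r (P.prod μ Q) := by
  obtain ⟨j, ν, hj, hinj, hr, h⟩ := h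
  refine ⟨Prod.map j id, fun z => (ν z.1, 0), hj.prodMap contMDiff_id,
    hinj.prodMap injective_id, ?_, fun z => ⟨?_, ?_, ?_⟩⟩
  · change Set.range (Prod.map j (id : Q.X.carrier → Q.X.carrier)) = Prod.fst ⁻¹' (f ⁻¹' {r})
    rw [Set.range_prodMap, hr, Set.range_id]
    ext z
    simp
  · have h1 := mvfderiv_comp_apply (I := W.model) (I' := W.model.prod Q.X.model)
      (f := (Prod.fst : W.carrier × Q.X.carrier → W.carrier)) (g := f) (j z.1, z.2)
      (hf.mdifferentiableAt (by simp)) mdifferentiableAt_fst (ν z.1, 0)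
    rw [mfderiv_fst] at h1
    exact lt_of_lt_of_eq (h z.1).1 h1.symm
  · refine Subtype.ext (Prod.ext ?_ ?_)
    · exact congrArg (fun p => μ.map (p, Q.str.lift z.2)) (h z.1).2.1
    · exact congrArg (fun p => BSOm.sum (rk_add d e c c') p.1.2 (Q.str.lift z.2).1.2) (h z.1).2.1
  · rintro ⟨v, w⟩ s u
    have h1 : mfderiv (P.X.model.prod Q.X.model) (W.model.prod Q.X.model)
        (Prod.map j (id : Q.X.carrier → Q.X.carrier)) z =
        (mfderiv P.X.model W.model j z.1).prodMap (mfderiv Q.X.model Q.X.model id z.2) :=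
      mfderiv_prodMap (hj.mdifferentiableAt (by simp)) mdifferentiableAt_id
    have h2 := congrArg (fun A => A (v, w)) h1
    rw [mfderiv_id] at h2
    have h3 : (mfderiv (P.X.model.prod Q.X.model) (W.model.prod Q.X.model)
        (Prod.map j (id : Q.X.carrier → Q.X.carrier)) z (v, w) + s • (ν z.1, 0) :
          W.T (j z.1) × Q.X.T z.2) =
        (mfderiv P.X.model W.model j z.1 v + s • ν z.1, w) := by
      refine (congrArg (fun a => a + s • ((ν z.1, 0) : W.T (j z.1) × Q.X.T z.2)) h2).trans ?_
      refine Prod.ext rfl ?_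
      exact (congrArg (fun a => w + a) (smul_zero s)).trans (add_zero w)
    refine Eq.trans ?_ (congrArg (fun a => (TangStr.prod (by omega) μ (rk_add d e c c')
      (splitRight c c') str Q.str).gauss (j z.1, z.2) (a, u)) h3.symm)
    change interleave (P.str.gauss z.1 (v, (s, (splitRight c c' u).1)),
        Q.str.gauss z.2 (w, (splitRight c c' u).2)) =
      interleave (str.gauss (j z.1) (mfderiv P.X.model W.model j z.1 v + s • ν z.1,
        (splitRight c c' u).1), Q.str.gauss z.2 (w, (splitRight c c' u).2))
    exact congrArg (fun a => interleave (a, Q.str.gauss z.2 (w, (splitRight c c' u).2)))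
      ((h z.1).2.2 v s (splitRight c c' u).1)

/-- Multiplication `Ω_d × Ω_e → Ω_{d+e}` by the class of a closed `⟨n⟩`-manifold from the right. -/
def mulRight (μ : 𝔅.SumLift (rk d c) (rk e c')) (Q : ClosedStr 𝔅 e c') :
    Omega 𝔅 d c → Omega 𝔅 (d + e) (c + (1 + c')) :=
  Quot.map (fun P => P.prod μ Q) (by
    rintro P P' ⟨W, str, f, hf, hc, h0, h1⟩
    refine ⟨⟨Mfd.prod (by omega) W Q.X,
      TangStr.prod (by omega) μ (rk_add d e c c') (splitRight c c') str Q.str,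
      fun z => f z.1, hf.comp contMDiff_fst, ?_, isLevel_prod μ str f hf 0 P Q h0,
      isLevel_prod μ str f hf 1 P' Q h1⟩⟩
    have := hc.prod (isCompact_univ (X := Q.X.carrier))
    convert this using 1
    ext z
    simp)

/-- Homotopic `⟨n⟩`-structures define the same bordism class. -/
theorem mk_eq_of_isHomotopy {X : Mfd d} [CompactSpace X.carrier]
    (h : unitInterval → TangStr 𝔅 X (ℝ × (Fin c → ℝ)) (rk d c)) (hh : TangStr.IsHomotopy h) :
    Omega.mk (⟨X, h 0⟩ : ClosedStr 𝔅 d c) = Omega.mk ⟨X, h 1⟩ := by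
  let π : ℝ → unitInterval := Set.projIcc 0 1 zero_le_one
  have hπ : Continuous π := continuous_projIcc
  let str : TangStr 𝔅 (Mfd.prod rfl X Mfd.line) (Fin c → ℝ) (rk d c) :=
    { lift := ⟨fun z => (h (π z.2)).lift z.1,
        hh.1.comp ((hπ.comp continuous_snd).prodMk continuous_fst)⟩
      gauss := fun z => (h (π z.2)).gauss z.1 ∘ₗ
        (LinearEquiv.prodAssoc ℝ (X.T z.1) ℝ (Fin c → ℝ)).toLinearMap
      continuous_gauss := by
        have h1 : Continuous fun p : TangentBundle (Mfd.prod rfl X Mfd.line).model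
              (Mfd.prod rfl X Mfd.line).carrier =>
            ((⟨p.1.1, p.2.1⟩, ⟨p.1.2, p.2.2⟩) :
              TangentBundle X.model X.carrier × TangentBundle 𝓘(ℝ, ℝ) ℝ) :=
          (contMDiff_equivTangentBundleProd (I := X.model) (I' := 𝓘(ℝ, ℝ)) (M := X.carrier)
            (M' := ℝ) (n := 0)).continuous
        have h2 : Continuous fun p : TangentBundle 𝓘(ℝ, ℝ) ℝ => ((p.1, p.2) : ℝ × ℝ) :=
          (tangentBundleModelSpaceHomeomorph 𝓘(ℝ, ℝ)).continuous
        exact hh.2.comp (((hπ.comp (continuous_fst.comp h2)).comp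
          ((continuous_snd.comp h1).comp continuous_fst)).prodMk
          (((continuous_fst.comp h1).comp continuous_fst).prodMk
            (((continuous_snd.comp h2).comp
              ((continuous_snd.comp h1).comp continuous_fst)).prodMk continuous_snd)))
      injective_gauss := fun z => ((h (π z.2)).injective_gauss z.1).comp (LinearEquiv.injective _)
      lift_eq := fun z => by
        obtain ⟨F, hF⟩ := (h (π z.2)).lift_eq z.1
        refine ⟨F.trans (LinearEquiv.prodAssoc ℝ (X.T z.1) ℝ (Fin c → ℝ)).symm, ?_⟩
        refine hF.trans (congrArg BSOm.mk (Frame.ext_apply fun x => ?_))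
        rfl }
  have hl : ∀ r : unitInterval, IsLevel str (fun z => z.2) r ⟨X, h r⟩ := by
    intro r
    have hr : π r = r := Set.projIcc_val _ r
    refine ⟨fun x => (x, (r : ℝ)), fun x => (0, (1 : ℝ)), contMDiff_id.prodMk contMDiff_const,
      fun x y hxy => congrArg Prod.fst hxy, ?_, fun x => ⟨?_, ?_, ?_⟩⟩
    · ext z
      constructor
      · rintro ⟨x, rfl⟩
        rfl
      · intro hz
        exact ⟨z.1, Prod.ext rfl hz.symm⟩
    · have h1 := mfderiv_snd (I := X.model) (I' := 𝓘(ℝ, ℝ)) (M := X.carrier) (M' := ℝ)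
        (x := (x, (r : ℝ)))
      have h2 := congrArg (fun A => A (0, 1)) h1
      exact lt_of_lt_of_eq zero_lt_one h2.symm
    · change (h (π r)).lift x = (h r).lift x
      rw [hr]
    · intro v s u
      have h1 : HasMFDerivAt X.model (X.model.prod 𝓘(ℝ, ℝ)) (fun x : X.carrier => (x, (r : ℝ))) x
          ((ContinuousLinearMap.id ℝ (X.T x)).prod 0) :=
        (hasMFDerivAt_id x).prodMk (hasMFDerivAt_const _ x)
      have h2 : (mfderiv X.model (X.model.prod 𝓘(ℝ, ℝ)) (fun x : X.carrier => (x, (r : ℝ))) x v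
          + s • (0, 1) : X.T x × ℝ) = (v, s) := by
        rw [h1.mfderiv]
        refine Prod.ext ?_ ?_
        · exact (congrArg (fun a => v + a) (smul_zero s)).trans (add_zero v)
        · exact (zero_add (s * 1)).trans (mul_one s)
      refine Eq.trans ?_ (congrArg (fun a => str.gauss (x, (r : ℝ)) (a, u)) h2.symm)
      change (h r).gauss x (v, (s, u)) = (h (π r)).gauss x (v, (s, u))
      rw [hr]
  refine Quot.sound ⟨⟨_, str, fun z => z.2, contMDiff_snd, ?_, hl 0, hl 1⟩⟩
  have := (isCompact_univ (X := X.carrier)).prod (isCompact_Icc (a := (0 : ℝ)) (b := 1))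
  convert this using 1
  ext z
  simp

end ClosedStr

/-- The isomorphism `T_x S^i ⊕ ℝ ≅ ℝ^{i+1}` whose second component is the outward normal. -/
def radialMap {i : ℕ} (x : (Mfd.sphere i).carrier) :
    ((Mfd.sphere i).T x × ℝ) →ₗ[ℝ] EuclideanSpace ℝ (Fin (i + 1)) :=
  (mvfderiv (𝓡 i) ((↑) : (Mfd.sphere i).carrier → EuclideanSpace ℝ (Fin (i + 1))) x
    ).toLinearMap.coprod (LinearMap.toSpanSingleton ℝ _ x.1)

theorem radialMap_bijective {i : ℕ} (x : (Mfd.sphere i).carrier) : Bijective (radialMap x) := by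
  have : Fact (Module.finrank ℝ (EuclideanSpace ℝ (Fin (i + 1))) = i + 1) := ⟨by simp⟩
  have hx : ‖(x.1 : EuclideanSpace ℝ (Fin (i + 1)))‖ = 1 := norm_eq_of_mem_sphere x
  have hinj : Injective (radialMap x) := by
    rw [← LinearMap.ker_eq_bot, LinearMap.ker_eq_bot']
    rintro ⟨v, s⟩ hv
    have h1 : mvfderiv (𝓡 i)
        ((↑) : (Mfd.sphere i).carrier → EuclideanSpace ℝ (Fin (i + 1))) x v ∈
          (Submodule.span ℝ {(x.1 : EuclideanSpace ℝ (Fin (i + 1)))})ᗮ := by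
      rw [← range_mvfderiv_subtypeVal (n := i)]
      exact ⟨v, rfl⟩
    have h2 : mvfderiv (𝓡 i)
        ((↑) : (Mfd.sphere i).carrier → EuclideanSpace ℝ (Fin (i + 1))) x v + s • x.1 = 0 := hv
    have h3 := Submodule.mem_orthogonal_singleton_iff_inner_right.1 h1
    have h4 : s = 0 := by
      have := congrArg (fun y => inner ℝ x.1 y) h2
      simpa [inner_add_right, h3, inner_smul_right, hx] using this
    subst h4
    have h5 := injective_mvfderiv_subtypeVal_sphere (n := i) x
    rw [zero_smul, add_zero] at h2
    rw [h5 (h2.trans (map_zero _).symm)]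
    rfl
  have : FiniteDimensional ℝ ((Mfd.sphere i).T x) :=
    inferInstanceAs (FiniteDimensional ℝ (EuclideanSpace ℝ (Fin i)))
  have hT : Module.finrank ℝ ((Mfd.sphere i).T x) = i :=
    finrank_euclideanSpace_fin (𝕜 := ℝ) (n := i)
  refine ⟨hinj, (LinearMap.injective_iff_surjective_of_finrank_eq_finrank ?_).1 hinj⟩
  rw [Module.finrank_prod, hT]
  simp

/-- `radialMap` as a linear isomorphism onto `Fin (i + 1) → ℝ`. -/
def radial {i : ℕ} (x : (Mfd.sphere i).carrier) :
    ((Mfd.sphere i).T x × ℝ) ≃ₗ[ℝ] (Fin (i + 1) → ℝ) :=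
  (LinearEquiv.ofBijective (radialMap x) (radialMap_bijective x)).trans
    (WithLp.linearEquiv 2 ℝ (Fin (i + 1) → ℝ))

theorem continuous_radial (i : ℕ) :
    Continuous fun p : TangentBundle (𝓡 i) (Mfd.sphere i).carrier × ℝ =>
      radial p.1.1 (p.1.2, p.2) := by
  have : Fact (Module.finrank ℝ (EuclideanSpace ℝ (Fin (i + 1))) = i + 1) := ⟨by simp⟩
  have h1 : Continuous fun p : TangentBundle (𝓡 i) (Mfd.sphere i).carrier =>
      mvfderiv (𝓡 i) ((↑) : (Mfd.sphere i).carrier → EuclideanSpace ℝ (Fin (i + 1))) p.1 p.2 := by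
    have h := (contMDiff_coe_sphere (n := i) (m := 1)
      (E := EuclideanSpace ℝ (Fin (i + 1)))).continuous_tangentMap le_rfl
    exact continuous_snd.comp ((tangentBundleModelSpaceHomeomorph
      𝓘(ℝ, EuclideanSpace ℝ (Fin (i + 1)))).continuous.comp h)
  have h2 : Continuous fun p : TangentBundle (𝓡 i) (Mfd.sphere i).carrier =>
      (p.1.1 : EuclideanSpace ℝ (Fin (i + 1))) :=
    continuous_subtype_val.comp (FiberBundle.continuous_proj _ _)
  refine (PiLp.continuous_ofLp 2 _).comp ?_
  exact (h1.comp continuous_fst).add (continuous_snd.smul (h2.comp continuous_fst))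

attribute [local irreducible] radial

/-- The action of `A⁻¹` on `ℝ^k`. -/
def rotInv {k : ℕ} (A : Matrix.specialOrthogonalGroup (Fin k) ℝ) :
    (Fin k → ℝ) ≃ₗ[ℝ] (Fin k → ℝ) where
  toFun w := Matrix.mulVec A.1.transpose w
  invFun w := Matrix.mulVec A.1 w
  map_add' := Matrix.mulVec_add _
  map_smul' r w := Matrix.mulVec_smul _ r w
  left_inv w := by
    have h : A.1 * A.1.transpose = 1 := (Matrix.mem_orthogonalGroup_iff (Fin k) ℝ).1
      (Matrix.mem_specialOrthogonalGroup_iff.1 A.2).1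
    change Matrix.mulVec _ (Matrix.mulVec _ w) = w
    rw [Matrix.mulVec_mulVec, h, Matrix.one_mulVec]
  right_inv w := by
    have h : A.1.transpose * A.1 = 1 := (Matrix.mem_orthogonalGroup_iff' (Fin k) ℝ).1
      (Matrix.mem_specialOrthogonalGroup_iff.1 A.2).1
    change Matrix.mulVec _ (Matrix.mulVec _ w) = w
    rw [Matrix.mulVec_mulVec, h, Matrix.one_mulVec]

/-- The framing of `TS^i ⊕ ℝ ⊕ ℝ^k` given by the standard framing of `TS^i ⊕ ℝ` and by the
map `x ↦ φ(x)⁻¹` on `ℝ^k`. On stable normal bundles this twists the standard framing by `φ`. -/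
def twistedFraming {i k : ℕ}
    (φ : (Mfd.sphere i).carrier → Matrix.specialOrthogonalGroup (Fin k) ℝ)
    (x : (Mfd.sphere i).carrier) :
    ((Mfd.sphere i).T x × (ℝ × (Fin k → ℝ))) ≃ₗ[ℝ] (Fin (rk i k) → ℝ) :=
  (LinearEquiv.prodAssoc ℝ ((Mfd.sphere i).T x) ℝ (Fin k → ℝ)).symm.trans
    (((radial x).prodCongr (rotInv (φ x))).trans
      (splitFin (by unfold rk; omega : i + 1 + k = rk i k)).symm)

theorem continuous_twistedFraming {i k : ℕ} {P : Type} [TopologicalSpace P]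
    (φ : P → (Mfd.sphere i).carrier → Matrix.specialOrthogonalGroup (Fin k) ℝ)
    (hφ : Continuous fun z : P × (Mfd.sphere i).carrier => φ z.1 z.2) :
    Continuous fun z : P × (TangentBundle (𝓡 i) (Mfd.sphere i).carrier × (ℝ × (Fin k → ℝ))) =>
      twistedFraming (φ z.1) z.2.1.1 (z.2.1.2, z.2.2) := by
  have hp : Continuous fun z : P × (TangentBundle (𝓡 i) (Mfd.sphere i).carrier ×
      (ℝ × (Fin k → ℝ))) => z.2.1 := continuous_fst.comp continuous_snd
  have hu : Continuous fun z : P × (TangentBundle (𝓡 i) (Mfd.sphere i).carrier ×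
      (ℝ × (Fin k → ℝ))) => z.2.2 := continuous_snd.comp continuous_snd
  have h1 : Continuous fun z : P × (TangentBundle (𝓡 i) (Mfd.sphere i).carrier ×
      (ℝ × (Fin k → ℝ))) => radial z.2.1.1 (z.2.1.2, z.2.2.1) :=
    Continuous.comp (g := fun p : TangentBundle (𝓡 i) (Mfd.sphere i).carrier × ℝ =>
      radial p.1.1 (p.1.2, p.2)) (continuous_radial i) (hp.prodMk (continuous_fst.comp hu))
  have h2 : Continuous fun z : P × (TangentBundle (𝓡 i) (Mfd.sphere i).carrier ×
      (ℝ × (Fin k → ℝ))) => z.2.1.1 :=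
    (FiberBundle.continuous_proj (EuclideanSpace ℝ (Fin i))
      (TangentSpace (𝓡 i) (M := (Mfd.sphere i).carrier))).comp hp
  have h3 : Continuous fun z : P × (TangentBundle (𝓡 i) (Mfd.sphere i).carrier ×
      (ℝ × (Fin k → ℝ))) => rotInv (φ z.1 z.2.1.1) z.2.2.2 := by
    have h4 : Continuous fun z : P × (TangentBundle (𝓡 i) (Mfd.sphere i).carrier ×
        (ℝ × (Fin k → ℝ))) => (φ z.1 z.2.1.1).1 :=
      continuous_subtype_val.comp (hφ.comp (continuous_fst.prodMk h2))
    exact h4.matrix_transpose.matrix_mulVec (continuous_snd.comp hu)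
  have h5 : Continuous (splitFin (by unfold rk; omega : i + 1 + k = rk i k)).symm :=
    LinearMap.continuous_of_finiteDimensional (LinearEquiv.toLinearMap _)
  exact h5.comp (h1.prodMk h3)

/-- The `⟨n⟩`-manifold given by the sphere with a twisted framing. -/
def twistedSphere {n : ℕ} (𝔅 : ConnectedCover n) {i k : ℕ}
    (φ : C((Mfd.sphere i).carrier, Matrix.specialOrthogonalGroup (Fin k) ℝ)) :
    ClosedStr 𝔅 i k where
  X := Mfd.sphere i
  str := TangStr.ofFraming 𝔅 (twistedFraming φ)
    (Continuous.comp (f := fun q => ((), q)) (continuous_twistedFraming (P := Unit) (fun _ => φ)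
      (φ.continuous.comp continuous_snd)) (Continuous.prodMk_right ()))

/-- The homotopy group `π_i(SO(k))`, as based homotopy classes of maps from the sphere. -/
def PiSO (i k : ℕ) : Type :=
  Quot fun φ ψ : {φ : C((Mfd.sphere i).carrier, Matrix.specialOrthogonalGroup (Fin k) ℝ) //
    φ (Mfd.basePt i) = 1} => ContinuousMap.HomotopicRel φ.1 ψ.1 {Mfd.basePt i}

/-- The `J`-homomorphism, in its geometric form, to framed bordism, followed by the map to
`⟨n⟩`-bordism. -/
def Jhom {n : ℕ} (𝔅 : ConnectedCover n) (i k : ℕ) : PiSO i k → Omega 𝔅 i k :=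
  Quot.lift (fun φ => Omega.mk (twistedSphere 𝔅 φ.1)) (by
    rintro φ ψ ⟨H⟩
    have key := ClosedStr.mk_eq_of_isHomotopy (X := Mfd.sphere i) (c := k)
      (fun t => (twistedSphere 𝔅 (H.toHomotopy.curry t)).str)
      ⟨continuous_const, (Frame.std (rk i k)).1.continuous_of_finiteDimensional.comp
        (continuous_twistedFraming (P := unitInterval) (fun t => H.toHomotopy.curry t)
          (by exact H.toHomotopy.continuous))⟩
    have h0 : H.toHomotopy.curry 0 = φ.1 := by ext1 x; simp
    have h1 : H.toHomotopy.curry 1 = ψ.1 := by ext1 x; simp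
    exact (congrArg (fun χ => Omega.mk (twistedSphere 𝔅 χ)) h0).symm.trans
      (key.trans (congrArg (fun χ => Omega.mk (twistedSphere 𝔅 χ)) h1)))

/-- An orientation of each tangent space of a manifold, locally constant in the trivialisations of
the tangent bundle. -/
structure Orient {d : ℕ} (X : Mfd d) where
  orient : ∀ x : X.carrier, Orientation ℝ (X.T x) (Fin d)
  locallyConst : ∀ x : X.carrier, ∀ᶠ y in 𝓝 x,
    ∀ hy : y ∈ (trivializationAt X.V (TangentSpace X.model) x).baseSet,
      Orientation.map (Fin d) ((trivializationAt X.V (TangentSpace X.model) x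
        ).continuousLinearEquivAt ℝ y hy).toLinearEquiv (orient y) =
      Orientation.map (Fin d) ((trivializationAt X.V (TangentSpace X.model) x
        ).continuousLinearEquivAt ℝ x (FiberBundle.mem_baseSet_trivializationAt' x)
        ).toLinearEquiv (orient x)

/-- The orientation of `TX ⊕ ℝ ⊕ ℝ^c` induced by the `⟨n⟩`-structure is that induced by `o`. -/
def TangStr.IsOriented {n : ℕ} {𝔅 : ConnectedCover n} {d c : ℕ} {X : Mfd d}
    (s : TangStr 𝔅 X (ℝ × (Fin c → ℝ)) (rk d c)) (o : Orient X) : Prop :=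
  ∀ (x : X.carrier) (b : Module.Basis (Fin d) ℝ (X.T x)), b.orientation = o.orient x →
    (s.lift x).1.2 = BSOm.mk ⟨s.gauss x ∘ₗ ((splitFin rfl).trans
        (b.equivFun.symm.prodCongr (splitOne c))).toLinearMap,
      (s.injective_gauss x).comp (LinearEquiv.injective _)⟩

/-- A smooth open embedding between manifolds of the same dimension. -/
structure IsSmoothOpenEmbedding {d : ℕ} (X Y : Mfd d) (f : X.carrier → Y.carrier) : Prop where
  smooth : ContMDiff X.model Y.model ∞ f
  isOpenEmbedding : IsOpenEmbedding f
  bijective : ∀ x, Bijective (mfderiv X.model Y.model f x)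

/-- An embedded disc in an oriented manifold `M`: an orientation preserving open embedding of `ℝ^d`
into `M`; the disc `D^d ⊆ M` itself is the image of the closed unit ball. -/
structure OrientedDisc {d : ℕ} (M : Mfd d) (o : Orient M) where
  toFun : EuclideanSpace ℝ (Fin d) → M.carrier
  embedding : IsSmoothOpenEmbedding (Mfd.euclid d) M toFun
  oriented : ∀ x, Orientation.map (Fin d)
    (LinearEquiv.ofBijective (mfderiv (𝓡 d) M.model toFun x).toLinearMap (embedding.bijective x))
      (EuclideanSpace.basisFun (Fin d) ℝ).toBasis.orientation = o.orient (toFun x)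

/-- A smooth fibre bundle over `S^i` (a proper submersion) with fibre `M` over the base point and
with a trivialised `D^d`-subbundle `S^i × D^d`, which over the base point is the disc in `M`. The
embedding of `S^i × D^d` is extended to `S^i × ℝ^d`. -/
structure DiscBundle {d : ℕ} (M : Mfd d) (e : EuclideanSpace ℝ (Fin d) → M.carrier) (i : ℕ) :
    Type 1 where
  tot : Mfd (i + d)
  [compact : CompactSpace tot.carrier]
  proj : tot.carrier → (Mfd.sphere i).carrier
  smooth_proj : ContMDiff tot.model (𝓡 i) ∞ proj
  submersion : ∀ z, Surjective (mfderiv tot.model (𝓡 i) proj z)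
  disc : (Mfd.sphere i).carrier × EuclideanSpace ℝ (Fin d) → tot.carrier
  embedding : IsSmoothOpenEmbedding (Mfd.prod rfl (Mfd.sphere i) (Mfd.euclid d)) tot disc
  proj_disc : ∀ s x, proj (disc (s, x)) = s
  fib : M.carrier → tot.carrier
  smooth_fib : ContMDiff M.model tot.model ∞ fib
  injective_fib : Injective fib
  immersion_fib : ∀ x, Injective (mfderiv M.model tot.model fib x)
  range_fib : Set.range fib = proj ⁻¹' {Mfd.basePt i}
  fib_disc : ∀ x, ‖x‖ ≤ 1 → fib (e x) = disc (Mfd.basePt i, x)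

attribute [instance] DiscBundle.compact

/-- Isomorphisms of bundles with fibre `M` over the base point and with trivialised disc bundle. -/
structure DiscBundle.Iso {d i : ℕ} {M : Mfd d} {e : EuclideanSpace ℝ (Fin d) → M.carrier}
    (E E' : DiscBundle M e i) where
  diffeo : Diffeomorph E.tot.model E'.tot.model E.tot.carrier E'.tot.carrier ∞
  proj : ∀ z, E'.proj (diffeo z) = E.proj z
  disc : ∀ s x, ‖x‖ ≤ 1 → diffeo (E.disc (s, x)) = E'.disc (s, x)
  fib : ∀ x, diffeo (E.fib x) = E'.fib x

/-- The homotopy group `π_i(BDiff(M, D^d))`, as isomorphism classes of the bundles over `S^i` which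
its elements classify. -/
def PiBDiff {d : ℕ} (M : Mfd d) (e : EuclideanSpace ℝ (Fin d) → M.carrier) (i : ℕ) : Type 1 :=
  Quot fun E E' : DiscBundle M e i => Nonempty (E.Iso E')

/-- The isomorphism class of a bundle. -/
def PiBDiff.mk {d i : ℕ} {M : Mfd d} {e : EuclideanSpace ℝ (Fin d) → M.carrier}
    (E : DiscBundle M e i) : PiBDiff M e i :=
  Quot.mk _ E

/-- A smooth based map `S^i → SO(k)`, representing an element of `π_i(SO(k))`. -/
structure SmoothSO (i k : ℕ) where
  toFun : C((Mfd.sphere i).carrier, Matrix.specialOrthogonalGroup (Fin k) ℝ)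
  based : toFun (Mfd.basePt i) = 1
  smooth : ∀ a b, ContMDiff (𝓡 i) 𝓘(ℝ, ℝ) ∞ fun x => (toFun x).1 a b

/-- The element of `π_i(SO(k))` represented by a smooth map. -/
def SmoothSO.toPiSO {i k : ℕ} (φ : SmoothSO i k) : PiSO i k := Quot.mk _ ⟨φ.toFun, φ.based⟩

/-- The action of `A` on Euclidean space. -/
def rotE {k : ℕ} (A : Matrix (Fin k) (Fin k) ℝ) (x : EuclideanSpace ℝ (Fin k)) :
    EuclideanSpace ℝ (Fin k) :=
  WithLp.toLp 2 (Matrix.mulVec A x.ofLp)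

theorem contMDiff_rotE {i k : ℕ} (A : (Mfd.sphere i).carrier → Matrix (Fin k) (Fin k) ℝ)
    (hA : ∀ a b, ContMDiff (𝓡 i) 𝓘(ℝ, ℝ) ∞ fun x => A x a b) :
    ContMDiff ((𝓡 i).prod (𝓡 k)) ((𝓡 i).prod (𝓡 k)) ∞
      fun z : (Mfd.sphere i).carrier × EuclideanSpace ℝ (Fin k) => (z.1, rotE (A z.1) z.2) := by
  refine contMDiff_fst.prodMk ?_
  have h0 : ∀ b, ContMDiff ((𝓡 i).prod (𝓡 k)) 𝓘(ℝ, ℝ) ∞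
      fun z : (Mfd.sphere i).carrier × EuclideanSpace ℝ (Fin k) => z.2 b := fun b =>
    ((EuclideanSpace.proj (𝕜 := ℝ) (ι := Fin k) b).contDiff.contMDiff).comp
      contMDiff_snd
  have h1 : ContMDiff ((𝓡 i).prod (𝓡 k)) 𝓘(ℝ, Fin k → ℝ) ∞
      fun z : (Mfd.sphere i).carrier × EuclideanSpace ℝ (Fin k) =>
        Matrix.mulVec (A z.1) z.2.ofLp := by
    refine contMDiff_pi_space.2 fun a => ?_
    change ContMDiff ((𝓡 i).prod (𝓡 k)) 𝓘(ℝ, ℝ) ∞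
      fun z : (Mfd.sphere i).carrier × EuclideanSpace ℝ (Fin k) => ∑ b, A z.1 a b * z.2 b
    exact contMDiff_finsetSum fun b _ => ((hA a b).comp contMDiff_fst).mul (h0 b)
  exact ((PiLp.continuousLinearEquiv 2 ℝ (fun _ : Fin k => ℝ)).symm.contDiff.contMDiff).comp h1

theorem rotE_rotE {k : ℕ} {A A' : Matrix (Fin k) (Fin k) ℝ} (h : A * A' = 1)
    (x : EuclideanSpace ℝ (Fin k)) : rotE A (rotE A' x) = x := by
  simp [rotE, Matrix.mulVec_mulVec, h]

/-- The diffeomorphism `(s, x) ↦ (s, φ(s) x)` of `S^i × ℝ^k`. -/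
def SmoothSO.diffeo {i k : ℕ} (φ : SmoothSO i k) :
    Diffeomorph ((𝓡 i).prod (𝓡 k)) ((𝓡 i).prod (𝓡 k))
      ((Mfd.sphere i).carrier × EuclideanSpace ℝ (Fin k))
      ((Mfd.sphere i).carrier × EuclideanSpace ℝ (Fin k)) ∞ where
  toFun z := (z.1, rotE (φ.toFun z.1).1 z.2)
  invFun z := (z.1, rotE (φ.toFun z.1).1.transpose z.2)
  left_inv z := Prod.ext rfl (rotE_rotE ((Matrix.mem_orthogonalGroup_iff' (Fin k) ℝ).1
      (Matrix.mem_specialOrthogonalGroup_iff.1 (φ.toFun z.1).2).1) z.2)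
  right_inv z := Prod.ext rfl (rotE_rotE ((Matrix.mem_orthogonalGroup_iff (Fin k) ℝ).1
      (Matrix.mem_specialOrthogonalGroup_iff.1 (φ.toFun z.1).2).1) z.2)
  contMDiff_toFun := contMDiff_rotE _ φ.smooth
  contMDiff_invFun := contMDiff_rotE _ fun a b => φ.smooth b a

theorem IsSmoothOpenEmbedding.twist {d i : ℕ} {M : Mfd d} {f : EuclideanSpace ℝ (Fin d) → M.carrier}
    (hf : IsSmoothOpenEmbedding (Mfd.euclid d) M f) (φ : SmoothSO i d) :
    IsSmoothOpenEmbedding (Mfd.prod rfl (Mfd.sphere i) (Mfd.euclid d))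
      (Mfd.prod rfl (Mfd.sphere i) M) fun z => (z.1, f (rotE (φ.toFun z.1).1 z.2)) := by
  have h1 : ContMDiff ((𝓡 i).prod (𝓡 d)) ((𝓡 i).prod M.model) ∞
      (Prod.map (id : (Mfd.sphere i).carrier → (Mfd.sphere i).carrier) f) :=
    contMDiff_id.prodMap hf.smooth
  refine ⟨h1.comp φ.diffeo.contMDiff,
    (IsOpenEmbedding.id.prodMap hf.isOpenEmbedding).comp φ.diffeo.toHomeomorph.isOpenEmbedding,
    fun z => ?_⟩
  have h2 : mfderiv ((𝓡 i).prod (𝓡 d)) ((𝓡 i).prod M.model)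
      (Prod.map (id : (Mfd.sphere i).carrier → (Mfd.sphere i).carrier) f ∘ φ.diffeo) z =
      (mfderiv ((𝓡 i).prod (𝓡 d)) ((𝓡 i).prod M.model)
        (Prod.map (id : (Mfd.sphere i).carrier → (Mfd.sphere i).carrier) f) (φ.diffeo z)).comp
      (mfderiv ((𝓡 i).prod (𝓡 d)) ((𝓡 i).prod (𝓡 d)) φ.diffeo z) :=
    mfderiv_comp z (h1.mdifferentiableAt (by simp))
      (φ.diffeo.contMDiff.mdifferentiableAt (by simp))
  have h3 : mfderiv ((𝓡 i).prod (𝓡 d)) ((𝓡 i).prod M.model)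
      (Prod.map (id : (Mfd.sphere i).carrier → (Mfd.sphere i).carrier) f) (φ.diffeo z) =
      (mfderiv (𝓡 i) (𝓡 i) id (φ.diffeo z).1).prodMap
        (mfderiv (𝓡 d) M.model f (φ.diffeo z).2) :=
    mfderiv_prodMap mdifferentiableAt_id (hf.smooth.mdifferentiableAt (by simp))
  have h4 : Bijective ((mfderiv (𝓡 i) (𝓡 i) (id : (Mfd.sphere i).carrier → _)
      (φ.diffeo z).1).prodMap (mfderiv (𝓡 d) M.model f (φ.diffeo z).2)) := by
    rw [mfderiv_id]
    exact bijective_id.prodMap (hf.bijective _)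
  rw [← h3] at h4
  have h5 : Bijective (mfderiv ((𝓡 i).prod (𝓡 d)) ((𝓡 i).prod (𝓡 d)) φ.diffeo z) := by
    rw [← φ.diffeo.mfderivToContinuousLinearEquiv_coe (by simp)]
    exact (φ.diffeo.mfderivToContinuousLinearEquiv (by simp) z).bijective
  exact (congrArg Bijective (congrArg DFunLike.coe h2)).mpr (h4.comp h5)

/-- `E` represents the image of the class of `φ` under the map `t_* : π_i(SO(d)) → π_i(BDiff(M, D^d))`
induced by the collar twist, that is, by looping the fibre sequence
`BDiff(M, D^d) → BDiff⁺(M, *) → BSO(d)`. Here the first map replaces the disc bundle by its centre,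
with fibre `e 0`, and the second one takes the vertical tangent bundle along the centre, which the
disc bundle trivialises. So `E` is trivial as a bundle with a section, and compared to the
trivialisation of the vertical tangent bundle along the section so obtained, that given by the disc
bundle is `φ`. -/
def DiscBundle.IsCollarTwist {d i : ℕ} {M : Mfd d} {o : Orient M} (e : OrientedDisc M o)
    (φ : SmoothSO i d) (E : DiscBundle M e.toFun i) : Prop :=
  ∃ g : Diffeomorph E.tot.model ((𝓡 i).prod M.model) E.tot.carrier
      ((Mfd.sphere i).carrier × M.carrier) ∞,
    (∀ z, (g z).1 = E.proj z) ∧ (∀ x, g (E.fib x) = (Mfd.basePt i, x)) ∧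
    ∀ s, g (E.disc (s, 0)) = (s, e.toFun 0) ∧ ∀ w : EuclideanSpace ℝ (Fin d),
      (mfderiv (𝓡 d) M.model (fun x => (g (E.disc (s, x))).2) 0 w : M.V) =
        mfderiv (𝓡 d) M.model e.toFun 0 (rotE (φ.toFun s).1 w)

/-- The collar twist on representatives: the trivial `M`-bundle over `S^i`, in which the disc bundle
`S^i × D^d → S^i × M` is twisted by `φ`. -/
def collarTwist {d i : ℕ} {M : Mfd d} [CompactSpace M.carrier] {o : Orient M}
    (e : OrientedDisc M o) (φ : SmoothSO i d) : DiscBundle M e.toFun i where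
  tot := Mfd.prod rfl (Mfd.sphere i) M
  compact := inferInstanceAs (CompactSpace ((Mfd.sphere i).carrier × M.carrier))
  proj := Prod.fst
  smooth_proj := contMDiff_fst
  submersion z v := by
    have h := mfderiv_fst (I := 𝓡 i) (I' := M.model) (M := (Mfd.sphere i).carrier)
      (M' := M.carrier) (x := z)
    exact ⟨(v, 0), congrArg (fun A => A (v, 0)) h⟩
  disc z := (z.1, e.toFun (rotE (φ.toFun z.1).1 z.2))
  embedding := e.embedding.twist φ
  proj_disc s x := rfl
  fib x := (Mfd.basePt i, x)
  smooth_fib := contMDiff_const.prodMk contMDiff_id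
  injective_fib x y h := congrArg Prod.snd h
  immersion_fib x := by
    have h : HasMFDerivAt M.model ((𝓡 i).prod M.model)
        (fun x : M.carrier => (Mfd.basePt i, x)) x
          ((0 : M.T x →L[ℝ] (Mfd.sphere i).T (Mfd.basePt i)).prod
            (ContinuousLinearMap.id ℝ (M.T x))) :=
      (hasMFDerivAt_const _ x).prodMk (hasMFDerivAt_id x)
    intro v w hvw
    have h1 := h.mfderiv
    exact (congrArg (fun A => (A v).2) h1).symm.trans
      ((congrArg Prod.snd hvw).trans (congrArg (fun A => (A w).2) h1))
  range_fib := by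
    ext z
    constructor
    · rintro ⟨x, rfl⟩
      rfl
    · intro hz
      exact ⟨z.2, Prod.ext hz.symm rfl⟩
  fib_disc x _ := by
    refine Prod.ext rfl (congrArg e.toFun ?_)
    simp [φ.based, rotE]

theorem collarTwist_isCollarTwist {d i : ℕ} {M : Mfd d} [CompactSpace M.carrier] {o : Orient M}
    (e : OrientedDisc M o) (φ : SmoothSO i d) : (collarTwist e φ).IsCollarTwist e φ := by
  have h0 : ∀ s, rotE (φ.toFun s).1 0 = 0 := fun s => by simp [rotE]
  refine ⟨Diffeomorph.refl _ _ _, fun z => rfl, fun x => rfl, fun s => ⟨?_, fun w => ?_⟩⟩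
  · exact Prod.ext rfl (congrArg e.toFun (h0 s))
  · let L : EuclideanSpace ℝ (Fin d) →L[ℝ] EuclideanSpace ℝ (Fin d) :=
      LinearMap.toContinuousLinearMap
        { toFun := rotE (φ.toFun s).1
          map_add' := fun x y => by simp [rotE, Matrix.mulVec_add]
          map_smul' := fun r x => by simp [rotE, Matrix.mulVec_smul] }
    have h1 : HasMFDerivAt (𝓡 d) (𝓡 d) (rotE (φ.toFun s).1) 0 L := L.hasMFDerivAt
    have h2 : HasMFDerivAt (𝓡 d) M.model e.toFun (rotE (φ.toFun s).1 0)
        (mfderiv (𝓡 d) M.model e.toFun (rotE (φ.toFun s).1 0)) :=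
      (e.embedding.smooth.mdifferentiableAt (by simp)).hasMFDerivAt
    have h3 := (h2.comp 0 h1).mfderiv
    have h4 : (mfderiv (𝓡 d) M.model e.toFun (rotE (φ.toFun s).1 0) (rotE (φ.toFun s).1 w) : M.V) =
        mfderiv (𝓡 d) M.model e.toFun 0 (rotE (φ.toFun s).1 w) := by
      rw [h0 s]
    exact (congrArg (fun A => A w) h3).trans h4

/-- The standard isomorphism `TS^i ⊕ (ℝ^d ⊕ (ℝ ⊕ ℝ^c)) ≅ (TS^i ⊕ ℝ) ⊕ ℝ^d ⊕ ℝ^c ≅ ℝ^{i+1+d+c}`. -/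
def stdFraming {i d c : ℕ} (x : (Mfd.sphere i).carrier) :
    ((Mfd.sphere i).T x × (EuclideanSpace ℝ (Fin d) × (ℝ × (Fin c → ℝ)))) ≃ₗ[ℝ]
      (Fin (rk (i + d) c) → ℝ) :=
  let swap : (EuclideanSpace ℝ (Fin d) × (ℝ × (Fin c → ℝ))) ≃ₗ[ℝ]
      (ℝ × ((Fin d → ℝ) × (Fin c → ℝ))) :=
    (((WithLp.linearEquiv 2 ℝ (Fin d → ℝ)).prodCongr (LinearEquiv.refl ℝ _)).trans
      (LinearEquiv.prodAssoc ℝ _ _ _).symm).trans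
    (((LinearEquiv.prodComm ℝ _ _).prodCongr (LinearEquiv.refl ℝ _)).trans
      (LinearEquiv.prodAssoc ℝ _ _ _))
  ((LinearEquiv.refl ℝ ((Mfd.sphere i).T x)).prodCongr swap).trans
    ((LinearEquiv.prodAssoc ℝ ((Mfd.sphere i).T x) ℝ _).symm.trans
      (((radial x).prodCongr (splitFin rfl).symm).trans
        (splitFin (by unfold rk; omega : i + 1 + (d + c) = rk (i + d) c)).symm))

theorem continuous_stdFraming (i d c : ℕ) :
    Continuous fun z : TangentBundle (𝓡 i) (Mfd.sphere i).carrier ×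
        (EuclideanSpace ℝ (Fin d) × (ℝ × (Fin c → ℝ))) => stdFraming z.1.1 (z.1.2, z.2) := by
  have h1 : Continuous fun z : TangentBundle (𝓡 i) (Mfd.sphere i).carrier ×
      (EuclideanSpace ℝ (Fin d) × (ℝ × (Fin c → ℝ))) => radial z.1.1 (z.1.2, z.2.2.1) :=
    Continuous.comp (g := fun p : TangentBundle (𝓡 i) (Mfd.sphere i).carrier × ℝ =>
      radial p.1.1 (p.1.2, p.2)) (continuous_radial i)
      (continuous_fst.prodMk (continuous_fst.comp (continuous_snd.comp continuous_snd)))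
  have h2 : Continuous (splitFin (rfl : d + c = d + c)).symm :=
    LinearMap.continuous_of_finiteDimensional (LinearEquiv.toLinearMap _)
  have h3 : Continuous (splitFin (by unfold rk; omega : i + 1 + (d + c) = rk (i + d) c)).symm :=
    LinearMap.continuous_of_finiteDimensional (LinearEquiv.toLinearMap _)
  have h4 : Continuous fun z : TangentBundle (𝓡 i) (Mfd.sphere i).carrier ×
      (EuclideanSpace ℝ (Fin d) × (ℝ × (Fin c → ℝ))) =>
        ((z.2.1.ofLp, z.2.2.2) : (Fin d → ℝ) × (Fin c → ℝ)) :=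
    ((PiLp.continuous_ofLp 2 _).comp (continuous_fst.comp continuous_snd)).prodMk
      (continuous_snd.comp (continuous_snd.comp continuous_snd))
  exact h3.comp (h1.prodMk (h2.comp h4))

/-- A `⟨n⟩`-structure `s` on the total space extends the canonical one on `S^i`: restricted to
`S^i × 0 ⊆ S^i × D^d`, where the disc bundle trivialises the normal bundle of `S^i`, it is
homotopic to the structure induced by the standard stable framing of `S^i`. -/
def DiscBundle.ExtendsStandard {n : ℕ} {𝔅 : ConnectedCover n} {d i c : ℕ} {M : Mfd d}
    {e : EuclideanSpace ℝ (Fin d) → M.carrier} (E : DiscBundle M e i)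
    (s : TangStr 𝔅 E.tot (ℝ × (Fin c → ℝ)) (rk (i + d) c)) : Prop :=
  ∃ h : unitInterval → TangStr 𝔅 (Mfd.sphere i) (EuclideanSpace ℝ (Fin d) × (ℝ × (Fin c → ℝ)))
      (rk (i + d) c),
    TangStr.IsHomotopy h ∧
    (∀ x, (h 0).lift x = s.lift (E.disc (x, 0)) ∧
      ∀ (v : (Mfd.sphere i).T x) (w : EuclideanSpace ℝ (Fin d)) (u : ℝ × (Fin c → ℝ)),
        (h 0).gauss x (v, (w, u)) = s.gauss (E.disc (x, 0))
          (mfderiv ((𝓡 i).prod (𝓡 d)) E.tot.model E.disc (x, 0) (v, w), u)) ∧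
    h 1 = TangStr.ofFraming 𝔅 stdFraming (continuous_stdFraming i d c)

/-- The map `Φ_i : π_i(BDiff(M, D^d)) → Ω_{d+i}^{⟨n⟩}`, which sends a bundle to the bordism class of
its total space with the `⟨n⟩`-structure extending the canonical one on `S^i`. It is given here as a
relation: `Phi 𝔅 M e i c x` is the set of all values so obtained from representatives of `x` and
such structures. -/
def Phi {n : ℕ} (𝔅 : ConnectedCover n) {d i : ℕ} {M : Mfd d}
    {e : EuclideanSpace ℝ (Fin d) → M.carrier} (c : ℕ) (x : PiBDiff M e i) :
    Set (Omega 𝔅 (i + d) c) :=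
  {y | ∃ E : DiscBundle M e i, PiBDiff.mk E = x ∧
    ∃ s : TangStr 𝔅 E.tot (ℝ × (Fin c → ℝ)) (rk (i + d) c),
      E.ExtendsStandard s ∧ y = Omega.mk ⟨E.tot, s⟩}

end

/-! A bundle in a class of the image of `t_*` is diffeomorphic over `S^i` to `S^i × M`, with the
centres of the discs at `S^i × {e 0}` and with their normal framing twisted by `φ`. Give `S^i` the
structure of the framing twisted by `φ`, and `M` the structure `ℓ`. The product structure, pulled
back to the total space `E`, has bordism class `J(φ) · [M, ℓ]`, since diffeomorphic `⟨n⟩`-manifolds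
are the two ends of a cylinder (`ClosedStr.mk_pullbackDiffeo`). It remains to see that this
structure is admissible in the definition of `Φ_i`, and that all admissible structures on `E` are
homotopic.

Admissibility (`DiscBundle.extendsStandard_prod`). Along the centres the product structure is given
by a framing in which the normal summand `ℝ^d` is twisted by `φ` and a stabilising summand `ℝ^d` by
`φ⁻¹`. The automorphism `φ ⊕ φ⁻¹` is homotopic to the identity by rotations (`shear`). The two
summands appear in the wrong order, but their exchange preserves orientations because `d = 2n` is
even. What is left is a choice of a frame in `ℝ^ℕ` and of a constant lift to `BO⟨n⟩`. This choice is
immaterial (`TangStr.homotopic_ofFraming`), since the space of frames is contractible and the fibre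
of `θ` over the base point is path connected.

Uniqueness (`TangStr.homotopic_of_pullback`). Take two structures on `S^i × M` whose restrictions to
`S^i × m₀` are homotopic. Their Gauss maps can be made equal, as the injective linear maps to `ℝ^ℕ`
form a contractible space (`blend`). The orientations then agree because `S^i × M` is connected.
Left are two lifts of one map to `BSO`. The homotopy of the fibre of `θ` vanishes in degrees `≥ n`
(`ConnectedCover.hasLift_boxBd`), while, `M` being `(n-1)`-connected, `S^i × M` arises from `S^i ×
m₀` up to homotopy by attaching cells of dimension `≥ n`. So no obstruction occurs
(`CubRetract.lift_unique`).

The obstruction theory does not need a cell structure on the manifolds. A closed manifold is a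
retract of a finite complex of lattice cubes (`Mfd.nonempty_cubRetract`), and lifts are built there
cube by cube (`Face.hasLift_support`). The fibre of `θ` is path connected because `BSO` is simply
connected; in place of that fact, `ConnectedCover.Reach` follows lifts of paths of frames, using
that frames are contractible, that `GL⁺` is connected, and that `BSO` contracts locally along paths
of frames. -/

/-! ### Lifting problems and Serre fibrations -/

noncomputable section

section Lifting

variable {E B Z Z' T : Type*} [TopologicalSpace E] [TopologicalSpace B] [TopologicalSpace Z]
  [TopologicalSpace Z'] [TopologicalSpace T] {p : E → B}

/-- The relative lifting property of `p : E → B` for the pair `A ⊆ X` of subsets of `Z`. -/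
def HasLift (p : E → B) (X A : Set Z) : Prop :=
  ∀ (u : Z → B) (a : Z → E), ContinuousOn u X → ContinuousOn a A → (∀ z ∈ A, p (a z) = u z) →
    ∃ v : Z → E, ContinuousOn v X ∧ Set.EqOn v a A ∧ ∀ z ∈ X, p (v z) = u z

theorem HasLift.refl (X : Set Z) : HasLift p X X :=
  fun _ a _ ha h => ⟨a, ha, fun _ _ => rfl, h⟩

theorem HasLift.trans {X Y A : Set Z} (h1 : HasLift p X Y) (h2 : HasLift p Y A)
    (hAY : A ⊆ Y) (hYX : Y ⊆ X) : HasLift p X A := by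
  intro u a hu ha h
  obtain ⟨v, hv, hva, hvu⟩ := h2 u a (hu.mono hYX) ha h
  obtain ⟨w, hw, hwv, hwu⟩ := h1 u v hu hv hvu
  exact ⟨w, hw, fun z hz => (hwv (hAY hz)).trans (hva hz), hwu⟩

/-- Attaching `X` to `Y` along `A`. -/
theorem HasLift.union {X Y A : Set Z} (h : HasLift p X A) (hX : IsClosed X) (hY : IsClosed Y)
    (hA : A ⊆ X ∩ Y) (hXY : X ∩ Y ⊆ A) : HasLift p (X ∪ Y) Y := by
  classical
  intro u a hu ha hau
  obtain ⟨v, hv, hva, hvu⟩ := h u a (hu.mono Set.subset_union_left)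
    (ha.mono fun z hz => (hA hz).2) fun z hz => hau z (hA hz).2
  let w : Z → E := fun z => if z ∈ Y then a z else v z
  have hwY : Set.EqOn w a Y := fun z hz => if_pos hz
  have hwX : Set.EqOn w v X := fun z hz => by
    by_cases hzY : z ∈ Y
    · exact (if_pos hzY).trans (hva (hXY ⟨hz, hzY⟩)).symm
    · exact if_neg hzY
  refine ⟨w, (hv.congr hwX).union_of_isClosed (ha.congr hwY) hX hY, hwY, ?_⟩
  rintro z (hz | hz)
  · rw [hwX hz, hvu z hz]
  · rw [hwY hz, hau z hz]

/-- The problem is pulled back along `r`, solved there, and the solution restricted along `i`. Every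
later change of model (ball, cube, box, cell, manifold) is an instance. -/
theorem HasLift.of_retract {X A : Set Z} {X' A' : Set Z'} (h : HasLift p X' A')
    (i : Z → Z') (r : Z' → Z) (hi : ContinuousOn i X) (hr : ContinuousOn r X')
    (hiX : Set.MapsTo i X X') (hrX : Set.MapsTo r X' X)
    (hiA : Set.MapsTo i A A') (hrA : Set.MapsTo r A' A) (hAX : A' ⊆ X')
    (hri : ∀ z ∈ X, r (i z) = z) (hAX' : A ⊆ X) : HasLift p X A := by
  intro u a hu ha hau
  obtain ⟨v, hv, hva, hvu⟩ := h (u ∘ r) (a ∘ r) (hu.comp hr hrX) (ha.comp (hr.mono hAX) hrA)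
    fun z hz => hau _ (hrA hz)
  refine ⟨v ∘ i, hv.comp hi hiX, fun z hz => ?_, fun z hz => ?_⟩
  · exact (hva (hiA hz)).trans (congrArg a (hri z (hAX' hz)))
  · exact (hvu _ (hiX hz)).trans (congrArg u (hri z hz))

/-- The homotopy lifting property of `p` for the subset `X`. -/
def HLP (p : E → B) (X : Set Z) : Prop :=
  HasLift p (X ×ˢ Set.Icc (0 : ℝ) 1) (X ×ˢ {(0 : ℝ)})

theorem prod_zero_subset {Z : Type*} (X : Set Z) : X ×ˢ {(0 : ℝ)} ⊆ X ×ˢ Set.Icc (0 : ℝ) 1 :=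
  Set.prod_mono le_rfl (by simp)

theorem HLP.of_retract {X : Set Z} {X' : Set Z'} (h : HLP p X')
    (i : Z → Z') (r : Z' → Z) (hi : ContinuousOn i X) (hr : ContinuousOn r X')
    (hiX : Set.MapsTo i X X') (hrX : Set.MapsTo r X' X) (hri : ∀ z ∈ X, r (i z) = z) : HLP p X :=
  HasLift.of_retract h (Prod.map i id) (Prod.map r id)
    (hi.prodMap continuousOn_id) (hr.prodMap continuousOn_id)
    (hiX.prodMap (Set.mapsTo_id _)) (hrX.prodMap (Set.mapsTo_id _))
    (hiX.prodMap (Set.mapsTo_id _)) (hrX.prodMap (Set.mapsTo_id _))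
    (prod_zero_subset _) (fun _ hz => Prod.ext (hri _ hz.1) rfl) (prod_zero_subset _)

/-- `p` is a Serre fibration. -/
def Serre (p : E → B) : Prop :=
  ∀ k : ℕ, HLP p (Set.Icc (0 : Fin k → ℝ) 1)

/-- A lift along the map to a point is just an extension. The relative lifting lemmas for Serre
fibrations, applied to this map, therefore become homotopy extension properties. -/
theorem serre_const : Serre (fun _ : E => ()) := by
  intro k u a _ ha _
  refine ⟨fun z => a (z.1, 0), ?_, ?_, fun _ _ => rfl⟩
  · exact ha.comp (by fun_prop) fun z hz => ⟨hz.1, rfl⟩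
  · rintro ⟨z, t⟩ ⟨_, ht⟩
    have h : t = 0 := ht
    subst h
    rfl

theorem Serre.cube (hp : Serre p) (κ : Type*) [Fintype κ] : HLP p (Set.Icc (0 : κ → ℝ) 1) := by
  let e := Fintype.equivFin κ
  refine (hp (Fintype.card κ)).of_retract (fun x j => x (e.symm j)) (fun x j => x (e j))
    (by fun_prop) (by fun_prop) (fun x hx => ⟨fun j => hx.1 _, fun j => hx.2 _⟩)
    (fun x hx => ⟨fun j => hx.1 _, fun j => hx.2 _⟩) fun x _ => by ext j; simp

/-! ### Relative homotopy lifting for a ball and its boundary. -/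

section Ball

variable {V : Type*} [NormedAddCommGroup V]

/-- The factor by which the radial projection from `(0, 2)` of the cylinder `D × [0, 1]` onto
`∂D × [0, 1] ∪ D × {0}` stretches. -/
def stretch (z : V × ℝ) : ℝ := (max ((2 - z.2) / 2) ‖z.1‖)⁻¹

theorem stretch_bounds {z : V × ℝ} (hz : z ∈ closedBall (0 : V) 1 ×ˢ Set.Icc (0 : ℝ) 1) :
    1 ≤ stretch z ∧ stretch z ≤ 2 ∧ stretch z * ‖z.1‖ ≤ 1 ∧ stretch z * (2 - z.2) ≤ 2 := by
  obtain ⟨h1, h2, h3⟩ := hz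
  rw [mem_closedBall_zero_iff] at h1
  have hl := le_max_left ((2 - z.2) / 2) ‖z.1‖
  have hr := le_max_right ((2 - z.2) / 2) ‖z.1‖
  have hm : max ((2 - z.2) / 2) ‖z.1‖ ≤ 1 := max_le (by linarith) h1
  have hpos : 0 < max ((2 - z.2) / 2) ‖z.1‖ := by linarith
  unfold stretch
  refine ⟨(one_le_inv₀ hpos).2 hm, ?_, ?_, ?_⟩
  · rw [inv_le_comm₀ hpos (by norm_num)]; linarith
  · rw [inv_mul_le_iff₀ hpos]; linarith
  · rw [inv_mul_le_iff₀ hpos]; linarith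

theorem stretch_eq_one {z : V × ℝ} (hz : z ∈ closedBall (0 : V) 1 ×ˢ Set.Icc (0 : ℝ) 1)
    (h : ‖z.1‖ = 1 ∨ z.2 = 0) : stretch z = 1 := by
  obtain ⟨h1, h2, h3⟩ := hz
  rw [mem_closedBall_zero_iff] at h1
  unfold stretch
  rw [inv_eq_one]
  rcases h with h | h
  · rw [h]; exact max_eq_right (by linarith)
  · rw [h]; rw [max_eq_left (by linarith)]; norm_num

theorem stretch_proj {z : V × ℝ} (hz : z ∈ closedBall (0 : V) 1 ×ˢ Set.Icc (0 : ℝ) 1) :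
    stretch z * ‖z.1‖ = 1 ∨ 2 - stretch z * (2 - z.2) = 0 := by
  obtain ⟨h1, h2, h3⟩ := hz
  unfold stretch
  rcases le_total ((2 - z.2) / 2) ‖z.1‖ with h | h
  · left; rw [max_eq_right h]; exact inv_mul_cancel₀ (by linarith)
  · right; rw [max_eq_left h]; field_simp [show 2 - z.2 ≠ 0 by linarith]; ring

theorem continuousOn_stretch :
    ContinuousOn (stretch (V := V)) (closedBall (0 : V) 1 ×ˢ Set.Icc (0 : ℝ) 1) := by
  refine ContinuousOn.inv₀ (by fun_prop) fun z hz => ?_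
  have hl := le_max_left ((2 - z.2) / 2) ‖z.1‖
  have := hz.2.2
  exact ne_of_gt (by linarith)

variable [NormedSpace ℝ V]

/-- Movement towards the projection onto `∂D × [0, 1] ∪ D × {0}`. -/
def pushOut (z : V × ℝ) (τ : ℝ) : V × ℝ :=
  (max 1 (stretch z - τ) • z.1, 2 - max 1 (stretch z - τ) * (2 - z.2))

theorem pushOut_mem {z : V × ℝ} (hz : z ∈ closedBall (0 : V) 1 ×ˢ Set.Icc (0 : ℝ) 1) {τ : ℝ}
    (hτ : 0 ≤ τ) : pushOut z τ ∈ closedBall (0 : V) 1 ×ˢ Set.Icc (0 : ℝ) 1 := by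
  obtain ⟨h1, h2, h3, h4⟩ := stretch_bounds hz
  have hl : max 1 (stretch z - τ) ≤ stretch z := max_le h1 (by linarith)
  have hl1 : 1 ≤ max 1 (stretch z - τ) := le_max_left _ _
  have := hz.2.1
  have := hz.2.2
  refine ⟨?_, ?_, ?_⟩
  · rw [mem_closedBall_zero_iff, pushOut, norm_smul, Real.norm_of_nonneg (by linarith)]
    exact (mul_le_mul_of_nonneg_right hl (norm_nonneg _)).trans h3
  · change 0 ≤ 2 - _ * _
    nlinarith [mul_le_mul_of_nonneg_right hl (by linarith : (0 : ℝ) ≤ 2 - z.2)]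
  · change 2 - _ * _ ≤ 1
    nlinarith [mul_le_mul_of_nonneg_right hl1 (by linarith : (0 : ℝ) ≤ 2 - z.2)]

theorem pushOut_zero_mem {z : V × ℝ} (hz : z ∈ closedBall (0 : V) 1 ×ˢ Set.Icc (0 : ℝ) 1) :
    pushOut z 0 ∈ sphere (0 : V) 1 ×ˢ Set.Icc (0 : ℝ) 1 ∪ closedBall (0 : V) 1 ×ˢ {(0 : ℝ)} := by
  have h1 := (stretch_bounds hz).1
  have h := pushOut_mem hz le_rfl
  have hm : max 1 (stretch z - 0) = stretch z := by rw [sub_zero, max_eq_right h1]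
  rcases stretch_proj hz with h2 | h2
  · left
    refine ⟨?_, h.2⟩
    rw [mem_sphere_zero_iff_norm, pushOut, hm, norm_smul, Real.norm_of_nonneg (by linarith), h2]
  · right
    refine ⟨h.1, ?_⟩
    rw [Set.mem_singleton_iff, pushOut, hm, h2]

/-- At time `0` the movement is the full radial projection; at time `stretch z - 1` nothing is left
of it. -/
theorem pushOut_stretch (z : V × ℝ) : pushOut z (stretch z - 1) = z := by
  simp [pushOut]

/-- The relative homotopy lifting property for `(D, ∂D)`, with parameters in `Y`. -/
theorem HLP.ball_prod {Y : Set T} (h : HLP p (Y ×ˢ (closedBall (0 : V) 1 ×ˢ Set.Icc (0 : ℝ) 1))) :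
    HasLift p (Y ×ˢ (closedBall (0 : V) 1 ×ˢ Set.Icc (0 : ℝ) 1))
      (Y ×ˢ (sphere (0 : V) 1 ×ˢ Set.Icc (0 : ℝ) 1 ∪ closedBall (0 : V) 1 ×ˢ {(0 : ℝ)})) := by
  have hsub : sphere (0 : V) 1 ×ˢ Set.Icc (0 : ℝ) 1 ∪ closedBall (0 : V) 1 ×ˢ {(0 : ℝ)} ⊆
      closedBall (0 : V) 1 ×ˢ Set.Icc (0 : ℝ) 1 :=
    Set.union_subset (Set.prod_mono sphere_subset_closedBall le_rfl) (prod_zero_subset _)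
  -- The cylinder and its open boundary form a retract of a pair `(X × [0, 1], X × 0)`: a point
  -- enters at the time `stretch - 1`, which is at most `1` because `stretch ≤ 2` and which vanishes
  -- on the subset, and `pushOut` is the retraction.
  refine HasLift.of_retract h (fun z => (z, stretch z.2 - 1))
    (fun z => (z.1.1, pushOut z.1.2 z.2)) ?_ ?_ ?_ ?_ ?_ ?_ (prod_zero_subset _) ?_
    (Set.prod_mono le_rfl hsub)
  · exact continuousOn_id.prodMk ((continuousOn_stretch.comp continuousOn_snd
      fun z hz => hz.2).sub continuousOn_const)
  · have h1 : ContinuousOn (fun z : (T × (V × ℝ)) × ℝ => max 1 (stretch z.1.2 - z.2))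
        ((Y ×ˢ (closedBall (0 : V) 1 ×ˢ Set.Icc (0 : ℝ) 1)) ×ˢ Set.Icc (0 : ℝ) 1) :=
      ContinuousOn.sup continuousOn_const ((continuousOn_stretch.comp (f := fun z : (T × (V × ℝ)) × ℝ => z.1.2)
        (by fun_prop) fun z hz => hz.1.2).sub continuousOn_snd)
    refine ContinuousOn.prodMk (by fun_prop) (ContinuousOn.prodMk ?_ ?_)
    · exact h1.smul (by fun_prop)
    · exact continuousOn_const.sub (h1.mul (by fun_prop))
  · intro z hz
    obtain ⟨h1, h2, -, -⟩ := stretch_bounds hz.2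
    exact ⟨hz, by linarith, by linarith⟩
  · exact fun z hz => ⟨hz.1.1, pushOut_mem hz.1.2 hz.2.1⟩
  · intro z hz
    refine ⟨⟨hz.1, hsub hz.2⟩, ?_⟩
    rw [Set.mem_singleton_iff, sub_eq_zero]
    refine stretch_eq_one (hsub hz.2) ?_
    rcases hz.2 with h | h
    · exact Or.inl (mem_sphere_zero_iff_norm.1 h.1)
    · exact Or.inr h.2
  · rintro ⟨z, τ⟩ ⟨hz, hτ⟩
    rw [Set.mem_singleton_iff] at hτ
    subst hτ
    exact ⟨hz.1, pushOut_zero_mem hz.2⟩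
  · exact fun z _ => Prod.ext rfl (pushOut_stretch _)

theorem HLP.ball (h : HLP p (closedBall (0 : V) 1 ×ˢ Set.Icc (0 : ℝ) 1)) :
    HasLift p (closedBall (0 : V) 1 ×ˢ Set.Icc (0 : ℝ) 1)
      (sphere (0 : V) 1 ×ˢ Set.Icc (0 : ℝ) 1 ∪ closedBall (0 : V) 1 ×ˢ {(0 : ℝ)}) := by
  have h1 : HLP p ((Set.univ : Set Unit) ×ˢ (closedBall (0 : V) 1 ×ˢ Set.Icc (0 : ℝ) 1)) :=
    h.of_retract Prod.snd (fun z => ((), z)) (by fun_prop) (by fun_prop) (fun z hz => hz.2)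
      (fun z hz => ⟨trivial, hz⟩) fun z _ => rfl
  have hsub : sphere (0 : V) 1 ×ˢ Set.Icc (0 : ℝ) 1 ∪ closedBall (0 : V) 1 ×ˢ {(0 : ℝ)} ⊆
      closedBall (0 : V) 1 ×ˢ Set.Icc (0 : ℝ) 1 :=
    Set.union_subset (Set.prod_mono sphere_subset_closedBall le_rfl) (prod_zero_subset _)
  refine h1.ball_prod.of_retract (fun z => ((), z)) Prod.snd (by fun_prop) (by fun_prop)
    (fun z hz => ⟨trivial, hz⟩) (fun z hz => hz.2) (fun z hz => ⟨trivial, hz⟩) (fun z hz => hz.2)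
    (Set.prod_mono le_rfl hsub) (fun z _ => rfl) hsub

end Ball

end Lifting

end

/-! ### Cubes and generalised loops -/

noncomputable section

section Cubes

/-- The boundary of the unit cube. -/
def cubeBd (κ : Type*) : Set (κ → ℝ) := {y ∈ Set.Icc 0 1 | ∃ j, y j = 0 ∨ y j = 1}

theorem cubeBd_subset (κ : Type*) : cubeBd κ ⊆ Set.Icc 0 1 := fun _ hy => hy.1

theorem isClosed_cubeBd (κ : Type*) [Finite κ] : IsClosed (cubeBd κ) := by
  have h : cubeBd κ = Set.Icc 0 1 ∩ ⋃ j, {y : κ → ℝ | y j = 0 ∨ y j = 1} := by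
    ext y; simp [cubeBd]
  rw [h]
  refine isClosed_Icc.inter (isClosed_iUnion_of_finite fun j => ?_)
  exact (isClosed_eq (continuous_apply j) continuous_const).union
    (isClosed_eq (continuous_apply j) continuous_const)

variable {E B Z Z' T : Type*} [TopologicalSpace E] [TopologicalSpace B] [TopologicalSpace Z]
  [TopologicalSpace Z'] [TopologicalSpace T] {p : E → B} {κ : Type*} [Fintype κ]

/-- In the supremum norm the unit ball of `ℝ^κ` is the cube `[-1, 1]^κ`, so the results on balls
apply to cubes. -/
theorem mem_Icc_iff_mem_closedBall {y : κ → ℝ} :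
    y ∈ Set.Icc (0 : κ → ℝ) 1 ↔ (fun j => 2 * y j - 1) ∈ closedBall (0 : κ → ℝ) 1 := by
  rw [mem_closedBall_zero_iff, pi_norm_le_iff_of_nonneg zero_le_one]
  simp only [Set.mem_Icc, Pi.le_def, Real.norm_eq_abs, abs_le, Pi.zero_apply, Pi.one_apply]
  constructor
  · exact fun h j => ⟨by linarith [h.1 j], by linarith [h.2 j]⟩
  · exact fun h => ⟨fun j => by linarith [(h j).1], fun j => by linarith [(h j).2]⟩

theorem mem_cubeBd_iff_mem_sphere {y : κ → ℝ} :
    y ∈ cubeBd κ ↔ (fun j => 2 * y j - 1) ∈ sphere (0 : κ → ℝ) 1 := by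
  rw [mem_sphere_zero_iff_norm]
  constructor
  · rintro ⟨hy, j, hj⟩
    refine le_antisymm (mem_closedBall_zero_iff.1 (mem_Icc_iff_mem_closedBall.1 hy)) ?_
    refine le_trans ?_ (norm_le_pi_norm _ j)
    rcases hj with hj | hj <;> rw [hj] <;> norm_num
  · intro h
    refine ⟨mem_Icc_iff_mem_closedBall.2 (mem_closedBall_zero_iff.2 h.le), ?_⟩
    by_contra hc
    push Not at hc
    have hy : y ∈ Set.Icc 0 1 := mem_Icc_iff_mem_closedBall.2 (mem_closedBall_zero_iff.2 h.le)
    refine absurd h (ne_of_lt ((pi_norm_lt_iff zero_lt_one).2 fun j => ?_))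
    have h0 := lt_of_le_of_ne (hy.1 j) (Ne.symm (hc j).1)
    have h1 := lt_of_le_of_ne (hy.2 j) (hc j).2
    simp only [Pi.zero_apply, Pi.one_apply] at h0 h1
    rw [Real.norm_eq_abs, abs_lt]
    constructor <;> linarith

theorem Serre.cube_prod (hp : Serre p) (κ : Type*) [Fintype κ] :
    HLP p (Set.Icc (0 : κ → ℝ) 1 ×ˢ Set.Icc (0 : ℝ) 1) := by
  refine (hp.cube (κ ⊕ Unit)).of_retract (fun z => Sum.elim z.1 fun _ => z.2)
    (fun x => (fun j => x (.inl j), x (.inr ()))) ?_ (by fun_prop) ?_ ?_ fun x _ => rfl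
  · refine continuousOn_pi.2 fun j => ?_
    cases j <;> simp only [Sum.elim_inl, Sum.elim_inr] <;> fun_prop
  · rintro z ⟨⟨h1, h2⟩, h3, h4⟩
    refine ⟨fun j => ?_, fun j => ?_⟩ <;> cases j <;> simp
    exacts [h1 _, h3, h2 _, h4]
  · exact fun z hz => ⟨⟨fun j => hz.1 _, fun j => hz.2 _⟩, hz.1 _, hz.2 _⟩

/-- The relative homotopy lifting property for the cube and its boundary. -/
theorem Serre.cubeBd_zero (hp : Serre p) (κ : Type*) [Fintype κ] :
    HasLift p (Set.Icc (0 : κ → ℝ) 1 ×ˢ Set.Icc (0 : ℝ) 1)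
      (cubeBd κ ×ˢ Set.Icc (0 : ℝ) 1 ∪ Set.Icc (0 : κ → ℝ) 1 ×ˢ {(0 : ℝ)}) := by
  have hri : ∀ z : κ → ℝ, (fun j => 2 * ((z j + 1) / 2) - 1) = z := fun z => by
    ext j; ring
  have hr : ∀ z ∈ closedBall (0 : κ → ℝ) 1, (fun j => (z j + 1) / 2) ∈ Set.Icc (0 : κ → ℝ) 1 := by
    intro z hz
    rw [mem_Icc_iff_mem_closedBall, hri]; exact hz
  have hr' : ∀ z ∈ sphere (0 : κ → ℝ) 1, (fun j => (z j + 1) / 2) ∈ cubeBd κ := by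
    intro z hz
    rw [mem_cubeBd_iff_mem_sphere, hri]; exact hz
  have h1 : HLP p (closedBall (0 : κ → ℝ) 1 ×ˢ Set.Icc (0 : ℝ) 1) :=
    (hp.cube_prod κ).of_retract (Prod.map (fun z j => (z j + 1) / 2) id)
      (Prod.map (fun y j => 2 * y j - 1) id) (by fun_prop) (by fun_prop)
      (fun z hz => ⟨hr _ hz.1, hz.2⟩)
      (fun z hz => ⟨mem_Icc_iff_mem_closedBall.1 hz.1, hz.2⟩)
      fun z _ => Prod.ext (hri _) rfl
  refine h1.ball.of_retract (Prod.map (fun y j => 2 * y j - 1) id)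
    (Prod.map (fun z j => (z j + 1) / 2) id) (by fun_prop) (by fun_prop)
    (fun z hz => ⟨mem_Icc_iff_mem_closedBall.1 hz.1, hz.2⟩) (fun z hz => ⟨hr _ hz.1, hz.2⟩)
    ?_ ?_ ?_ (fun z _ => Prod.ext (by ext j; simp) rfl) ?_
  · rintro z (hz | hz)
    · exact Or.inl ⟨mem_cubeBd_iff_mem_sphere.1 hz.1, hz.2⟩
    · exact Or.inr ⟨mem_Icc_iff_mem_closedBall.1 hz.1, hz.2⟩
  · rintro z (hz | hz)
    · exact Or.inl ⟨hr' _ hz.1, hz.2⟩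
    · exact Or.inr ⟨hr _ hz.1, hz.2⟩
  · exact Set.union_subset (Set.prod_mono sphere_subset_closedBall le_rfl) (prod_zero_subset _)
  · exact Set.union_subset (Set.prod_mono (cubeBd_subset κ) le_rfl) (prod_zero_subset _)

/-- The boundary of the box `[0, 1]^κ × [0, 1]`. -/
def boxBd (κ : Type*) : Set ((κ → ℝ) × ℝ) :=
  cubeBd κ ×ˢ Set.Icc (0 : ℝ) 1 ∪ Set.Icc (0 : κ → ℝ) 1 ×ˢ {0, 1}

theorem boxBd_subset (κ : Type*) :
    boxBd κ ⊆ Set.Icc (0 : κ → ℝ) 1 ×ˢ Set.Icc (0 : ℝ) 1 := by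
  refine Set.union_subset (Set.prod_mono (cubeBd_subset κ) le_rfl) (Set.prod_mono le_rfl ?_)
  rintro t (rfl | rfl) <;> simp

theorem Serre.boxBd_zero (hp : Serre p) (κ : Type*) [Fintype κ] :
    HasLift p ((Set.Icc (0 : κ → ℝ) 1 ×ˢ Set.Icc (0 : ℝ) 1) ×ˢ Set.Icc (0 : ℝ) 1)
      (boxBd κ ×ˢ Set.Icc (0 : ℝ) 1 ∪
        (Set.Icc (0 : κ → ℝ) 1 ×ˢ Set.Icc (0 : ℝ) 1) ×ˢ {(0 : ℝ)}) := by
  let i : (κ → ℝ) × ℝ → (κ ⊕ Unit → ℝ) := fun z => Sum.elim z.1 fun _ => z.2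
  let r : (κ ⊕ Unit → ℝ) → (κ → ℝ) × ℝ := fun x => (fun j => x (.inl j), x (.inr ()))
  have hi : Continuous i := by
    refine continuous_pi fun j => ?_
    cases j <;> simp only [i, Sum.elim_inl, Sum.elim_inr] <;> fun_prop
  have hr : Continuous r := by fun_prop
  have hi1 : ∀ z ∈ Set.Icc (0 : κ → ℝ) 1 ×ˢ Set.Icc (0 : ℝ) 1, i z ∈ Set.Icc 0 1 := by
    rintro z ⟨⟨h1, h2⟩, h3, h4⟩
    refine ⟨fun j => ?_, fun j => ?_⟩ <;> cases j <;> simp [i]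
    exacts [h1 _, h3, h2 _, h4]
  have hr1 : ∀ x ∈ Set.Icc 0 1, r x ∈ Set.Icc (0 : κ → ℝ) 1 ×ˢ Set.Icc (0 : ℝ) 1 :=
    fun z hz => ⟨⟨fun j => hz.1 _, fun j => hz.2 _⟩, hz.1 _, hz.2 _⟩
  have hi2 : ∀ z ∈ boxBd κ, i z ∈ cubeBd (κ ⊕ Unit) := by
    rintro z hz
    refine ⟨hi1 _ (boxBd_subset κ hz), ?_⟩
    rcases hz with ⟨⟨-, j, hj⟩, -⟩ | ⟨-, hz⟩
    · exact ⟨.inl j, hj⟩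
    · exact ⟨.inr (), hz⟩
  have hr2 : ∀ x ∈ cubeBd (κ ⊕ Unit), r x ∈ boxBd κ := by
    rintro x ⟨hx, j | j, hj⟩
    · exact Or.inl ⟨⟨(hr1 x hx).1, j, hj⟩, (hr1 x hx).2⟩
    · exact Or.inr ⟨(hr1 x hx).1, hj⟩
  refine (hp.cubeBd_zero (κ ⊕ Unit)).of_retract (Prod.map i id) (Prod.map r id) (by fun_prop)
    (by fun_prop) (fun z hz => ⟨hi1 _ hz.1, hz.2⟩) (fun z hz => ⟨hr1 _ hz.1, hz.2⟩) ?_ ?_ ?_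
    (fun z _ => rfl) ?_
  · rintro z (hz | hz)
    · exact Or.inl ⟨hi2 _ hz.1, hz.2⟩
    · exact Or.inr ⟨hi1 _ hz.1, hz.2⟩
  · rintro z (hz | hz)
    · exact Or.inl ⟨hr2 _ hz.1, hz.2⟩
    · exact Or.inr ⟨hr1 _ hz.1, hz.2⟩
  · exact Set.union_subset (Set.prod_mono (cubeBd_subset _) le_rfl) (prod_zero_subset _)
  · exact Set.union_subset (Set.prod_mono (boxBd_subset _) le_rfl) (prod_zero_subset _)

/-- Turning the interval around. -/
theorem HasLift.flip {X A C : Set Z} (h : HasLift p (X ×ˢ Set.Icc (0 : ℝ) 1)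
      (A ×ˢ Set.Icc (0 : ℝ) 1 ∪ C ×ˢ {(0 : ℝ)})) (hA : A ⊆ X) (hC : C ⊆ X) :
    HasLift p (X ×ˢ Set.Icc (0 : ℝ) 1) (A ×ˢ Set.Icc (0 : ℝ) 1 ∪ C ×ˢ {(1 : ℝ)}) := by
  have h1 : ∀ t ∈ Set.Icc (0 : ℝ) 1, 1 - t ∈ Set.Icc (0 : ℝ) 1 :=
    fun t ht => ⟨by linarith [ht.2], by linarith [ht.1]⟩
  refine h.of_retract (Prod.map id fun t => 1 - t) (Prod.map id fun t => 1 - t) (by fun_prop)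
    (by fun_prop) (fun z hz => ⟨hz.1, h1 _ hz.2⟩) (fun z hz => ⟨hz.1, h1 _ hz.2⟩) ?_ ?_ ?_
    (fun z _ => Prod.ext rfl (by simp)) ?_
  · rintro z (hz | ⟨hz, hz'⟩)
    · exact Or.inl ⟨hz.1, h1 _ hz.2⟩
    · refine Or.inr ⟨hz, ?_⟩
      rw [Set.mem_singleton_iff] at hz' ⊢
      simp [hz']
  · rintro z (hz | ⟨hz, hz'⟩)
    · exact Or.inl ⟨hz.1, h1 _ hz.2⟩
    · refine Or.inr ⟨hz, ?_⟩
      rw [Set.mem_singleton_iff] at hz' ⊢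
      simp [hz']
  · exact Set.union_subset (Set.prod_mono hA le_rfl) (Set.prod_mono hC (by simp))
  · exact Set.union_subset (Set.prod_mono hA le_rfl) (Set.prod_mono hC (by simp))

end Cubes

/-! ### Lifting null homotopies of generalised loops. -/

section GenLoops

open scoped unitInterval

variable {E B : Type*} [TopologicalSpace E] [TopologicalSpace B] {κ : Type*}

/-- The map of spaces of generalised loops induced by a continuous map. -/
def GenLoop.mapC (p : C(E, B)) {e : E} (g : GenLoop κ E e) : GenLoop κ B (p e) :=
  ⟨p.comp g.1, fun y hy => congrArg p (g.2 y hy)⟩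

theorem GenLoop.continuous_mapC (p : C(E, B)) {e : E} :
    Continuous (GenLoop.mapC (κ := κ) p (e := e)) :=
  Continuous.subtype_mk ((ContinuousMap.continuous_postcomp p).comp continuous_subtype_val) _

theorem GenLoop.Homotopic.joined {e : E} {f g : GenLoop κ E e} (h : GenLoop.Homotopic f g) :
    Joined f g := by
  obtain ⟨H⟩ := h
  refine ⟨⟨⟨fun t => ⟨H.toHomotopy.curry t, fun y hy => ?_⟩, ?_⟩, ?_, ?_⟩⟩
  · exact (H.eq_fst t hy).trans (f.2 y hy)
  · exact Continuous.subtype_mk (H.toHomotopy.curry.continuous) _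
  · exact Subtype.ext (ContinuousMap.ext fun y => H.apply_zero y)
  · exact Subtype.ext (ContinuousMap.ext fun y => H.apply_one y)

theorem GenLoop.homotopic_of_path {e : E} {f g : GenLoop κ E e} (γ : Path f g) :
    GenLoop.Homotopic f g := by
  refine ⟨⟨⟨⟨fun z => γ z.1 z.2, ?_⟩, fun y => ?_, fun y => ?_⟩, fun t y hy => ?_⟩⟩
  · exact (γ.continuous.comp continuous_fst).eval continuous_snd
  · simp
  · simp
  · exact ((γ t).2 y hy).trans (f.2 y hy).symm

/-- Lifting a null homotopy of a loop, under the hypotheses on homotopy groups which make the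
corresponding relative homotopy group vanish. -/
theorem Serre.lift_path_genLoop {p : C(E, B)} (hp : Serre p) {e : E} {k : ℕ}
    (hinj : ∀ g : GenLoop {j : Fin (k + 1) // j ≠ 0} E e,
      GenLoop.Homotopic GenLoop.const (GenLoop.mapC p g) → GenLoop.Homotopic GenLoop.const g)
    (hsurj : ∀ w : GenLoop (Fin (k + 1)) B (p e), ∃ g : GenLoop (Fin (k + 1)) E e,
      GenLoop.Homotopic (GenLoop.mapC p g) w)
    (g : GenLoop {j : Fin (k + 1) // j ≠ 0} E e)
    (U : Path (GenLoop.const : GenLoop {j : Fin (k + 1) // j ≠ 0} B (p e)) (GenLoop.mapC p g)) :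
    ∃ V : Path GenLoop.const g, ∀ t y, p (V t y) = U t y := by
  -- `V₀` is some null homotopy of `g` upstairs. Its image need not be homotopic to `U`; the
  -- difference is a loop `w` of loops, an element of `π_{k+1}(B)`. A preimage of `w` in
  -- `π_{k+1}(E)` corrects `V₀` to `V₁`, whose image is homotopic to `U` relative to the ends.
  obtain ⟨V₀⟩ := (hinj g (GenLoop.homotopic_of_path U)).joined
  let pV₀ : Path (GenLoop.const : GenLoop {j : Fin (k + 1) // j ≠ 0} B (p e)) (GenLoop.mapC p g) :=
    V₀.map (GenLoop.continuous_mapC p)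
  let w := U.trans pV₀.symm
  obtain ⟨g', hg'⟩ := hsurj (GenLoop.fromLoop 0 w)
  have h1 := GenLoop.homotopicTo 0 hg'
  rw [GenLoop.to_from] at h1
  let G := GenLoop.toLoop 0 g'
  let V₁ := G.trans V₀
  let pV₁ : Path (GenLoop.const : GenLoop {j : Fin (k + 1) // j ≠ 0} B (p e)) (GenLoop.mapC p g) :=
    V₁.map (GenLoop.continuous_mapC p)
  have h2 : pV₁ = (GenLoop.toLoop 0 (GenLoop.mapC p g')).trans pV₀ :=
    Path.map_trans _ _ _
  have h3 : pV₁.Homotopic U := by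
    rw [h2]
    refine (h1.hcomp (Path.Homotopic.refl _)).trans ?_
    refine (Path.Homotopic.trans_assoc _ _ _).trans ?_
    refine ((Path.Homotopic.refl U).hcomp (Path.Homotopic.symm_trans _)).trans ?_
    exact Path.Homotopic.trans_refl _
  obtain ⟨H⟩ := h3
  let c01 : ℝ → I := Set.projIcc 0 1 zero_le_one
  have hpi : Continuous c01 := continuous_projIcc
  let pr : ({j : Fin (k + 1) // j ≠ 0} → ℝ) → ({j : Fin (k + 1) // j ≠ 0} → I) := fun y j => c01 (y j)
  have hq : Continuous pr := by fun_prop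
  have hbd : ∀ y ∈ cubeBd {j : Fin (k + 1) // j ≠ 0}, pr y ∈ Cube.boundary _ := by
    rintro y ⟨-, j, hj⟩
    refine ⟨j, hj.imp (fun h => ?_) fun h => ?_⟩ <;> simp [pr, c01, h]
  -- The homotopy from `p V₁` to `U` is lifted, starting at `V₁` and constant in time on the
  -- boundary of the box. Its end lies over `U` itself.
  obtain ⟨v, hv, hva, hvu⟩ := hp.boxBd_zero {j : Fin (k + 1) // j ≠ 0}
    (fun z => H (c01 z.2, c01 z.1.2) (pr z.1.1)) (fun z => V₁ (c01 z.1.2) (pr z.1.1))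
    (Continuous.continuousOn (Continuous.eval (by fun_prop) (by fun_prop)))
    (Continuous.continuousOn (Continuous.eval (by fun_prop) (by fun_prop))) (by
      rintro z (⟨hz | hz, -⟩ | hz)
      · exact (congrArg p ((V₁ _).2 _ (hbd _ hz.1))).trans ((H _).2 _ (hbd _ hz.1)).symm
      · have h4 : c01 z.1.2 ∈ ({0, 1} : Set I) := by
          rcases hz.2 with h | h
          · left; rw [h]; simp [c01]
          · right; rw [Set.mem_singleton_iff] at h ⊢; rw [h]; simp [c01]
        exact (congrArg (fun q : GenLoop _ B (p e) => q (pr z.1.1)) (H.eq_fst (c01 z.2) h4)).symm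
      · have h4 : c01 z.2 = 0 := by rw [Set.mem_singleton_iff.1 hz.2]; simp [c01]
        rw [h4]
        exact (congrArg (fun q : GenLoop _ B (p e) => q (pr z.1.1)) (H.apply_zero (c01 z.1.2))).symm)
  have hqc : ∀ y : {j : Fin (k + 1) // j ≠ 0} → I, pr (fun j => (y j : ℝ)) = y := fun y => by
    ext j; simp [pr, c01]
  have hmem : ∀ (y : {j : Fin (k + 1) // j ≠ 0} → I), (fun j => (y j : ℝ)) ∈ Set.Icc 0 1 :=
    fun y => ⟨fun j => (y j).2.1, fun j => (y j).2.2⟩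
  have hbd' : ∀ y ∈ Cube.boundary {j : Fin (k + 1) // j ≠ 0}, (fun j => (y j : ℝ)) ∈ cubeBd _ := by
    rintro y ⟨j, hj⟩
    refine ⟨hmem y, j, hj.imp (fun h => ?_) fun h => ?_⟩ <;> simp [h]
  let W : I × ({j : Fin (k + 1) // j ≠ 0} → I) → E := fun z => v ((fun j => (z.2 j : ℝ), z.1), 1)
  have hW : Continuous W := hv.comp_continuous (by fun_prop) fun z => ⟨⟨hmem _, z.1.2⟩, by simp⟩
  have hWa : ∀ (t : I) y, ((fun j => (y j : ℝ)), (t : ℝ)) ∈ boxBd {j : Fin (k + 1) // j ≠ 0} →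
      W (t, y) = V₁ t y := by
    intro t y hty
    have h4 := hva (Or.inl ⟨hty, by simp⟩ : (((fun j => (y j : ℝ)), (t : ℝ)), (1 : ℝ)) ∈
      boxBd {j : Fin (k + 1) // j ≠ 0} ×ˢ Set.Icc (0 : ℝ) 1 ∪ _)
    refine h4.trans ?_
    change V₁ (c01 t) (pr _) = _
    rw [hqc]
    congr
    exact Set.projIcc_val _ t
  refine ⟨⟨⟨fun t => ⟨⟨fun y => W (t, y), by fun_prop⟩, fun y hy => ?_⟩, ?_⟩, ?_, ?_⟩, fun t y => ?_⟩
  · exact (hWa t y (Or.inl ⟨hbd' y hy, t.2⟩)).trans ((V₁ t).2 y hy)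
  · exact Continuous.subtype_mk (ContinuousMap.curry ⟨W, hW⟩).continuous _
  · ext y
    refine (hWa 0 y (Or.inr ⟨hmem y, by simp⟩)).trans ?_
    rw [V₁.source]
  · ext y
    refine (hWa 1 y (Or.inr ⟨hmem y, by simp⟩)).trans ?_
    rw [V₁.target]
  · refine (hvu _ ⟨⟨hmem _, t.2⟩, by simp⟩).trans ?_
    change H (c01 1, c01 t) (pr _) = _
    rw [hqc]
    have h5 : c01 1 = 1 := by simp [c01]
    have h6 : c01 t = t := Set.projIcc_val _ t
    rw [h5, h6]
    exact congrArg (fun q : GenLoop _ B (p e) => q y) (H.apply_one t)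

end GenLoops

end

/-! ### Gluing -/

noncomputable section

theorem exists_glue {Z E : Type*} [TopologicalSpace Z] [TopologicalSpace E] {S S' : Set Z}
    (hS : IsClosed S) (hS' : IsClosed S') {f f' : Z → E} (hf : ContinuousOn f S)
    (hf' : ContinuousOn f' S') (h : ∀ z ∈ S, z ∈ S' → f z = f' z) :
    ∃ F : Z → E, ContinuousOn F (S ∪ S') ∧ (∀ z ∈ S, F z = f z) ∧ ∀ z ∈ S', F z = f' z := by
  classical
  have h1 : ∀ z ∈ S, (if z ∈ S then f z else f' z) = f z := fun z hz => if_pos hz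
  have h2 : ∀ z ∈ S', (if z ∈ S then f z else f' z) = f' z := fun z hz => by
    split_ifs with hzS
    exacts [h z hzS hz, rfl]
  exact ⟨_, (hf.congr h1).union_of_isClosed (hf'.congr h2) hS hS', h1, h2⟩

/-! ### Lifting over a box relative to its whole boundary. -/

section Box

open scoped unitInterval

variable {E B : Type*} [TopologicalSpace E] [TopologicalSpace B] {κ : Type*}

/-- The projection of the line to the unit interval. -/
def clampI : ℝ → I := Set.projIcc 0 1 zero_le_one

theorem continuous_clampI : Continuous clampI := continuous_projIcc

@[simp] theorem clampI_coe (t : I) : clampI t = t := Set.projIcc_val _ t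

@[simp] theorem clampI_zero : clampI 0 = 0 := by simp [clampI]

@[simp] theorem clampI_one : clampI 1 = 1 := by simp [clampI]

theorem coe_clampI {t : ℝ} (ht : t ∈ Set.Icc (0 : ℝ) 1) : (clampI t : ℝ) = t := by
  rw [clampI, Set.projIcc_of_mem _ ht]

theorem isClosed_boxBd (κ : Type*) [Finite κ] : IsClosed (boxBd κ) :=
  ((isClosed_cubeBd κ).prod isClosed_Icc).union
    (isClosed_Icc.prod (Set.Finite.isClosed (by simp)))

/-- This is the passage from free to based lifting problems. The boundary without its lid, `J`, is
contractible in the box, so the prescribed lift can be deformed until it is constant at `e` on `J`.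
The problem becomes that of lifting a null homotopy of the loop on the lid, which
`Serre.lift_path_genLoop` solves. Relative homotopy lifting, with time reversed, brings the solution
back to the original data. -/
theorem Serre.hasLift_boxBd {p : C(E, B)} (hp : Serre p) {e : E} (hE : ∀ x : E, Joined x e) {k : ℕ}
    (hinj : ∀ g : GenLoop {j : Fin (k + 1) // j ≠ 0} E e,
      GenLoop.Homotopic GenLoop.const (GenLoop.mapC p g) → GenLoop.Homotopic GenLoop.const g)
    (hsurj : ∀ w : GenLoop (Fin (k + 1)) B (p e), ∃ g : GenLoop (Fin (k + 1)) E e,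
      GenLoop.Homotopic (GenLoop.mapC p g) w) :
    HasLift p (Set.Icc (0 : {j : Fin (k + 1) // j ≠ 0} → ℝ) 1 ×ˢ Set.Icc (0 : ℝ) 1)
      (boxBd {j : Fin (k + 1) // j ≠ 0}) := by
  intro u a hu ha hau
  -- The coordinates other than `0`, on which `GenLoop.toLoop` puts its loops, are treated as an
  -- abstract index type until `hV`, where `hκ` is substituted back.
  generalize hκ : {j : Fin (k + 1) // j ≠ 0} = κ at *
  have : Fintype κ := hκ ▸ inferInstance
  set X : Set ((κ → ℝ) × ℝ) := Set.Icc (0 : κ → ℝ) 1 ×ˢ Set.Icc (0 : ℝ) 1 with hX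
  have hXc : IsClosed X := isClosed_Icc.prod isClosed_Icc
  set J : Set ((κ → ℝ) × ℝ) := cubeBd κ ×ˢ Set.Icc (0 : ℝ) 1 ∪ Set.Icc (0 : κ → ℝ) 1 ×ˢ {(0 : ℝ)}
    with hJ
  have hJc : IsClosed J :=
    ((isClosed_cubeBd κ).prod isClosed_Icc).union (isClosed_Icc.prod isClosed_singleton)
  have hJb : J ⊆ boxBd κ := Set.union_subset_union le_rfl (Set.prod_mono le_rfl (by simp))
  have hbX : boxBd κ ⊆ X := boxBd_subset κ
  -- contract `J` in `E`
  obtain ⟨a₁, ha₁, ha₁J, -⟩ := serre_const.cubeBd_zero κ (fun _ => ()) a continuousOn_const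
    (ha.mono hJb) fun _ _ => rfl
  obtain ⟨γ⟩ := hE (a₁ 0)
  let q : (κ → ℝ) × ℝ → (κ → ℝ) × ℝ := fun z => (fun j => clampI (z.1 j), clampI z.2)
  have hcl := continuous_clampI
  have hq : Continuous q := by fun_prop
  have hqX : ∀ z, q z ∈ X := fun z =>
    ⟨⟨fun j => (clampI (z.1 j)).2.1, fun j => (clampI (z.1 j)).2.2⟩, (clampI z.2).2⟩
  have hqz : ∀ z ∈ X, q z = z := fun z hz =>
    Prod.ext (funext fun j => coe_clampI ⟨hz.1.1 j, hz.1.2 j⟩) (coe_clampI hz.2)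
  have hA : Continuous (a₁ ∘ q) := ha₁.comp_continuous hq hqX
  -- Up to time `1/2` the box shrinks to its corner `0`, on which `a₁` extends `a`; afterwards the
  -- path `γ` runs from `a₁ 0` to `e`.
  let c : ((κ → ℝ) × ℝ) × ℝ → E := fun z =>
    if z.2 ≤ 1 / 2 then a₁ (q ((1 - 2 * z.2) • z.1)) else γ.extend (2 * z.2 - 1)
  have hc : Continuous c := by
    refine Continuous.if_le (hA.comp (by fun_prop)) (γ.continuous_extend.comp (by fun_prop))
      continuous_snd continuous_const fun z hz => ?_
    have h1 : (1 - 2 * z.2) = 0 := by rw [hz]; norm_num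
    have h2 : (2 * z.2 - 1) = 0 := by rw [hz]; norm_num
    change a₁ (q _) = γ.extend _
    rw [h1, h2, zero_smul, hqz 0 ⟨⟨le_rfl, zero_le_one⟩, le_rfl, zero_le_one⟩, Path.extend_zero]
  have hc0 : ∀ z ∈ J, c (z, 0) = a z := fun z hz => by
    have h1 : c (z, 0) = a₁ (q z) := by simp [c]
    rw [h1, hqz z (hbX (hJb hz)), ha₁J hz]
  have hc1 : ∀ z, c (z, 1) = e := fun z => by
    have h1 : ¬ ((1 : ℝ) ≤ 1 / 2) := by norm_num
    have h2 : (2 * (1 : ℝ) - 1) = 1 := by norm_num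
    change (if (1 : ℝ) ≤ 1 / 2 then _ else γ.extend (2 * 1 - 1)) = e
    rw [if_neg h1, h2, Path.extend_one]
  -- extend the contraction to the boundary of the box
  obtain ⟨D, hD, hD1, hD2⟩ := exists_glue (S := cubeBd κ ×ˢ Set.Icc (0 : ℝ) 1)
    (S' := Set.Icc (0 : κ → ℝ) 1 ×ˢ {(0 : ℝ)})
    ((isClosed_cubeBd κ).prod isClosed_Icc) (isClosed_Icc.prod isClosed_singleton)
    (f := fun z => c ((z.1, 1), z.2)) (f' := fun z => a (z.1, 1)) (by fun_prop)
    (ha.comp (by fun_prop) fun z hz => Or.inr ⟨hz.1, by simp⟩) (by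
      rintro ⟨y, s⟩ hz ⟨-, hs⟩
      have hs : s = 0 := hs
      subst hs
      exact hc0 (y, 1) (Or.inl ⟨hz.1, by simp⟩))
  obtain ⟨d, hd, hdD, -⟩ := serre_const.cubeBd_zero κ (fun _ => ()) D continuousOn_const hD
    fun _ _ => rfl
  obtain ⟨a', ha', ha'J, ha't⟩ := exists_glue (S := J ×ˢ Set.Icc (0 : ℝ) 1)
    (S' := (Set.Icc (0 : κ → ℝ) 1 ×ˢ {(1 : ℝ)}) ×ˢ Set.Icc (0 : ℝ) 1)
    (hJc.prod isClosed_Icc) ((isClosed_Icc.prod isClosed_singleton).prod isClosed_Icc)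
    (f := c) (f' := fun z => d (z.1.1, z.2)) hc.continuousOn
    (hd.comp (by fun_prop) fun z hz => ⟨hz.1.1, hz.2⟩) (by
      rintro ⟨⟨y, t⟩, s⟩ ⟨hz, hs⟩ ⟨⟨hy, ht⟩, -⟩
      have ht : t = 1 := ht
      subst ht
      have hy : y ∈ cubeBd κ := by
        rcases hz with hz | hz
        · exact hz.1
        · exact absurd hz.2 (by simp)
      exact ((hdD (x := (y, s)) (Or.inl ⟨hy, hs⟩)).trans (hD1 (y, s) ⟨hy, hs⟩)).symm)
  have hbd : boxBd κ = J ∪ Set.Icc (0 : κ → ℝ) 1 ×ˢ {(1 : ℝ)} := by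
    rw [hJ, boxBd, Set.union_assoc, ← Set.prod_union]; rfl
  rw [← Set.union_prod, ← hbd] at ha'
  have ha'0 : ∀ z ∈ boxBd κ, a' (z, 0) = a z := by
    intro z hz
    rw [hbd] at hz
    rcases hz with hz | ⟨hz, hz1⟩
    · rw [ha'J _ ⟨hz, by simp⟩, hc0 z hz]
    · rw [ha't (z, 0) ⟨⟨hz, hz1⟩, by simp⟩]
      refine (hdD (x := (z.1, 0)) (Or.inr ⟨hz, rfl⟩)).trans ((hD2 (z.1, 0) ⟨hz, rfl⟩).trans ?_)
      exact congrArg a (Prod.ext rfl hz1.symm)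
  have ha'1 : ∀ z ∈ J, a' (z, 1) = e := fun z hz => by
    rw [ha'J _ ⟨hz, by simp⟩, hc1]
  obtain ⟨U₀, hU₀, hU₀b, hU₀z⟩ := exists_glue (S := boxBd κ ×ˢ Set.Icc (0 : ℝ) 1)
    (S' := X ×ˢ {(0 : ℝ)}) ((isClosed_boxBd κ).prod isClosed_Icc) (hXc.prod isClosed_singleton)
    (f := fun z => p (a' z)) (f' := fun z => u z.1) (p.continuous.comp_continuousOn ha')
    (hu.comp (by fun_prop) fun z hz => hz.1) (by
      rintro ⟨z, s⟩ hz ⟨-, hs⟩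
      have hs : s = 0 := hs
      subst hs
      change p (a' (z, 0)) = u z
      rw [ha'0 z hz.1, hau z hz.1])
  obtain ⟨u', hu', hu'U, -⟩ := serre_const.boxBd_zero κ (fun _ => ()) U₀ continuousOn_const hU₀
    fun _ _ => rfl
  have hu'b : ∀ z ∈ boxBd κ ×ˢ Set.Icc (0 : ℝ) 1, u' z = p (a' z) :=
    fun z hz => (hu'U (Or.inl hz)).trans (hU₀b z hz)
  have hu'0 : ∀ z ∈ X, u' (z, 0) = u z :=
    fun z hz => (hu'U (x := (z, 0)) (Or.inr ⟨hz, rfl⟩)).trans (hU₀z (z, 0) ⟨hz, rfl⟩)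
  -- solve the based problem
  let co : (κ → I) → (κ → ℝ) := fun y j => y j
  have hco : Continuous co := by fun_prop
  have hmem : ∀ y, co y ∈ Set.Icc (0 : κ → ℝ) 1 := fun y => ⟨fun j => (y j).2.1, fun j => (y j).2.2⟩
  have hcobd : ∀ y ∈ Cube.boundary κ, co y ∈ cubeBd κ := by
    rintro y ⟨j, hj⟩
    refine ⟨hmem y, j, hj.imp (fun h => ?_) fun h => ?_⟩ <;> simp [co, h]
  let g : GenLoop κ E e := ⟨⟨fun y => a' ((co y, 1), 1),
    ha'.comp_continuous (by fun_prop) fun y => ⟨Or.inr ⟨hmem y, by simp⟩, by simp⟩⟩,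
    fun y hy => ha'1 _ (Or.inl ⟨hcobd y hy, by simp⟩)⟩
  have hW : Continuous fun z : I × (κ → I) => u' ((co z.2, z.1), 1) :=
    hu'.comp_continuous (by fun_prop) fun z => ⟨⟨hmem _, z.1.2⟩, by simp⟩
  let U : Path (GenLoop.const : GenLoop κ B (p e)) (GenLoop.mapC p g) :=
    ⟨⟨fun t => ⟨ContinuousMap.curry ⟨_, hW⟩ t, fun y hy => by
        refine (hu'b ((co y, t), 1) ⟨Or.inl ⟨hcobd y hy, t.2⟩, by simp⟩).trans ?_
        rw [ha'1 _ (Or.inl ⟨hcobd y hy, t.2⟩)]⟩,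
      Continuous.subtype_mk (ContinuousMap.curry ⟨_, hW⟩).continuous _⟩, by
        refine Subtype.ext (ContinuousMap.ext fun y => ?_)
        refine (hu'b ((co y, 0), 1) ⟨Or.inr ⟨hmem y, by simp⟩, by simp⟩).trans ?_
        rw [ha'1 _ (Or.inr ⟨hmem y, Set.mem_singleton _⟩)]
        rfl, by
        refine Subtype.ext (ContinuousMap.ext fun y => ?_)
        exact hu'b ((co y, 1), 1) ⟨Or.inr ⟨hmem y, by simp⟩, by simp⟩⟩
  have hV : ∃ V : Path GenLoop.const g, ∀ t y, p (V t y) = U t y := by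
    clear_value U g
    subst hκ
    exact Serre.lift_path_genLoop hp hinj hsurj g U
  obtain ⟨V, hV⟩ := hV
  let v₁ : (κ → ℝ) × ℝ → E := fun z => V (clampI z.2) fun j => clampI (z.1 j)
  have hv₁ : Continuous v₁ :=
    Continuous.eval (V.continuous.comp (hcl.comp continuous_snd)) (by fun_prop)
  have hv₁b : ∀ z ∈ boxBd κ, v₁ z = a' (z, 1) := by
    intro z hz
    have hzX := hbX hz
    rw [hbd] at hz
    have hz1 : co (fun j => clampI (z.1 j)) = z.1 := congrArg Prod.fst (hqz z hzX)
    rcases hz with hz | hz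
    · rw [ha'1 z hz]
      rcases hz with ⟨⟨hz2, j, hj⟩, -⟩ | ⟨-, hz2⟩
      · refine (V _).2 _ ⟨j, hj.imp (fun h => ?_) fun h => ?_⟩ <;> simp [h]
      · change V (clampI z.2) _ = e
        rw [Set.mem_singleton_iff.1 hz2, clampI_zero, V.source]
        rfl
    · change V (clampI z.2) _ = _
      have hz2 := Set.mem_singleton_iff.1 hz.2
      rw [hz2, clampI_one, V.target]
      change a' ((co _, 1), 1) = _
      rw [hz1]
      exact congrArg a' (Prod.ext (Prod.ext rfl hz2.symm) rfl)
  -- and transport the solution back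
  obtain ⟨a₂, ha₂, ha₂b, ha₂v⟩ := exists_glue (S := boxBd κ ×ˢ Set.Icc (0 : ℝ) 1)
    (S' := X ×ˢ {(1 : ℝ)}) ((isClosed_boxBd κ).prod isClosed_Icc) (hXc.prod isClosed_singleton)
    (f := a') (f' := fun z => v₁ z.1) ha' (by fun_prop) (by
      rintro ⟨z, s⟩ hz ⟨-, hs⟩
      have hs : s = 1 := hs
      subst hs
      exact (hv₁b z hz.1).symm)
  obtain ⟨v, hv, hva, hvu⟩ := (hp.boxBd_zero κ).flip hbX le_rfl u' a₂ hu' ha₂ (by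
    rintro z (hz | hz)
    · rw [ha₂b z hz, hu'b z hz]
    · rw [ha₂v z hz]
      obtain ⟨z, s⟩ := z
      have hs : s = 1 := hz.2
      subst hs
      refine (hV _ _).trans ?_
      change u' (q z, 1) = u' (z, 1)
      rw [hqz z hz.1])
  refine ⟨fun z => v (z, 0), hv.comp (by fun_prop) fun z hz => ⟨hz, by simp⟩, fun z hz => ?_,
    fun z hz => ?_⟩
  · change v (z, 0) = a z
    rw [hva (Or.inl ⟨hz, by simp⟩), ha₂b _ ⟨hz, by simp⟩, ha'0 z hz]
  · rw [hvu _ ⟨hz, by simp⟩, hu'0 z hz]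

end Box

end

/-! ### Lifting over cubes relative to the boundary -/

noncomputable section

section Connectivity

open scoped unitInterval

variable {E B : Type} [TopologicalSpace E] [TopologicalSpace B]

theorem HasLift.boxBd_reindex {p : E → B} {κ κ' : Type*} (e : κ ≃ κ')
    (h : HasLift p (Set.Icc (0 : κ → ℝ) 1 ×ˢ Set.Icc (0 : ℝ) 1) (boxBd κ)) :
    HasLift p (Set.Icc (0 : κ' → ℝ) 1 ×ˢ Set.Icc (0 : ℝ) 1) (boxBd κ') := by
  refine h.of_retract (fun z => (fun j => z.1 (e j), z.2)) (fun z => (fun j => z.1 (e.symm j), z.2))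
    (by fun_prop) (by fun_prop) (fun z hz => ⟨⟨fun j => hz.1.1 _, fun j => hz.1.2 _⟩, hz.2⟩)
    (fun z hz => ⟨⟨fun j => hz.1.1 _, fun j => hz.1.2 _⟩, hz.2⟩) ?_ ?_ (boxBd_subset _)
    (fun z _ => by simp) (boxBd_subset _)
  · rintro z (⟨⟨hz, j, hj⟩, ht⟩ | ⟨hz, ht⟩)
    · exact Or.inl ⟨⟨⟨fun j => hz.1 _, fun j => hz.2 _⟩, e.symm j, by simpa using hj⟩, ht⟩
    · exact Or.inr ⟨⟨fun j => hz.1 _, fun j => hz.2 _⟩, ht⟩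
  · rintro z (⟨⟨hz, j, hj⟩, ht⟩ | ⟨hz, ht⟩)
    · exact Or.inl ⟨⟨⟨fun j => hz.1 _, fun j => hz.2 _⟩, e j, by simpa using hj⟩, ht⟩
    · exact Or.inr ⟨⟨fun j => hz.1 _, fun j => hz.2 _⟩, ht⟩

/-- A Serre fibration `p` lifts extensions over `[0, 1]^k × [0, 1]` if `π_k(p)` has trivial kernel
and `π_{k+1}(p)` is surjective. -/
theorem Serre.hasLift_boxBd_of_pi {p : C(E, B)} (hp : Serre p) {e : E} (hE : ∀ x : E, Joined x e)
    {k : ℕ}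
    (hinj : ∀ g : GenLoop (Fin k) E e,
      GenLoop.Homotopic GenLoop.const (GenLoop.mapC p g) → GenLoop.Homotopic GenLoop.const g)
    (hsurj : ∀ w : GenLoop (Fin (k + 1)) B (p e), ∃ g : GenLoop (Fin (k + 1)) E e,
      GenLoop.Homotopic (GenLoop.mapC p g) w) :
    HasLift p (Set.Icc (0 : Fin k → ℝ) 1 ×ˢ Set.Icc (0 : ℝ) 1) (boxBd (Fin k)) := by
  let f : {j : Fin (k + 1) // j ≠ 0} ≃ Fin k := (finSuccAboveEquiv 0).symm
  refine HasLift.boxBd_reindex f (hp.hasLift_boxBd hE (fun g hg => ?_) hsurj)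
  obtain ⟨γ⟩ := hg.joined
  have h1 := hinj (GenLoop.congr e f g)
    (GenLoop.homotopic_of_path (γ.map (GenLoop.congr (p e) f).continuous))
  obtain ⟨δ⟩ := h1.joined
  have h2 := GenLoop.homotopic_of_path (δ.map (GenLoop.congr e f).symm.continuous)
  rwa [Homeomorph.symm_apply_apply] at h2

theorem ConnectedCover.serre {n : ℕ} (𝔅 : ConnectedCover n) : Serre 𝔅.θ := by
  intro k u a hu ha hau
  have hc := continuous_clampI
  have hmem : ∀ x : Fin k → I, (fun j => (x j : ℝ)) ∈ Set.Icc (0 : Fin k → ℝ) 1 :=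
    fun x => ⟨fun j => (x j).2.1, fun j => (x j).2.2⟩
  obtain ⟨G, hG0, hG⟩ := 𝔅.fibration k ⟨fun x => a (fun j => x j, 0),
      ha.comp_continuous (by fun_prop) fun x => ⟨hmem x, rfl⟩⟩
    ⟨fun z => u (fun j => z.2 j, z.1),
      hu.comp_continuous (by fun_prop) fun z => ⟨hmem _, z.1.2⟩⟩
    fun x => (hau (fun j => x j, 0) ⟨hmem x, rfl⟩).symm
  refine ⟨fun z => G (clampI z.2, fun j => clampI (z.1 j)), by fun_prop, ?_, ?_⟩
  · rintro ⟨x, t⟩ ⟨hx, ht⟩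
    have ht : t = 0 := ht
    subst ht
    simp only [clampI_zero, hG0, ContinuousMap.coe_mk]
    congr
    funext j
    exact coe_clampI ⟨hx.1 j, hx.2 j⟩
  · rintro ⟨x, t⟩ ⟨hx, ht⟩
    refine (hG _).trans ?_
    simp only [ContinuousMap.coe_mk]
    congr
    · funext j
      exact coe_clampI ⟨hx.1 j, hx.2 j⟩
    · exact coe_clampI ht

theorem ConnectedCover.joined {n : ℕ} (𝔅 : ConnectedCover n) (b b' : 𝔅.B) : Joined b b' := by
  have := 𝔅.connected 0 (Nat.zero_le _)
  have h := (HomotopyGroup.pi0EquivZerothHomotopy (X := 𝔅.B) (x := 𝔅.pt)).symm.injective.subsingleton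
  exact Quotient.exact (h.elim (Quotient.mk _ b) (Quotient.mk _ b'))

/-- The fibre of `θ` has no homotopy in degrees `≥ n`: the kernel of `π_k(θ)` is trivial for `k > n`
by injectivity and for `k = n` because `π_n(BO⟨n⟩) = 0`, and `π_{k+1}(θ)` is onto as `k + 1 > n`. -/
theorem ConnectedCover.hasLift_boxBd {n : ℕ} (𝔅 : ConnectedCover n) {k : ℕ} (hk : n ≤ k) :
    HasLift 𝔅.θ (Set.Icc (0 : Fin k → ℝ) 1 ×ˢ Set.Icc (0 : ℝ) 1) (boxBd (Fin k)) := by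
  refine 𝔅.serre.hasLift_boxBd_of_pi (fun x => 𝔅.joined x 𝔅.pt) (fun g hg => ?_) fun w => ?_
  · rcases hk.eq_or_lt with rfl | hk
    · have := 𝔅.connected n le_rfl
      exact Quotient.exact (this.elim (Quotient.mk _ GenLoop.const) (Quotient.mk _ g))
    · exact Quotient.exact ((𝔅.iso k hk).1 (Quotient.sound hg :
        piMap k 𝔅.θ 𝔅.pt (Quotient.mk _ GenLoop.const) = piMap k 𝔅.θ 𝔅.pt (Quotient.mk _ g)))
  · obtain ⟨g, hg⟩ := (𝔅.iso (k + 1) (by omega)).2 (Quotient.mk _ w)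
    obtain ⟨g, rfl⟩ := Quotient.exists_rep g
    exact ⟨g, Quotient.exact hg⟩

theorem joined_of_pi_zero (hE : ∀ x : E, Subsingleton (HomotopyGroup.Pi 0 E x)) (x y : E) :
    Joined x y := by
  have := hE x
  have h := (HomotopyGroup.pi0EquivZerothHomotopy (X := E) (x := x)).symm.injective.subsingleton
  exact Quotient.exact (h.elim (Quotient.mk _ x) (Quotient.mk _ y))

/-- The boundary of the box is a `k`-sphere, so maps on it extend when `π_k(E)` vanishes. Formally
this is the lifting criterion for the map to a point. -/
theorem hasLift_boxBd_of_connected {e : E} (hE : ∀ x : E, Joined x e) {k : ℕ}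
    (h : Subsingleton (HomotopyGroup.Pi k E e)) :
    HasLift (fun _ : E => ()) (Set.Icc (0 : Fin k → ℝ) 1 ×ˢ Set.Icc (0 : ℝ) 1)
      (boxBd (Fin k)) := by
  refine Serre.hasLift_boxBd_of_pi (p := (⟨fun _ : E => (), continuous_const⟩ : C(E, Unit)))
    serre_const hE (fun g _ => ?_) fun w => ⟨GenLoop.const, ?_⟩
  · exact Quotient.exact (h.elim (Quotient.mk _ GenLoop.const) (Quotient.mk _ g))
  · have h1 : GenLoop.mapC (⟨fun _ : E => (), continuous_const⟩ : C(E, Unit))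
      (GenLoop.const : GenLoop (Fin (k + 1)) E e) = w := by ext
    rw [h1]

end Connectivity

end

/-! ### Finite complexes of faces of cubes -/

noncomputable section

/-- A face of the cubical decomposition of `ℝ^ι` with vertices in the integral lattice: the product
of the intervals `[a j, a j + 1]` for `j ∈ D` and the points `a j` for `j ∉ D`. -/
structure Face (ι : Type) where
  a : ι → ℤ
  D : Finset ι

namespace Face

variable {ι : Type}

/-- The closed cell. -/
def cell (σ : Face ι) : Set (ι → ℝ) :=
  {x | ∀ j, (j ∈ σ.D → (σ.a j : ℝ) ≤ x j ∧ x j ≤ σ.a j + 1) ∧ (j ∉ σ.D → x j = σ.a j)}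

/-- The boundary of the cell. -/
def bd (σ : Face ι) : Set (ι → ℝ) :=
  {x ∈ σ.cell | ∃ j ∈ σ.D, x j = σ.a j ∨ x j = σ.a j + 1}

/-- The face relation. -/
def Le (σ τ : Face ι) : Prop :=
  ∀ j, (j ∈ σ.D → j ∈ τ.D ∧ σ.a j = τ.a j) ∧
    (j ∉ σ.D → σ.a j = τ.a j ∨ (j ∈ τ.D ∧ σ.a j = τ.a j + 1))

theorem Le.refl (σ : Face ι) : σ.Le σ := fun _ => ⟨fun h => ⟨h, rfl⟩, fun _ => Or.inl rfl⟩

theorem Le.trans {σ τ ρ : Face ι} (h : σ.Le τ) (h' : τ.Le ρ) : σ.Le ρ := by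
  intro j
  have h1 := h j
  have h2 := h' j
  grind

theorem Le.card_le {σ τ : Face ι} (h : σ.Le τ) : σ.D.card ≤ τ.D.card :=
  Finset.card_le_card fun j hj => ((h j).1 hj).1

theorem Le.eq_of_card_le {σ τ : Face ι} (h : σ.Le τ) (hc : τ.D.card ≤ σ.D.card) : σ = τ := by
  have hD : σ.D = τ.D := Finset.eq_of_subset_of_card_le (fun j hj => ((h j).1 hj).1) hc
  have ha : σ.a = τ.a := by
    funext j
    have := h j
    grind
  cases σ
  cases τ
  simp_all

/-- In the interior of `σ` the coordinates in the directions of `σ` are not integers, so a cell `τ`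
through such a point extends in these directions, over the same unit intervals. Hence open cells are
disjoint from all cells that do not have them as faces. -/
theorem le_of_mem {σ τ : Face ι} {x : ι → ℝ} (h : x ∈ σ.cell) (hb : x ∉ σ.bd) (hτ : x ∈ τ.cell) :
    σ.Le τ := by
  have hb' : ∀ j ∈ σ.D, x j ≠ σ.a j ∧ x j ≠ σ.a j + 1 := by
    intro j hj
    by_contra hc
    exact hb ⟨h, j, hj, by tauto⟩
  intro j
  constructor
  · intro hj
    obtain ⟨h1, h2⟩ := (h j).1 hj
    have h3 := lt_of_le_of_ne h1 (hb' j hj).1.symm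
    have h4 := lt_of_le_of_ne h2 (hb' j hj).2
    by_cases hjt : j ∈ τ.D
    · refine ⟨hjt, ?_⟩
      obtain ⟨h5, h6⟩ := (hτ j).1 hjt
      have h7 : (σ.a j : ℝ) < τ.a j + 1 := by linarith
      have h8 : (τ.a j : ℝ) < σ.a j + 1 := by linarith
      norm_cast at h7 h8
      omega
    · rw [(hτ j).2 hjt] at h3 h4
      norm_cast at h3 h4
      omega
  · intro hj
    have h1 := (h j).2 hj
    by_cases hjt : j ∈ τ.D
    · obtain ⟨h5, h6⟩ := (hτ j).1 hjt
      rw [h1] at h5 h6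
      norm_cast at h5 h6
      have : σ.a j = τ.a j ∨ σ.a j = τ.a j + 1 := by omega
      exact this.imp id fun h => ⟨hjt, h⟩
    · have h2 := (hτ j).2 hjt
      rw [h1] at h2
      exact Or.inl (by exact_mod_cast h2)

theorem exists_le_of_mem_bd [DecidableEq ι] {σ : Face ι} {x : ι → ℝ} (h : x ∈ σ.bd) :
    ∃ τ : Face ι, τ.Le σ ∧ τ ≠ σ ∧ x ∈ τ.cell := by
  obtain ⟨hx, j, hj, hxj⟩ := h
  rcases hxj with hxj | hxj
  · refine ⟨⟨σ.a, σ.D.erase j⟩, fun k => ?_, fun he => ?_, fun k => ?_⟩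
    · simp only [Finset.mem_erase]; grind
    · have := congrArg D he
      exact absurd hj (this ▸ Finset.notMem_erase j σ.D)
    · by_cases hk : k = j
      · subst hk; simpa using hxj
      · simpa [hk] using hx k
  · refine ⟨⟨Function.update σ.a j (σ.a j + 1), σ.D.erase j⟩, fun k => ?_, fun he => ?_, fun k => ?_⟩
    · by_cases hk : k = j
      · subst hk; simp [hj]
      · simp [hk]
    · have := congrArg D he
      exact absurd hj (this ▸ Finset.notMem_erase j σ.D)
    · by_cases hk : k = j
      · subst hk; simpa using hxj
      · simpa [hk] using hx k

theorem isClosed_cell [Finite ι] (σ : Face ι) : IsClosed σ.cell := by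
  have h : σ.cell = ⋂ j, {x : ι → ℝ | (j ∈ σ.D → (σ.a j : ℝ) ≤ x j ∧ x j ≤ σ.a j + 1) ∧
      (j ∉ σ.D → x j = σ.a j)} := by
    ext x; simp [cell]
  rw [h]
  refine isClosed_iInter fun j => ?_
  by_cases hj : j ∈ σ.D
  · simp only [hj, true_imp_iff, not_true, false_imp_iff, and_true]
    exact (isClosed_le continuous_const (continuous_apply j)).inter
      (isClosed_le (continuous_apply j) continuous_const)
  · simp only [hj, true_imp_iff, not_false_iff, false_imp_iff, true_and]
    exact isClosed_eq (continuous_apply j) continuous_const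

variable {E B T : Type*} [TopologicalSpace E] [TopologicalSpace B] [TopologicalSpace T] {p : E → B}

/-- Lifting over a cell in terms of the standard cube. -/
theorem hasLift_cell [DecidableEq ι] (σ : Face ι) {P P₀ : Set T} (hP : P₀ ⊆ P)
    (h : HasLift p ((Set.Icc 0 1 : Set (Fin σ.D.card → ℝ)) ×ˢ P)
      (cubeBd (Fin σ.D.card) ×ˢ P ∪ Set.Icc 0 1 ×ˢ P₀)) :
    HasLift p (σ.cell ×ˢ P) (σ.bd ×ˢ P ∪ σ.cell ×ˢ P₀) := by
  let f : σ.D ≃ Fin σ.D.card := σ.D.equivFin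
  let i : (ι → ℝ) → (Fin σ.D.card → ℝ) := fun x k => x (f.symm k) - σ.a (f.symm k)
  let r : (Fin σ.D.card → ℝ) → (ι → ℝ) :=
    fun y j => if h : j ∈ σ.D then σ.a j + y (f ⟨j, h⟩) else σ.a j
  have hi : Continuous i := by fun_prop
  have hr : Continuous r := by
    refine continuous_pi fun j => ?_
    by_cases h : j ∈ σ.D <;> simp only [r, h, dite_true, dite_false] <;> fun_prop
  have hi1 : ∀ x ∈ σ.cell, i x ∈ Set.Icc 0 1 := fun x hx =>
    ⟨fun k => by have := ((hx (f.symm k)).1 (f.symm k).2).1; simp [i]; linarith,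
      fun k => by have := ((hx (f.symm k)).1 (f.symm k).2).2; simp [i]; linarith⟩
  have hr1 : ∀ y ∈ Set.Icc 0 1, r y ∈ σ.cell := by
    intro y hy j
    by_cases h : j ∈ σ.D
    · have h1 := hy.1 (f ⟨j, h⟩)
      have h2 := hy.2 (f ⟨j, h⟩)
      simp only [Pi.zero_apply, Pi.one_apply] at h1 h2
      simp [r, h]
      exact ⟨h1, h2⟩
    · simp [r, h]
  have hi2 : ∀ x ∈ σ.bd, i x ∈ cubeBd _ := by
    rintro x ⟨hx, j, hj, h⟩
    refine ⟨hi1 x hx, f ⟨j, hj⟩, ?_⟩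
    simp only [i, Equiv.symm_apply_apply]
    exact h.imp (fun h => by rw [h]; ring) fun h => by rw [h]; ring
  have hr2 : ∀ y ∈ cubeBd _, r y ∈ σ.bd := by
    rintro y ⟨hy, k, h⟩
    refine ⟨hr1 y hy, f.symm k, (f.symm k).2, ?_⟩
    simp only [r, (f.symm k).2, dite_true, Subtype.coe_eta, Equiv.apply_symm_apply]
    exact h.imp (fun h => by rw [h]; ring) fun h => by rw [h]
  have hri : ∀ x ∈ σ.cell, r (i x) = x := by
    intro x hx
    funext j
    by_cases h : j ∈ σ.D
    · simp [r, i, h]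
    · simp [r, h, (hx j).2 h]
  refine h.of_retract (Prod.map i id) (Prod.map r id) (by fun_prop) (by fun_prop)
    (fun z hz => ⟨hi1 _ hz.1, hz.2⟩) (fun z hz => ⟨hr1 _ hz.1, hz.2⟩) ?_ ?_ ?_
    (fun _ hz => Prod.ext (hri _ hz.1) rfl) ?_
  · rintro z (hz | hz)
    exacts [Or.inl ⟨hi2 _ hz.1, hz.2⟩, Or.inr ⟨hi1 _ hz.1, hz.2⟩]
  · rintro z (hz | hz)
    exacts [Or.inl ⟨hr2 _ hz.1, hz.2⟩, Or.inr ⟨hr1 _ hz.1, hz.2⟩]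
  · exact Set.union_subset (Set.prod_mono (cubeBd_subset _) le_rfl) (Set.prod_mono le_rfl hP)
  · exact Set.union_subset (Set.prod_mono (fun x hx => hx.1) le_rfl) (Set.prod_mono le_rfl hP)

/-- The union of the cells in a set of faces. -/
def support (S : Set (Face ι)) : Set (ι → ℝ) := ⋃ σ ∈ S, σ.cell

theorem mem_support {S : Set (Face ι)} {x : ι → ℝ} : x ∈ support S ↔ ∃ σ ∈ S, x ∈ σ.cell := by
  simp [support]

theorem isClosed_support [Finite ι] {S : Set (Face ι)} (hS : S.Finite) : IsClosed (support S) :=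
  hS.isClosed_biUnion fun σ _ => σ.isClosed_cell

/-- Subcomplexes of the cubical decomposition. -/
def IsComplex (S : Set (Face ι)) : Prop := ∀ τ ∈ S, ∀ σ : Face ι, σ.Le τ → σ ∈ S

/-- Lifting over a finite relative complex, cell by cell. -/
theorem hasLift_support [Finite ι] {S S₀ : Set (Face ι)} (hSf : S.Finite) (hS : IsComplex S)
    (hS₀ : IsComplex S₀) (hSS : S₀ ⊆ S) {P P₀ : Set T} (hPc : IsClosed P) (hP₀c : IsClosed P₀)
    (hP : P₀ ⊆ P)
    (h : ∀ σ ∈ S, σ ∉ S₀ → HasLift p (σ.cell ×ˢ P) (σ.bd ×ˢ P ∪ σ.cell ×ˢ P₀)) :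
    HasLift p (support S ×ˢ P) (support S₀ ×ˢ P ∪ support S ×ˢ P₀) := by
  classical
  -- Induction on the number of cells outside `S₀`. The part `support S ×ˢ P₀` stays prescribed
  -- throughout, so that only the attachment of `σ.cell ×ˢ P` has to be treated.
  have key : ∀ (n : ℕ) (S₁ : Set (Face ι)), IsComplex S₁ → S₀ ⊆ S₁ → S₁ ⊆ S →
      (S₁ \ S₀).ncard = n → HasLift p (support S₁ ×ˢ P ∪ support S ×ˢ P₀)
        (support S₀ ×ˢ P ∪ support S ×ˢ P₀) := by
    intro n
    induction n with
    | zero =>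
      intro S₁ _ h01 h1 hn
      rw [Set.ncard_eq_zero ((hSf.subset h1).sdiff), Set.sdiff_eq_empty] at hn
      rw [subset_antisymm hn h01]
      exact HasLift.refl _
    | succ n ih =>
      intro S₁ hS₁ h01 h1 hn
      have hfin : (S₁ \ S₀).Finite := (hSf.subset h1).sdiff
      have hne : (S₁ \ S₀).Nonempty := by
        rw [← Set.ncard_pos hfin]; omega
      -- A cell of maximal dimension outside `S₀` is not a proper face of any cell of `S₁`. It can
      -- be removed without destroying the complex, and its interior misses the rest.
      obtain ⟨σ, ⟨hσ1, hσ0⟩, hmax⟩ := Set.exists_max_image (S₁ \ S₀) (fun σ => σ.D.card) hfin hne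
      have hle : ∀ τ ∈ S₁, σ.Le τ → τ = σ := by
        intro τ hτ hστ
        have hτ0 : τ ∉ S₀ := fun h0 => hσ0 (hS₀ τ h0 σ hστ)
        exact (hστ.eq_of_card_le (hmax τ ⟨hτ, hτ0⟩)).symm
      have hS₂ : IsComplex (S₁ \ {σ}) := by
        rintro τ ⟨hτ, hne⟩ ρ hρ
        refine ⟨hS₁ τ hτ ρ hρ, fun he => hne ?_⟩
        rw [Set.mem_singleton_iff] at he
        subst he
        exact hle τ hτ hρ
      have h02 : S₀ ⊆ S₁ \ {σ} := fun τ hτ => ⟨h01 hτ, fun he => hσ0 (by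
        rw [Set.mem_singleton_iff] at he; exact he ▸ hτ)⟩
      have hn2 : ((S₁ \ {σ}) \ S₀).ncard = n := by
        have h3 : (S₁ \ {σ}) \ S₀ = (S₁ \ S₀) \ {σ} := by
          ext τ; simp only [Set.mem_sdiff]; tauto
        rw [h3, Set.ncard_sdiff_singleton_of_mem (show σ ∈ S₁ \ S₀ from ⟨hσ1, hσ0⟩), hn]
        rfl
      have h2 : S₁ \ {σ} ⊆ S := Set.sdiff_subset.trans h1
      have hX : support S₁ ×ˢ P ∪ support S ×ˢ P₀ =
          σ.cell ×ˢ P ∪ (support (S₁ \ {σ}) ×ˢ P ∪ support S ×ˢ P₀) := by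
        rw [← Set.union_assoc, ← Set.union_prod]
        congr 2
        ext x
        simp only [mem_support, Set.mem_union, Set.mem_sdiff, Set.mem_singleton_iff]
        constructor
        · rintro ⟨τ, hτ, hx⟩
          by_cases he : τ = σ
          · subst he; exact Or.inl hx
          · exact Or.inr ⟨τ, ⟨hτ, he⟩, hx⟩
        · rintro (hx | ⟨τ, ⟨hτ, -⟩, hx⟩)
          exacts [⟨σ, hσ1, hx⟩, ⟨τ, hτ, hx⟩]
      rw [hX]
      refine HasLift.trans ?_ (ih _ hS₂ h02 h2 hn2) ?_ Set.subset_union_right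
      · refine (h σ (h1 hσ1) hσ0).union (σ.isClosed_cell.prod hPc)
          (((isClosed_support (hSf.subset h2)).prod hPc).union
            ((isClosed_support hSf).prod hP₀c)) ?_ ?_
        · rintro ⟨x, t⟩ (⟨hx, ht⟩ | ⟨hx, ht⟩)
          · refine ⟨⟨hx.1, ht⟩, Or.inl ⟨?_, ht⟩⟩
            obtain ⟨τ, hτ, hne, hxτ⟩ := exists_le_of_mem_bd hx
            exact mem_support.2 ⟨τ, ⟨hS₁ σ hσ1 τ hτ, hne⟩, hxτ⟩
          · exact ⟨⟨hx, hP ht⟩, Or.inr ⟨mem_support.2 ⟨σ, h1 hσ1, hx⟩, ht⟩⟩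
        · rintro ⟨x, t⟩ ⟨⟨hx, ht⟩, ⟨hx', -⟩ | ⟨-, ht'⟩⟩
          · by_cases hb : x ∈ σ.bd
            · exact Or.inl ⟨hb, ht⟩
            · obtain ⟨τ, hτ, hxτ⟩ := mem_support.1 hx'
              exact absurd (hle τ hτ.1 (le_of_mem hx hb hxτ)) hτ.2
          · exact Or.inr ⟨hx, ht'⟩
      · refine Set.union_subset_union_left _ (Set.prod_mono ?_ le_rfl)
        exact Set.biUnion_subset_biUnion_left h02
  have h1 := key _ S hS hSS le_rfl rfl
  rwa [Set.union_eq_left.2 (Set.prod_mono le_rfl hP)] at h1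

/-- The complex of all faces of top-dimensional cells which meet `C`. -/
def hull [Fintype ι] (C : Set (ι → ℝ)) : Set (Face ι) :=
  {σ | ∃ τ : Face ι, τ.D = Finset.univ ∧ (τ.cell ∩ C).Nonempty ∧ σ.Le τ}

theorem isComplex_hull [Fintype ι] (C : Set (ι → ℝ)) : IsComplex (hull C) := by
  rintro τ ⟨ρ, h1, h2, h3⟩ σ h
  exact ⟨ρ, h1, h2, h.trans h3⟩

theorem finite_hull [Fintype ι] {C : Set (ι → ℝ)} {R : ℤ} (hC : ∀ x ∈ C, ∀ j, |x j| ≤ R) :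
    (hull C).Finite := by
  classical
  let F : Set ((ι → ℤ) × Finset ι) := (Set.univ.pi fun _ => Set.Icc (-R - 1) (R + 1)) ×ˢ Set.univ
  have hF : F.Finite := (Set.Finite.pi' fun _ => Set.finite_Icc _ _).prod Set.finite_univ |>.subset
    fun z hz => ⟨fun j => hz.1 j trivial, trivial⟩
  refine (hF.image fun z => (⟨z.1, z.2⟩ : Face ι)).subset ?_
  rintro σ ⟨τ, hτ, ⟨x, hx, hxC⟩, hστ⟩
  refine ⟨(σ.a, σ.D), ⟨fun j _ => ?_, trivial⟩, rfl⟩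
  have h1 := (hx j).1 (hτ ▸ Finset.mem_univ j)
  have h2 := abs_le.1 (hC x hxC j)
  have h3 : (τ.a j : ℝ) ≤ R := by linarith
  have h4 : (-R - 1 : ℝ) ≤ τ.a j := by linarith
  norm_cast at h3
  have h4 : -R - 1 ≤ τ.a j := by exact_mod_cast h4
  have h5 := hστ j
  have h6 : σ.a j = τ.a j ∨ σ.a j = τ.a j + 1 := by
    by_cases hj : j ∈ σ.D
    · exact Or.inl (h5.1 hj).2
    · exact (h5.2 hj).imp id fun h => h.2
  change -R - 1 ≤ σ.a j ∧ σ.a j ≤ R + 1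
  omega

theorem subset_support_hull [Fintype ι] (C : Set (ι → ℝ)) : C ⊆ support (hull C) := by
  intro x hx
  let τ : Face ι := ⟨fun j => ⌊x j⌋, Finset.univ⟩
  have hτ : x ∈ τ.cell := fun j => ⟨fun _ => ⟨Int.floor_le _, (Int.lt_floor_add_one _).le⟩,
    fun h => absurd (Finset.mem_univ j) h⟩
  exact mem_support.2 ⟨τ, ⟨τ, rfl, ⟨x, hτ, hx⟩, Le.refl τ⟩, hτ⟩

theorem Le.cell_subset {σ τ : Face ι} (h : σ.Le τ) : σ.cell ⊆ τ.cell := by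
  intro x hx j
  have h1 := h j
  have h2 := hx j
  by_cases hj : j ∈ σ.D
  · obtain ⟨h3, h4⟩ := h1.1 hj
    rw [h4] at h2
    exact ⟨fun _ => h2.1 hj, fun h => absurd h3 h⟩
  · have h3 := h2.2 hj
    rcases h1.2 hj with h4 | ⟨h4, h5⟩
    · rw [h3, h4]
      simp
    · rw [h3, h5]
      simp [h4]

/-- Such a point shares a unit cube with a point of `C`. This controls how far the complex reaches
out of a rescaled manifold. -/
theorem exists_near_of_mem_support_hull [Fintype ι] {C : Set (ι → ℝ)} {y : ι → ℝ}
    (hy : y ∈ support (hull C)) : ∃ x ∈ C, ‖y - x‖ ≤ 1 := by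
  obtain ⟨σ, ⟨τ, hτ, ⟨x, hx, hxC⟩, hστ⟩, hyσ⟩ := mem_support.1 hy
  have hyτ := hστ.cell_subset hyσ
  refine ⟨x, hxC, (pi_norm_le_iff_of_nonneg zero_le_one).2 fun j => ?_⟩
  have hj : j ∈ τ.D := hτ ▸ Finset.mem_univ j
  have h1 := (hx j).1 hj
  have h2 := (hyτ j).1 hj
  rw [Real.norm_eq_abs, abs_le, Pi.sub_apply]
  constructor <;> linarith

/-- The left factor of a face of `ℝ^ι × ℝ^κ`. -/
def left {κ : Type} (ρ : Face (ι ⊕ κ)) : Face ι := ⟨fun j => ρ.a (.inl j), ρ.D.toLeft⟩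

/-- The right factor of a face of `ℝ^ι × ℝ^κ`. -/
def right {κ : Type} (ρ : Face (ι ⊕ κ)) : Face κ := ⟨fun j => ρ.a (.inr j), ρ.D.toRight⟩

theorem mem_cell_sum {κ : Type} {ρ : Face (ι ⊕ κ)} {x : ι ⊕ κ → ℝ} :
    x ∈ ρ.cell ↔ x ∘ Sum.inl ∈ ρ.left.cell ∧ x ∘ Sum.inr ∈ ρ.right.cell := by
  simp [cell, left, right, Sum.forall]

theorem Le.left {κ : Type} {ρ ρ' : Face (ι ⊕ κ)} (h : ρ.Le ρ') : ρ.left.Le ρ'.left := fun j => by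
  simpa [Face.left] using h (.inl j)

theorem Le.right {κ : Type} {ρ ρ' : Face (ι ⊕ κ)} (h : ρ.Le ρ') : ρ.right.Le ρ'.right :=
  fun j => by simpa [Face.right] using h (.inr j)

/-- The product of complexes. -/
def prod {κ : Type} (S : Set (Face ι)) (S' : Set (Face κ)) : Set (Face (ι ⊕ κ)) :=
  {ρ | ρ.left ∈ S ∧ ρ.right ∈ S'}

theorem isComplex_prod {κ : Type} {S : Set (Face ι)} {S' : Set (Face κ)} (hS : IsComplex S)
    (hS' : IsComplex S') : IsComplex (prod S S') :=
  fun _ hτ _ h => ⟨hS _ hτ.1 _ h.left, hS' _ hτ.2 _ h.right⟩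

theorem finite_prod {κ : Type} {S : Set (Face ι)} {S' : Set (Face κ)} (hS : S.Finite)
    (hS' : S'.Finite) : (prod S S').Finite := by
  refine Set.Finite.of_finite_image ((hS.prod hS').subset (?_ :
    (fun ρ : Face (ι ⊕ κ) => (ρ.left, ρ.right)) '' prod S S' ⊆ _)) ?_
  · rintro _ ⟨ρ, hρ, rfl⟩
    exact hρ
  · rintro ⟨a, D⟩ - ⟨a', D'⟩ - h
    simp only [left, right, Prod.mk.injEq, Face.mk.injEq] at h
    obtain ⟨⟨h1, h2⟩, h3, h4⟩ := h
    congr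
    · funext j
      cases j
      exacts [congrFun h1 _, congrFun h3 _]
    · ext j
      cases j
      · rw [← Finset.mem_toLeft, h2, Finset.mem_toLeft]
      · rw [← Finset.mem_toRight, h4, Finset.mem_toRight]

theorem mem_support_prod {κ : Type} {S : Set (Face ι)} {S' : Set (Face κ)} {x : ι ⊕ κ → ℝ} :
    x ∈ support (prod S S') ↔ x ∘ Sum.inl ∈ support S ∧ x ∘ Sum.inr ∈ support S' := by
  simp only [mem_support]
  constructor
  · rintro ⟨ρ, hρ, hx⟩
    exact ⟨⟨_, hρ.1, (mem_cell_sum.1 hx).1⟩, _, hρ.2, (mem_cell_sum.1 hx).2⟩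
  · rintro ⟨⟨σ, hσ, hx⟩, τ, hτ, hx'⟩
    let ρ : Face (ι ⊕ κ) := ⟨Sum.elim σ.a τ.a, σ.D.disjSum τ.D⟩
    have h1 : ρ.left = σ := by
      have : ρ.D.toLeft = σ.D := Finset.toLeft_disjSum
      simp only [left, this]
      rfl
    have h2 : ρ.right = τ := by
      have : ρ.D.toRight = τ.D := Finset.toRight_disjSum
      simp only [right, this]
      rfl
    exact ⟨ρ, ⟨h1 ▸ hσ, h2 ▸ hτ⟩, mem_cell_sum.2 ⟨h1 ▸ hx, h2 ▸ hx'⟩⟩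

end Face

end

/-! ### Retracts of finite complexes -/

noncomputable section

open scoped unitInterval

/-- The space `X` is a retract of the finite cubical complex `S` in `ℝ^ι`. -/
structure CubRetract (X : Type) [TopologicalSpace X] where
  {ι : Type}
  [fintype : Fintype ι]
  S : Set (Face ι)
  finite : S.Finite
  isComplex : Face.IsComplex S
  i : X → ι → ℝ
  r : (ι → ℝ) → X
  continuous_i : Continuous i
  continuousOn_r : ContinuousOn r (Face.support S)
  i_mem : ∀ x, i x ∈ Face.support S
  r_i : ∀ x, r (i x) = x

attribute [instance] CubRetract.fintype

namespace CubRetract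

variable {X Y : Type} [TopologicalSpace X] [TopologicalSpace Y]

/-- Products of retracts of complexes. -/
def prod (c : CubRetract X) (c' : CubRetract Y) : CubRetract (X × Y) where
  ι := c.ι ⊕ c'.ι
  S := Face.prod c.S c'.S
  finite := Face.finite_prod c.finite c'.finite
  isComplex := Face.isComplex_prod c.isComplex c'.isComplex
  i z := Sum.elim (c.i z.1) (c'.i z.2)
  r x := (c.r (x ∘ Sum.inl), c'.r (x ∘ Sum.inr))
  continuous_i := by
    refine continuous_pi fun j => ?_
    cases j
    · exact (continuous_apply _).comp (c.continuous_i.comp continuous_fst)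
    · exact (continuous_apply _).comp (c'.continuous_i.comp continuous_snd)
  continuousOn_r := (c.continuousOn_r.comp (by fun_prop) fun _ hx =>
      (Face.mem_support_prod.1 hx).1).prodMk
    (c'.continuousOn_r.comp (by fun_prop) fun _ hx => (Face.mem_support_prod.1 hx).2)
  i_mem z := Face.mem_support_prod.2 ⟨c.i_mem z.1, c'.i_mem z.2⟩
  r_i z := Prod.ext (c.r_i z.1) (c'.r_i z.2)

/-- The unit interval as a complex. -/
def interval : CubRetract I where
  ι := Unit
  S := {ρ | ρ.Le ⟨fun _ => 0, Finset.univ⟩}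
  finite := by
    refine (Face.finite_hull (C := {fun _ : Unit => (1 / 2 : ℝ)}) (R := 1) ?_).subset ?_
    · rintro _ rfl _
      norm_num [abs_le]
    · exact fun ρ hρ => ⟨_, rfl, ⟨_, fun j => by norm_num, rfl⟩, hρ⟩
  isComplex := fun _ hτ _ h => h.trans hτ
  i t _ := t
  r x := clampI (x ())
  continuous_i := by fun_prop
  continuousOn_r := (continuous_clampI.comp (continuous_apply ())).continuousOn
  i_mem t := Face.mem_support.2 ⟨⟨fun _ => 0, Finset.univ⟩, Face.Le.refl _, fun j => by
    exact ⟨fun _ => by simpa using And.intro t.2.1 t.2.2, fun h => absurd (Finset.mem_univ _) h⟩⟩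
  r_i t := clampI_coe t

variable {E B : Type*} [TopologicalSpace E] [TopologicalSpace B] {p : E → B}

theorem hlp_support (hp : Serre p) {ι : Type} [Fintype ι] {S : Set (Face ι)} (hS : S.Finite)
    (hS' : Face.IsComplex S) : HLP p (Face.support S) := by
  classical
  have h := Face.hasLift_support hS hS' (S₀ := ∅) (fun _ h => absurd h (Set.notMem_empty _))
    (Set.empty_subset _) (P := Set.Icc (0 : ℝ) 1) (P₀ := {0}) isClosed_Icc isClosed_singleton
    (by simp) fun ρ _ _ => ρ.hasLift_cell (by simp) (hp.cubeBd_zero _)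
  have he : Face.support (∅ : Set (Face ι)) = ∅ := by simp [Face.support]
  rw [he, Set.empty_prod, Set.empty_union] at h
  exact h

theorem hlp (c : CubRetract X) (hp : Serre p) : HLP p (Set.univ : Set X) :=
  (hlp_support hp c.finite c.isComplex).of_retract c.i c.r c.continuous_i.continuousOn
    c.continuousOn_r (fun x _ => c.i_mem x) (fun _ _ => trivial) fun x _ => c.r_i x

/-- The homotopy lifting property for retracts of complexes. -/
theorem lift_homotopy (c : CubRetract X) (hp : Serre p) {u : X × I → B} (hu : Continuous u)
    {a : X → E} (ha : Continuous a) (h : ∀ x, p (a x) = u (x, 0)) :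
    ∃ v : X × I → E, Continuous v ∧ (∀ x, v (x, 0) = a x) ∧ ∀ z, p (v z) = u z := by
  have hc := continuous_clampI
  obtain ⟨v, hv, hva, hvu⟩ := c.hlp hp (fun z => u (z.1, clampI z.2)) (fun z => a z.1)
    (by fun_prop) (by fun_prop) (by
      rintro ⟨x, t⟩ ⟨-, ht⟩
      have ht : t = 0 := ht
      subst ht
      simp [h])
  refine ⟨fun z => v (z.1, z.2), hv.comp_continuous (by fun_prop) fun z => ⟨trivial, z.2.2⟩,
    fun x => hva ⟨trivial, by simp⟩, fun z => ?_⟩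
  exact (hvu (z.1, z.2) ⟨trivial, z.2.2⟩).trans (by simp)

/-- Lifting a map on `X × [0, 1] × [0, 1]` with prescribed lifts on three sides of the square. -/
theorem lift_square (c : CubRetract X) (hp : Serre p) {u : X × I × I → B} (hu : Continuous u)
    {a a₀ a₁ : X × I → E} (ha : Continuous a) (ha₀ : Continuous a₀) (ha₁ : Continuous a₁)
    (h : ∀ x t, p (a (x, t)) = u (x, t, 0)) (h₀ : ∀ x s, p (a₀ (x, s)) = u (x, 0, s))
    (h₁ : ∀ x s, p (a₁ (x, s)) = u (x, 1, s)) (hc₀ : ∀ x, a (x, 0) = a₀ (x, 0))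
    (hc₁ : ∀ x, a (x, 1) = a₁ (x, 0)) :
    ∃ v : X × I × I → E, Continuous v ∧ (∀ z, p (v z) = u z) ∧ (∀ x t, v (x, t, 0) = a (x, t)) ∧
      (∀ x s, v (x, 0, s) = a₀ (x, s)) ∧ ∀ x s, v (x, 1, s) = a₁ (x, s) := by
  have hc := continuous_clampI
  -- One side of the square is rescaled to `[-1, 1]`, the unit ball of `ℝ`. The three sides with
  -- prescribed lifts are then `∂D × [0, 1] ∪ D × 0`, and `HLP.ball_prod` applies with parameters in
  -- `X`.
  let q : ℝ → I := fun y => clampI ((y + 1) / 2)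
  have hq : Continuous q := by fun_prop
  let Q : Set (ℝ × ℝ) := closedBall (0 : ℝ) 1 ×ˢ Set.Icc (0 : ℝ) 1
  have hmem : ∀ t : I, (2 * (t : ℝ) - 1) ∈ closedBall (0 : ℝ) 1 := fun t => by
    rw [mem_closedBall_zero_iff, Real.norm_eq_abs, abs_le]
    constructor <;> linarith [t.2.1, t.2.2]
  have hqt : ∀ t : I, q (2 * (t : ℝ) - 1) = t := fun t => by
    have h1 : (2 * (t : ℝ) - 1 + 1) / 2 = t := by ring
    simp only [q, h1, clampI_coe]
  have hH : HLP p ((Set.univ : Set X) ×ˢ Q) := by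
    refine ((c.prod (interval.prod interval)).hlp hp).of_retract
      (fun z => (z.1, q z.2.1, clampI z.2.2))
      (fun z => (z.1, 2 * (z.2.1 : ℝ) - 1, (z.2.2 : ℝ))) (by fun_prop) (by fun_prop)
      (fun _ _ => trivial) (fun z _ => ⟨trivial, hmem _, z.2.2.2⟩) ?_
    rintro ⟨x, y, s⟩ ⟨-, hy, hs⟩
    rw [mem_closedBall_zero_iff, Real.norm_eq_abs, abs_le] at hy
    have h1 : ((q y : I) : ℝ) = (y + 1) / 2 := coe_clampI ⟨by linarith, by linarith⟩
    refine Prod.ext rfl (Prod.ext ?_ (coe_clampI hs))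
    simp only [h1]
    ring
  -- the prescribed lift on three sides
  have hsp : ∀ y : ℝ, y ∈ sphere (0 : ℝ) 1 ↔ y = -1 ∨ y = 1 := fun y => by
    rw [mem_sphere_zero_iff_norm, Real.norm_eq_abs, abs_eq zero_le_one, or_comm]
  obtain ⟨F, hF, hF0, hF1⟩ := exists_glue (Z := X × ℝ × ℝ)
    (S := Set.univ ×ˢ ({-1} ×ˢ Set.Icc (0 : ℝ) 1)) (S' := Set.univ ×ˢ ({1} ×ˢ Set.Icc (0 : ℝ) 1))
    (isClosed_univ.prod (isClosed_singleton.prod isClosed_Icc))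
    (isClosed_univ.prod (isClosed_singleton.prod isClosed_Icc))
    (f := fun z => a₀ (z.1, clampI z.2.2)) (f' := fun z => a₁ (z.1, clampI z.2.2))
    (by fun_prop) (by fun_prop) (by
      rintro ⟨x, y, s⟩ ⟨-, hy, -⟩ ⟨-, hy', -⟩
      have hy : y = -1 := hy
      have hy' : y = 1 := hy'
      norm_num [hy] at hy')
  have hS : ((Set.univ : Set X) ×ˢ (sphere (0 : ℝ) 1 ×ˢ Set.Icc (0 : ℝ) 1)) =
      Set.univ ×ˢ ({-1} ×ˢ Set.Icc (0 : ℝ) 1) ∪ Set.univ ×ˢ ({1} ×ˢ Set.Icc (0 : ℝ) 1) := by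
    rw [← Set.prod_union, ← Set.union_prod]
    congr 2
    ext y
    rw [hsp]
    rfl
  have hq0 : q (-1) = 0 := by simp [q]
  have hq1 : q 1 = 1 := by simp [q]
  obtain ⟨G, hG, hGF, hGa⟩ := exists_glue (Z := X × ℝ × ℝ)
    (S := Set.univ ×ˢ (sphere (0 : ℝ) 1 ×ˢ Set.Icc (0 : ℝ) 1))
    (S' := Set.univ ×ˢ (closedBall (0 : ℝ) 1 ×ˢ {(0 : ℝ)}))
    (isClosed_univ.prod (isClosed_sphere.prod isClosed_Icc))
    (isClosed_univ.prod (isClosed_closedBall.prod isClosed_singleton))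
    (f := F) (f' := fun z => a (z.1, q z.2.1)) (hS ▸ hF) (by fun_prop) (by
      rintro ⟨x, y, s⟩ ⟨-, hy, hs⟩ ⟨-, -, hs'⟩
      have hs' : s = 0 := hs'
      subst hs'
      rcases (hsp y).1 hy with rfl | rfl
      · rw [hF0 (x, -1, 0) ⟨trivial, rfl, hs⟩]
        simp [hq0, hc₀]
      · rw [hF1 (x, 1, 0) ⟨trivial, rfl, hs⟩]
        simp [hq1, hc₁])
  rw [← Set.prod_union] at hG
  obtain ⟨v, hv, hva, hvu⟩ := hH.ball_prod (fun z => u (z.1, q z.2.1, clampI z.2.2)) G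
    (by fun_prop) hG (by
      rintro ⟨x, y, s⟩ ⟨-, ⟨hy, hs⟩ | ⟨hy, hs⟩⟩
      · rw [hGF _ ⟨trivial, hy, hs⟩]
        rcases (hsp y).1 hy with rfl | rfl
        · rw [hF0 (x, -1, s) ⟨trivial, rfl, hs⟩, h₀, hq0]
        · rw [hF1 (x, 1, s) ⟨trivial, rfl, hs⟩, h₁, hq1]
      · rw [hGa _ ⟨trivial, hy, hs⟩, h]
        have hs : s = 0 := hs
        rw [hs, clampI_zero])
  refine ⟨fun z => v (z.1, 2 * (z.2.1 : ℝ) - 1, z.2.2), hv.comp_continuous (by fun_prop)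
    fun z => ⟨trivial, hmem _, z.2.2.2⟩, fun z => ?_, fun x t => ?_, fun x s => ?_, fun x s => ?_⟩
  · refine (hvu _ ⟨trivial, hmem _, z.2.2.2⟩).trans ?_
    simp only [hqt, clampI_coe]
  · refine (hva ⟨trivial, Or.inr ⟨hmem t, by simp⟩⟩).trans ?_
    rw [hGa _ ⟨trivial, hmem t, by simp⟩]
    simp only [hqt]
  · have h2 : (2 * ((0 : I) : ℝ) - 1) = -1 := by simp
    simp only [h2]
    have h3 : (-1 : ℝ) ∈ sphere (0 : ℝ) 1 := (hsp _).2 (Or.inl rfl)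
    refine (hva ⟨trivial, Or.inl ⟨h3, s.2⟩⟩).trans ?_
    rw [hGF _ ⟨trivial, h3, s.2⟩, hF0 (x, -1, s) ⟨trivial, rfl, s.2⟩]
    simp only [clampI_coe]
  · have h2 : (2 * ((1 : I) : ℝ) - 1) = 1 := by norm_num
    simp only [h2]
    have h3 : (1 : ℝ) ∈ sphere (0 : ℝ) 1 := (hsp _).2 (Or.inr rfl)
    refine (hva ⟨trivial, Or.inl ⟨h3, s.2⟩⟩).trans ?_
    rw [hGF _ ⟨trivial, h3, s.2⟩, hF1 (x, 1, s) ⟨trivial, rfl, s.2⟩]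
    simp only [clampI_coe]

/-- If `X` is `(n - 1)`-connected, then the retraction of the complex to `X` is homotopic to a map
which is constant on the `(n - 1)`-skeleton. -/
theorem exists_contraction (c : CubRetract X) {x₀ : X} (hX : ∀ x : X, Joined x x₀) {n : ℕ}
    (h : ∀ k < n, Subsingleton (HomotopyGroup.Pi k X x₀)) :
    ∃ R : (c.ι → ℝ) × ℝ → X, ContinuousOn R (Face.support c.S ×ˢ Set.Icc (0 : ℝ) 1) ∧
      (∀ y ∈ Face.support c.S, R (y, 0) = c.r y) ∧
      ∀ y ∈ Face.support {ρ ∈ c.S | ρ.D.card < n}, R (y, 1) = x₀ := by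
  classical
  set S₀ : Set (Face c.ι) := {ρ ∈ c.S | ρ.D.card < n} with hS₀
  have hS₀S : S₀ ⊆ c.S := fun ρ hρ => hρ.1
  have hS₀c : Face.IsComplex S₀ := fun τ hτ ρ hρ =>
    ⟨c.isComplex τ hτ.1 ρ hρ, hρ.card_le.trans_lt hτ.2⟩
  have hS₀f := c.finite.subset hS₀S
  have hsub : Face.support S₀ ⊆ Face.support c.S := Set.biUnion_subset_biUnion_left hS₀S
  -- On the `(n-1)`-skeleton, `c.r` at time `0` and the constant `x₀` at time `1` are joined cell by
  -- cell; over a `k`-cell the obstruction lies in `π_k(X) = 0`, as `k < n`.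
  have h1 := Face.hasLift_support (p := fun _ : X => ()) hS₀f hS₀c (S₀ := ∅)
    (fun _ h => absurd h (Set.notMem_empty _))
    (Set.empty_subset _) (P := Set.Icc (0 : ℝ) 1) (P₀ := {0, 1}) isClosed_Icc
    (Set.Finite.isClosed (by simp)) (by rintro t (rfl | rfl) <;> simp)
    fun ρ hρ _ => ρ.hasLift_cell (by rintro t (rfl | rfl) <;> simp)
      (hasLift_boxBd_of_connected hX (h _ hρ.2))
  obtain ⟨a, ha, ha0, ha1⟩ := exists_glue (S := Face.support S₀ ×ˢ {(0 : ℝ)})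
    (S' := Face.support S₀ ×ˢ {(1 : ℝ)})
    ((Face.isClosed_support hS₀f).prod isClosed_singleton)
    ((Face.isClosed_support hS₀f).prod isClosed_singleton)
    (f := fun z => c.r z.1) (f' := fun _ => x₀)
    (c.continuousOn_r.comp continuousOn_fst fun z hz => hsub hz.1) continuousOn_const (by
      rintro ⟨y, t⟩ ⟨-, ht⟩ ⟨-, ht'⟩
      have ht : t = 0 := ht
      have ht' : t = 1 := ht'
      norm_num [ht] at ht')
  have hset : Face.support (∅ : Set (Face c.ι)) ×ˢ Set.Icc (0 : ℝ) 1 ∪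
      Face.support S₀ ×ˢ {(0 : ℝ), 1} =
      Face.support S₀ ×ˢ {(0 : ℝ)} ∪ Face.support S₀ ×ˢ {(1 : ℝ)} := by
    rw [← Set.prod_union, ← Set.insert_eq]
    simp [Face.support]
  obtain ⟨R₀, hR₀, hR₀a, -⟩ := h1 (fun _ => ()) a continuousOn_const (hset ▸ ha) fun _ _ => rfl
  -- Homotopy extension from the skeleton to the whole complex.
  have h2 := Face.hasLift_support (p := fun _ : X => ()) c.finite c.isComplex hS₀c hS₀S
    (P := Set.Icc (0 : ℝ) 1) (P₀ := {0}) isClosed_Icc isClosed_singleton (by simp)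
    fun ρ _ _ => ρ.hasLift_cell (by simp) (serre_const.cubeBd_zero _)
  obtain ⟨a', ha', ha'0, ha'1⟩ := exists_glue (S := Face.support S₀ ×ˢ Set.Icc (0 : ℝ) 1)
    (S' := Face.support c.S ×ˢ {(0 : ℝ)})
    ((Face.isClosed_support hS₀f).prod isClosed_Icc)
    ((Face.isClosed_support c.finite).prod isClosed_singleton)
    (f := R₀) (f' := fun z => c.r z.1) hR₀
    (c.continuousOn_r.comp continuousOn_fst fun z hz => hz.1) (by
      rintro ⟨y, t⟩ ⟨hy, -⟩ ⟨-, ht⟩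
      have hm : (y, t) ∈ Face.support S₀ ×ˢ {(0 : ℝ)} := ⟨hy, ht⟩
      rw [hR₀a (hset ▸ Or.inl hm), ha0 _ hm])
  obtain ⟨R, hR, hRa, -⟩ := h2 (fun _ => ()) a' continuousOn_const ha' fun _ _ => rfl
  refine ⟨R, hR, fun y hy => ?_, fun y hy => ?_⟩
  · exact (hRa (x := (y, 0)) (Or.inr ⟨hy, rfl⟩)).trans (ha'1 (y, 0) ⟨hy, rfl⟩)
  · have hm : (y, (1 : ℝ)) ∈ Face.support S₀ ×ˢ {(1 : ℝ)} := ⟨hy, rfl⟩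
    refine (hRa (Or.inl ⟨hy, by simp⟩)).trans ((ha'0 (y, 1) ⟨hy, by simp⟩).trans ?_)
    rw [hR₀a (hset ▸ Or.inr hm), ha1 _ hm]

/-- Two lifts `l`, `l'` of a map `S × M → B` along a Serre fibration, which are fibrewise homotopic
on `S × m₀`, are fibrewise homotopic, provided that `M` is `(n - 1)`-connected and `p` lifts
extensions over cubes of dimension greater than `n`. -/
theorem lift_unique {S M : Type} [TopologicalSpace S] [TopologicalSpace M] (cS : CubRetract S)
    (cM : CubRetract M) (hp : Serre p) (hpc : Continuous p) {n : ℕ}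
    (hpn : ∀ k, n ≤ k → HasLift p (Set.Icc (0 : Fin k → ℝ) 1 ×ˢ Set.Icc (0 : ℝ) 1) (boxBd (Fin k)))
    {m₀ : M} (hM : ∀ m : M, Joined m m₀) (hM' : ∀ k < n, Subsingleton (HomotopyGroup.Pi k M m₀))
    {l l' : S × M → E} (hl : Continuous l) (hl' : Continuous l') (hll : ∀ z, p (l z) = p (l' z))
    {H : S × I → E} (hH : Continuous H) (hHp : ∀ s t, p (H (s, t)) = p (l (s, m₀)))
    (hH0 : ∀ s, H (s, 0) = l (s, m₀)) (hH1 : ∀ s, H (s, 1) = l' (s, m₀)) :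
    ∃ G : (S × M) × I → E, Continuous G ∧ (∀ z t, p (G (z, t)) = p (l z)) ∧
      (∀ z, G (z, 0) = l z) ∧ ∀ z, G (z, 1) = l' z := by
  classical
  have hc := continuous_clampI
  obtain ⟨R, hR, hR0, hR1⟩ := cM.exists_contraction hM hM'
  -- The product of the first complex with the `(n-1)`-skeleton of the second one. Below, `g` maps
  -- it to `S × m₀`, where `H` is the required homotopy. A cell outside `S₀` has a right factor of
  -- dimension at least `n`, hence itself dimension at least `n`, and `hpn` applies to it.
  let S₀ : Set (Face (cS.ι ⊕ cM.ι)) := Face.prod cS.S {ρ ∈ cM.S | ρ.D.card < n}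
  have hcx := Face.isComplex_prod cS.isComplex cM.isComplex
  have hS₀c : Face.IsComplex S₀ := Face.isComplex_prod cS.isComplex fun τ hτ ρ hρ =>
    ⟨cM.isComplex τ hτ.1 ρ hρ, hρ.card_le.trans_lt hτ.2⟩
  have hfin := Face.finite_prod cS.finite cM.finite
  have hS₀S : S₀ ⊆ Face.prod cS.S cM.S := fun ρ hρ => ⟨hρ.1, hρ.2.1⟩
  have hS₀f := hfin.subset hS₀S
  have hsub : Face.support S₀ ⊆ Face.support (Face.prod cS.S cM.S) :=
    Set.biUnion_subset_biUnion_left hS₀S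
  have h1 := Face.hasLift_support (p := p) hfin hcx hS₀c hS₀S
    (P := Set.Icc (0 : ℝ) 1) (P₀ := {0, 1}) isClosed_Icc (Set.Finite.isClosed (by simp))
    (by rintro t (rfl | rfl) <;> simp)
    fun ρ hρ hρ0 => ρ.hasLift_cell (by rintro t (rfl | rfl) <;> simp) (hpn _ (by
      by_contra hcard
      refine hρ0 ⟨hρ.1, hρ.2, lt_of_le_of_lt ?_ (not_le.1 hcard)⟩
      have h2 : (ρ.right.D.map ⟨Sum.inr, Sum.inr_injective⟩ : Finset (cS.ι ⊕ cM.ι)) ⊆ ρ.D := by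
        intro j hj
        obtain ⟨k, hk, rfl⟩ := Finset.mem_map.1 hj
        exact Finset.mem_toRight.1 hk
      simpa using Finset.card_le_card h2))
  -- the map `(s, k) ↦ (s, R(k, 1))` on the complex
  let g : (cS.ι ⊕ cM.ι → ℝ) → S × M := fun x => (cS.r (x ∘ Sum.inl), R (x ∘ Sum.inr, 1))
  have hg : ContinuousOn g (Face.support (Face.prod cS.S cM.S)) :=
    (cS.continuousOn_r.comp (by fun_prop) fun _ hx => (Face.mem_support_prod.1 hx).1).prodMk
      (hR.comp (by fun_prop) fun _ hx => ⟨(Face.mem_support_prod.1 hx).2, by simp⟩)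
  have hg0 : ∀ x ∈ Face.support S₀, g x = (cS.r (x ∘ Sum.inl), m₀) := fun x hx =>
    Prod.ext rfl (hR1 _ (Face.mem_support_prod.1 hx).2)
  have hclS := Face.isClosed_support hfin
  obtain ⟨a, ha, ha0, ha1⟩ := exists_glue
    (S := Face.support (Face.prod cS.S cM.S) ×ˢ {(0 : ℝ)})
    (S' := Face.support (Face.prod cS.S cM.S) ×ˢ {(1 : ℝ)})
    (hclS.prod isClosed_singleton) (hclS.prod isClosed_singleton)
    (f := fun z => l (g z.1)) (f' := fun z => l' (g z.1))
    (hl.comp_continuousOn (hg.comp continuousOn_fst fun z hz => hz.1))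
    (hl'.comp_continuousOn (hg.comp continuousOn_fst fun z hz => hz.1)) (by
      rintro ⟨y, t⟩ ⟨-, ht⟩ ⟨-, ht'⟩
      have ht : t = 0 := ht
      have ht' : t = 1 := ht'
      norm_num [ht] at ht')
  rw [← Set.prod_union] at ha
  obtain ⟨b, hb, hb0, hb1⟩ := exists_glue (S := Face.support S₀ ×ˢ Set.Icc (0 : ℝ) 1)
    (S' := Face.support (Face.prod cS.S cM.S) ×ˢ ({(0 : ℝ)} ∪ {1}))
    ((Face.isClosed_support hS₀f).prod isClosed_Icc)
    (hclS.prod (isClosed_singleton.union isClosed_singleton))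
    (f := fun z => H (cS.r (z.1 ∘ Sum.inl), clampI z.2)) (f' := a)
    (hH.comp_continuousOn ((cS.continuousOn_r.comp (by fun_prop) fun z hz =>
      (Face.mem_support_prod.1 hz.1).1).prodMk (by fun_prop))) ha (by
      rintro ⟨x, t⟩ ⟨hx, -⟩ ⟨hx', ht⟩
      rcases ht with ht | ht
      · rw [ha0 _ ⟨hx', ht⟩]
        have ht : t = 0 := ht
        subst ht
        simp [hg0 x hx, hH0]
      · rw [ha1 _ ⟨hx', ht⟩]
        have ht : t = 1 := ht
        subst ht
        simp [hg0 x hx, hH1])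
  obtain ⟨v, hv, hvb, hvu⟩ := h1 (fun z => p (l (g z.1))) b
    (hpc.comp_continuousOn (hl.comp_continuousOn (hg.comp continuousOn_fst fun z hz => hz.1))) hb
    (by
      rintro ⟨x, t⟩ (hz | ⟨hx, ht⟩)
      · rw [hb0 _ hz, hHp, hg0 x hz.1]
      · rw [hb1 _ ⟨hx, ht⟩]
        rcases ht with ht | ht
        · rw [ha0 _ ⟨hx, ht⟩]
        · rw [ha1 _ ⟨hx, ht⟩, hll])
  -- restrict to `S × M` and move back
  let i : S × M → (cS.ι ⊕ cM.ι → ℝ) := (cS.prod cM).i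
  have hi : Continuous i := (cS.prod cM).continuous_i
  have him : ∀ z, i z ∈ Face.support (Face.prod cS.S cM.S) := (cS.prod cM).i_mem
  -- The composite `g ∘ i` is not the identity, only homotopic to it: `K` follows the contraction
  -- `R` backwards, from `g ∘ i` to the identity.
  let K : (S × M) × I → S × M := fun z => (z.1.1, R (cM.i z.1.2, 1 - (z.2 : ℝ)))
  have hK : Continuous K := (continuous_fst.comp continuous_fst).prodMk
    (hR.comp_continuous ((cM.continuous_i.comp (continuous_snd.comp continuous_fst)).prodMk
      (by fun_prop)) fun z => ⟨cM.i_mem _, by linarith [z.2.2.2], by linarith [z.2.2.1]⟩)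
  have hK0 : ∀ z, K (z, 0) = g (i z) := fun z => by
    refine Prod.ext (cS.r_i z.1).symm ?_
    simp [K, g, i, CubRetract.prod]
  have hK1 : ∀ z, K (z, 1) = z := fun z => by
    refine Prod.ext rfl ?_
    simp [K, hR0 _ (cM.i_mem _), cM.r_i]
  -- One edge of the square is the homotopy `v` over `g ∘ i`, and the two adjacent edges are `l ∘ K`
  -- and `l' ∘ K`. The map to be lifted does not depend on the coordinate along the first edge, so
  -- the opposite edge, over the identity, is a fibrewise homotopy from `l` to `l'`.
  obtain ⟨w, hw, hwu, -, hw0, hw1⟩ := (cS.prod cM).lift_square hp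
    (u := fun z => p (l (K (z.1, z.2.2)))) (by fun_prop)
    (a := fun z => v (i z.1, z.2)) (a₀ := fun z => l (K z)) (a₁ := fun z => l' (K z))
    (hv.comp_continuous (by fun_prop) fun z => ⟨him _, z.2.2⟩) (by fun_prop) (by fun_prop)
    (fun z t => by rw [hvu _ ⟨him _, t.2⟩, hK0]) (fun _ _ => rfl) (fun _ _ => (hll _).symm)
    (fun z => by
      have h2 : i z ∈ Face.support (Face.prod cS.S cM.S) := him z
      refine (hvb (Or.inr ⟨h2, by simp⟩)).trans ?_
      rw [hb1 _ ⟨h2, by simp⟩, ha0 _ ⟨h2, by simp⟩, hK0])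
    (fun z => by
      have h2 : i z ∈ Face.support (Face.prod cS.S cM.S) := him z
      refine (hvb (Or.inr ⟨h2, by simp⟩)).trans ?_
      rw [hb1 _ ⟨h2, by simp⟩, ha1 _ ⟨h2, by simp⟩, hK0])
  refine ⟨fun z => w (z.1, z.2, 1), by fun_prop, fun z t => ?_, fun z => ?_, fun z => ?_⟩
  · rw [hwu]
    simp only [hK1]
  · exact (hw0 _ _).trans (by rw [hK1])
  · exact (hw1 _ _).trans (by rw [hK1])

end CubRetract

end

/-! ### Closed manifolds are retracts of finite complexes -/

noncomputable section

/-- Near a point where `F` is an immersion, a point close to the image of `F` has at most one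
critical point for the distance among points of equal distance. -/
theorem exists_unique_critical {V W : Type*} [NormedAddCommGroup V] [NormedSpace ℝ V]
    [FiniteDimensional ℝ V] [NormedAddCommGroup W] [InnerProductSpace ℝ W] {F : V → W} {x₀ : V}
    (hF : ContDiffAt ℝ 2 F x₀) (hinj : Injective (fderiv ℝ F x₀)) :
    ∃ r > 0, ∃ U ∈ 𝓝 x₀, ∀ a ∈ U, ∀ b ∈ U, ∀ y, ‖y - F a‖ ≤ r →
      (∀ v, inner ℝ (y - F a) (fderiv ℝ F a v) = 0) → ‖y - F b‖ = ‖y - F a‖ → a = b := by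
  obtain ⟨K, t, ht, hK⟩ := (hF.fderiv_right (m := 1) (by norm_num)).exists_lipschitzOnWith
  obtain ⟨c, hc, hanti⟩ := (fderiv ℝ F x₀).toLinearMap.exists_antilipschitzWith
    (LinearMap.ker_eq_bot.2 hinj)
  have hdiff : ∀ᶠ x in 𝓝 x₀, DifferentiableAt ℝ F x := by
    filter_upwards [hF.eventually (by simp)] with x hx
    exact hx.differentiableAt (by norm_num)
  obtain ⟨ρ, hρ, hball⟩ := Metric.mem_nhds_iff.1 (Filter.inter_mem ht hdiff)
  have hx₀ : x₀ ∈ ball x₀ ρ := mem_ball_self hρ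
  set L : ℝ := K + 1 with hL
  have hL0 : 0 < L := by positivity
  have hLip : ∀ a ∈ ball x₀ ρ, ∀ b ∈ ball x₀ ρ, ‖fderiv ℝ F b - fderiv ℝ F a‖ ≤ L * ‖b - a‖ := by
    intro a ha b hb
    have := hK.dist_le_mul b (hball hb).1 a (hball ha).1
    rw [dist_eq_norm, dist_eq_norm] at this
    nlinarith [norm_nonneg (b - a)]
  have hc' : (0 : ℝ) < c := hc
  set k : ℝ := (c : ℝ)⁻¹ with hk
  have hk0 : 0 < k := by positivity
  have hlow : ∀ v, k * ‖v‖ ≤ ‖fderiv ℝ F x₀ v‖ := by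
    intro v
    have := hanti.le_mul_dist v 0
    rw [dist_zero_right, map_zero, dist_zero_right] at this
    rw [hk, inv_mul_le_iff₀ hc']
    exact this
  -- On the ball of radius `ε` the derivative differs from that at the centre, where `k` is a lower
  -- bound, by at most `k / 8`. This leaves room for the estimate `hFab` with constant `k / 2`.
  set ε := min ρ (k / (8 * L)) with hε
  have hε0 : 0 < ε := by positivity
  have hεk : L * ε ≤ k / 8 := by
    calc L * ε ≤ L * (k / (8 * L)) := by gcongr; exact min_le_right _ _
      _ = k / 8 := by field_simp
  -- With this radius `r`, equidistance and criticality give `‖F b - F a‖² ≤ 2 r L ‖b - a‖²`, which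
  -- is `k² / 8 · ‖b - a‖²`. The lower bound is `k² / 4 · ‖b - a‖²`, so `a = b`.
  refine ⟨k ^ 2 / (16 * L), by positivity, ball x₀ ε, ball_mem_nhds _ hε0, ?_⟩
  intro a ha b hb y hy hcrit hyb
  have hsub : ball x₀ ε ⊆ ball x₀ ρ := ball_subset_ball (min_le_left _ _)
  have hseg : segment ℝ a b ⊆ ball x₀ ρ := (convex_ball _ _).segment_subset (hsub ha) (hsub hb)
  -- Taylor estimate
  have hT : ‖F b - F a - fderiv ℝ F a (b - a)‖ ≤ L * ‖b - a‖ * ‖b - a‖ := by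
    refine (convex_segment a b).norm_image_sub_le_of_norm_hasFDerivWithin_le'
      (f' := fderiv ℝ F) (fun x hx => ((hball (hseg hx)).2).hasFDerivAt.hasFDerivWithinAt)
      (fun x hx => ?_) (left_mem_segment ℝ a b) (right_mem_segment ℝ a b)
    refine (hLip a (hsub ha) x (hseg hx)).trans ?_
    have h1 : ‖x - a‖ ≤ ‖b - a‖ := by
      obtain ⟨θ, hθ, rfl⟩ := (segment_eq_image' ℝ a b).subset hx
      rw [add_sub_cancel_left, norm_smul, Real.norm_eq_abs, abs_of_nonneg hθ.1]
      exact mul_le_of_le_one_left (norm_nonneg _) hθ.2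
    gcongr
  have hab : ‖b - a‖ ≤ 2 * ε := by
    have h1 := mem_ball_iff_norm.1 ha
    have h2 := mem_ball_iff_norm.1 hb
    have h3 := norm_sub_le (b - x₀) (a - x₀)
    rw [sub_sub_sub_cancel_right] at h3
    linarith
  have hFa : k * ‖b - a‖ ≤ ‖fderiv ℝ F a (b - a)‖ + k / 8 * ‖b - a‖ := by
    have h1 := hlow (b - a)
    have h2 := (fderiv ℝ F a - fderiv ℝ F x₀).le_opNorm (b - a)
    have h3 := hLip x₀ hx₀ a (hsub ha)
    have h4 := (mem_ball_iff_norm.1 ha).le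
    have h5 : ‖fderiv ℝ F x₀ (b - a)‖ ≤ ‖fderiv ℝ F a (b - a)‖ +
        ‖(fderiv ℝ F a - fderiv ℝ F x₀) (b - a)‖ := by
      rw [sub_apply]
      exact norm_le_norm_add_norm_sub _ _
    have h6 : ‖fderiv ℝ F a - fderiv ℝ F x₀‖ ≤ k / 8 :=
      h3.trans ((mul_le_mul_of_nonneg_left h4 hL0.le).trans hεk)
    have h7 := mul_le_mul_of_nonneg_right h6 (norm_nonneg (b - a))
    linarith
  have hFab : k / 2 * ‖b - a‖ ≤ ‖F b - F a‖ := by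
    have h1 := norm_le_norm_add_norm_sub (F b - F a) (fderiv ℝ F a (b - a))
    have h2 : L * ‖b - a‖ * ‖b - a‖ ≤ k / 4 * ‖b - a‖ := by
      gcongr
      calc L * ‖b - a‖ ≤ L * (2 * ε) := by gcongr
        _ ≤ k / 4 := by linarith
    have h3 := mul_nonneg hk0.le (norm_nonneg (b - a))
    linarith
  -- Expansion of `‖y - F b‖ = ‖y - F a‖`. In the inner product, criticality then removes the linear
  -- part of `F b - F a` and leaves the quadratic Taylor remainder.
  have hinner : ‖F b - F a‖ ^ 2 = 2 * inner ℝ (y - F a) (F b - F a) := by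
    have h1 : y - F b = (y - F a) - (F b - F a) := by abel
    have h2 := norm_sub_sq_real (y - F a) (F b - F a)
    rw [← h1, hyb] at h2
    linarith
  have hbound : inner ℝ (y - F a) (F b - F a) ≤ k ^ 2 / (16 * L) * (L * ‖b - a‖ * ‖b - a‖) := by
    have h1 : inner ℝ (y - F a) (F b - F a) =
        inner ℝ (y - F a) (F b - F a - fderiv ℝ F a (b - a)) := by
      rw [inner_sub_right (y - F a) (F b - F a), hcrit, sub_zero]
    rw [h1]
    refine (real_inner_le_norm _ _).trans ?_
    gcongr
  have h8 : k ^ 2 / (16 * L) * (L * ‖b - a‖ * ‖b - a‖) = k ^ 2 / 16 * ‖b - a‖ ^ 2 := by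
    field_simp
  rw [h8] at hbound
  have h9 : (k / 2 * ‖b - a‖) ^ 2 ≤ ‖F b - F a‖ ^ 2 := by gcongr
  have h10 : k ^ 2 * ‖b - a‖ ^ 2 ≤ 0 := by nlinarith
  have h11 : ‖b - a‖ = 0 := by
    have : 0 < k ^ 2 := by positivity
    have h12 : ‖b - a‖ ^ 2 ≤ 0 := by
      by_contra hcon
      push Not at hcon
      nlinarith [mul_pos this hcon]
    exact pow_eq_zero_iff (two_ne_zero) |>.1 (le_antisymm h12 (by positivity))
  exact (sub_eq_zero.1 (norm_eq_zero.1 h11)).symm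

/-! ### Nearest-point retraction onto an embedded compact manifold. -/

section Nearest

variable {V H M W : Type*} [NormedAddCommGroup V] [NormedSpace ℝ V] [FiniteDimensional ℝ V]
  [TopologicalSpace H] {J : ModelWithCorners ℝ V H} [J.Boundaryless] [TopologicalSpace M]
  [ChartedSpace H M] [IsManifold J ∞ M] [NormedAddCommGroup W] [InnerProductSpace ℝ W] {f : M → W}

/-- `f a` is a point of `f(M)` nearest to `y`. -/
def IsNearest (f : M → W) (y : W) (a : M) : Prop := ∀ b, ‖y - f a‖ ≤ ‖y - f b‖

/-- A nearest point minimises the squared distance, so in a chart it is critical, and two nearest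
points have equal distance to `y`: the hypotheses of `exists_unique_critical`. -/
theorem exists_unique_nearest_local (hf : ContMDiff J 𝓘(ℝ, W) ∞ f) (p : M)
    (hinj : Injective (mfderiv J 𝓘(ℝ, W) f p)) :
    ∃ r > 0, ∃ U ∈ 𝓝 p, ∀ a ∈ U, ∀ b ∈ U, ∀ y, ‖y - f a‖ ≤ r →
      IsNearest f y a → IsNearest f y b → a = b := by
  set χ := extChartAt J p with hχ
  set F : V → W := f ∘ χ.symm with hFdef
  have hFs : ContDiffOn ℝ ∞ F χ.target := by
    have h1 : ContMDiffOn 𝓘(ℝ, V) 𝓘(ℝ, W) ∞ F χ.target :=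
      hf.comp_contMDiffOn (contMDiffOn_extChartAt_symm p)
    exact contMDiffOn_iff_contDiffOn.1 h1
  have htop : IsOpen χ.target := isOpen_extChartAt_target p
  have hx₀ : χ p ∈ χ.target := mem_extChartAt_target p
  have hFx : ∀ x ∈ χ.target, ContDiffAt ℝ ∞ F x := fun x hx => hFs.contDiffAt (htop.mem_nhds hx)
  have hinj' : Injective (fderiv ℝ F (χ p)) := by
    have h1 : mfderiv J 𝓘(ℝ, W) f p = fderiv ℝ F (χ p) := by
      rw [(hf.mdifferentiableAt (by simp)).mfderiv]
      rw [J.range_eq_univ, fderivWithin_univ]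
      rfl
    intro v w hvw
    exact hinj ((congrArg (fun A => A v) h1).trans
      (hvw.trans (congrArg (fun A => A w) h1).symm))
  obtain ⟨r, hr, U, hU, h⟩ := exists_unique_critical ((hFx _ hx₀).of_le (by norm_cast)) hinj'
  refine ⟨r, hr, χ.source ∩ χ ⁻¹' U, Filter.inter_mem (extChartAt_source_mem_nhds p)
    ((continuousAt_extChartAt p).preimage_mem_nhds hU), ?_⟩
  rintro a ⟨ha, haU⟩ b ⟨hb, hbU⟩ y hy hya hyb
  have hFa : F (χ a) = f a := congrArg f (χ.left_inv ha)
  have hFb : F (χ b) = f b := congrArg f (χ.left_inv hb)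
  refine χ.injOn ha hb (h _ haU _ hbU y (by rwa [hFa]) (fun v => ?_) ?_)
  · have hta : χ a ∈ χ.target := χ.map_source ha
    have hd := ((hFx _ hta).differentiableAt (by simp)).hasFDerivAt
    have h1 : HasFDerivAt (fun x => ‖y - F x‖ ^ 2) _ (χ a) := (hd.const_sub y).norm_sq
    have hmin : IsLocalMin (fun x => ‖y - F x‖ ^ 2) (χ a) := by
      refine Filter.Eventually.of_forall fun x => ?_
      have := hya (χ.symm x)
      rw [← hFa] at this
      change ‖y - F (χ a)‖ ^ 2 ≤ ‖y - F x‖ ^ 2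
      gcongr
      exact this
    have h2 := congrArg (fun A => A v) (hmin.hasFDerivAt_eq_zero h1)
    have h3 : inner ℝ (F (χ a)) (fderiv ℝ F (χ a) v) - inner ℝ y (fderiv ℝ F (χ a) v) = 0 := by
      simpa using h2
    rw [inner_sub_left]
    linarith
  · rw [hFa, hFb]
    exact le_antisymm (hyb a) (hya b)

/-- Compactness of `M × M`. Near the diagonal the local statement applies. Near a pair with `f p ≠ f
p'`, a point within a quarter of their distance of one image cannot be that close to the other, so
both points cannot be nearest to it. -/
theorem exists_unique_nearest [CompactSpace M] (hf : ContMDiff J 𝓘(ℝ, W) ∞ f)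
    (hfi : Injective f) (hinj : ∀ p, Injective (mfderiv J 𝓘(ℝ, W) f p)) :
    ∃ r > 0, ∀ a b y, ‖y - f a‖ ≤ r → IsNearest f y a → IsNearest f y b → a = b := by
  have key : ∃ r > 0, ∀ z ∈ (Set.univ : Set (M × M)), ∀ y, ‖y - f z.1‖ ≤ r →
      IsNearest f y z.1 → IsNearest f y z.2 → z.1 = z.2 := by
    refine isCompact_univ.induction_on (p := fun s : Set (M × M) => ∃ r > 0, ∀ z ∈ s, ∀ y, ‖y - f z.1‖ ≤ r →
      IsNearest f y z.1 → IsNearest f y z.2 → z.1 = z.2) ⟨1, one_pos, by simp⟩ ?_ ?_ ?_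
    · rintro s t hst ⟨r, hr, h⟩
      exact ⟨r, hr, fun z hz => h z (hst hz)⟩
    · rintro s t ⟨r, hr, h⟩ ⟨r', hr', h'⟩
      refine ⟨min r r', lt_min hr hr', ?_⟩
      rintro z (hz | hz) y hy
      · exact h z hz y (hy.trans (min_le_left _ _))
      · exact h' z hz y (hy.trans (min_le_right _ _))
    · rintro ⟨p, p'⟩ -
      by_cases hp : p = p'
      · subst hp
        obtain ⟨r, hr, U, hU, h⟩ := exists_unique_nearest_local hf p (hinj p)
        exact ⟨U ×ˢ U, mem_nhdsWithin_of_mem_nhds (prod_mem_nhds hU hU), r, hr,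
          fun z hz y => h z.1 hz.1 z.2 hz.2 y⟩
      · have hd : 0 < ‖f p - f p'‖ := norm_sub_pos_iff.2 (hfi.ne hp)
        have hc : Continuous fun z : M × M => ‖f z.1 - f z.2‖ :=
          ((hf.continuous.comp continuous_fst).sub (hf.continuous.comp continuous_snd)).norm
        refine ⟨{z | ‖f p - f p'‖ / 2 < ‖f z.1 - f z.2‖}, mem_nhdsWithin_of_mem_nhds
          ((isOpen_lt continuous_const hc).mem_nhds (half_lt_self hd)), ‖f p - f p'‖ / 4,
          by positivity, ?_⟩
        intro z hz y hy h1 h2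
        have h3 := (h2 z.1).trans hy
        have h4 := norm_sub_le (y - f z.2) (y - f z.1)
        rw [sub_sub_sub_cancel_left] at h4
        have h5 : ‖f p - f p'‖ / 2 < ‖f z.1 - f z.2‖ := hz
        linarith
  obtain ⟨r, hr, h⟩ := key
  exact ⟨r, hr, fun a b => h (a, b) trivial⟩

/-- A neighbourhood of an embedded compact manifold retracts to it. -/
theorem exists_retraction [CompactSpace M] [T2Space M] [Nonempty M]
    (hf : ContMDiff J 𝓘(ℝ, W) ∞ f)
    (hfi : Injective f) (hinj : ∀ p, Injective (mfderiv J 𝓘(ℝ, W) f p)) :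
    ∃ r > 0, ∃ R : W → M, (∀ x, R (f x) = x) ∧ ContinuousOn R {y | ∃ x, ‖y - f x‖ ≤ r} := by
  obtain ⟨r, hr, h⟩ := exists_unique_nearest hf hfi hinj
  have hex : ∀ y, ∃ a, IsNearest f y a := fun y => by
    obtain ⟨a, -, ha⟩ := isCompact_univ.exists_isMinOn (f := fun a => ‖y - f a‖)
      Set.univ_nonempty (continuous_const.sub hf.continuous).norm.continuousOn
    exact ⟨a, fun b => ha (Set.mem_univ b)⟩
  choose R hR using hex
  refine ⟨r, hr, R, fun x => ?_, ?_⟩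
  · have h1 := hR (f x) x
    rw [sub_self, norm_zero] at h1
    exact hfi (sub_eq_zero.1 (norm_le_zero_iff.1 h1)).symm
  · rw [continuousOn_iff_isClosed]
    intro C hC
    -- The relation of being nearest is closed and `M` is compact, so the points with a nearest
    -- point in `C` form a closed set. By uniqueness, within distance `r` this set is the preimage
    -- of `C` under `R`.
    refine ⟨Prod.fst '' {z : W × M | IsNearest f z.1 z.2 ∧ z.2 ∈ C}, ?_, ?_⟩
    · refine isClosedMap_fst_of_compactSpace _ ?_
      refine IsClosed.inter ?_ (hC.preimage continuous_snd)
      have h1 : {z : W × M | IsNearest f z.1 z.2} =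
          ⋂ b, {z : W × M | ‖z.1 - f z.2‖ ≤ ‖z.1 - f b‖} := by
        ext z
        simp [IsNearest]
      change IsClosed {z : W × M | IsNearest f z.1 z.2}
      rw [h1]
      have := hf.continuous
      exact isClosed_iInter fun b => isClosed_le (by fun_prop) (by fun_prop)
    · ext y
      constructor
      · rintro ⟨hy, x, hx⟩
        exact ⟨⟨(y, R y), ⟨hR y, hy⟩, rfl⟩, x, hx⟩
      · rintro ⟨⟨⟨y', a⟩, ⟨ha, haC⟩, rfl⟩, x, hx⟩
        refine ⟨?_, x, hx⟩
        have h1 : R y' = a := h _ _ y' ((hR y' x).trans hx) (hR y') ha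
        change R y' ∈ C
        rwa [h1]

end Nearest

/-- Closed manifolds are retracts of finite complexes. -/
theorem Mfd.nonempty_cubRetract {d : ℕ} (X : Mfd d) [CompactSpace X.carrier]
    [Nonempty X.carrier] : Nonempty (CubRetract X.carrier) := by
  obtain ⟨N, f, hf, hfe, hfi⟩ := exists_embedding_euclidean_of_compact (I := X.model) (M := X.carrier)
  obtain ⟨r, hr, R, hRf, hR⟩ := exists_retraction hf hfe.injective hfi
  let T := (PiLp.continuousLinearEquiv 2 ℝ (fun _ : Fin N => ℝ)).symm
  let K := ‖(T : (Fin N → ℝ) →L[ℝ] EuclideanSpace ℝ (Fin N))‖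
  -- The manifold is enlarged by `c` until unit cubes are small compared to its tubular
  -- neighbourhood: scaled back, a vector of supremum norm at most `1` has Euclidean norm at most `K
  -- / c < r`.
  let c : ℝ := (K + 1) / r
  have hc : 0 < c := by positivity
  let i : X.carrier → Fin N → ℝ := fun x => c • T.symm (f x)
  have hi : Continuous i := (T.symm.continuous.comp hf.continuous).const_smul c
  have hR' : ContinuousOn (fun z : Fin N → ℝ => R (c⁻¹ • T z))
      (Face.support (Face.hull (Set.range i))) := by
    refine hR.comp (T.continuous.const_smul c⁻¹).continuousOn fun z hz => ?_
    obtain ⟨_, ⟨x, rfl⟩, hx⟩ := Face.exists_near_of_mem_support_hull hz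
    refine ⟨x, ?_⟩
    have h1 : c⁻¹ • T z - f x = c⁻¹ • T (z - i x) := by
      simp only [i, map_sub, map_smul, ContinuousLinearEquiv.apply_symm_apply, smul_sub, smul_smul,
        inv_mul_cancel₀ hc.ne', one_smul]
    have h2 : ‖T (z - i x)‖ ≤ K * ‖z - i x‖ :=
      (T : (Fin N → ℝ) →L[ℝ] EuclideanSpace ℝ (Fin N)).le_opNorm _
    have hK : 0 ≤ K := norm_nonneg _
    rw [h1, norm_smul, norm_inv, Real.norm_eq_abs, abs_of_pos hc, inv_mul_le_iff₀ hc]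
    have h3 : c * r = K + 1 := by simp only [c]; field_simp
    rw [h3]
    nlinarith
  obtain ⟨B, hB⟩ := (isCompact_range hi).isBounded.exists_norm_le
  exact ⟨{
    ι := Fin N
    S := Face.hull (Set.range i)
    finite := Face.finite_hull (R := ⌈B⌉) fun x hx j =>
      ((norm_le_pi_norm x j).trans (hB x hx)).trans (Int.le_ceil B)
    isComplex := Face.isComplex_hull _
    i := i
    r := fun z => R (c⁻¹ • T z)
    continuous_i := hi
    continuousOn_r := hR'
    i_mem := fun x => Face.subset_support_hull _ ⟨x, rfl⟩
    r_i := fun x => by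
      simp only [i, map_smul, ContinuousLinearEquiv.apply_symm_apply, smul_smul,
        inv_mul_cancel₀ hc.ne', one_smul, hRf] }⟩

end

/-! ### Deformations of injective linear maps to `ℝ^ℕ` -/

noncomputable section

/-- The linear map of `ℝ^ℕ` that spreads a sequence over the even coordinates. -/
def spreadEven : (ℕ → ℝ) →ₗ[ℝ] (ℕ → ℝ) := interleave.toLinearMap ∘ₗ LinearMap.inl ℝ _ _

/-- The linear map of `ℝ^ℕ` that spreads a sequence over the odd coordinates. -/
def spreadOdd : (ℕ → ℝ) →ₗ[ℝ] (ℕ → ℝ) := interleave.toLinearMap ∘ₗ LinearMap.inr ℝ _ _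

theorem interleave_even (p : (ℕ → ℝ) × (ℕ → ℝ)) (j : ℕ) : interleave p (2 * j) = p.1 j := by
  change Sum.elim p.1 p.2 (Equiv.natSumNatEquivNat.symm (2 * j)) = _
  have h : Equiv.natSumNatEquivNat.symm (2 * j) = Sum.inl j := by
    rw [Equiv.symm_apply_eq]; simp
  rw [h]; rfl

theorem interleave_odd (p : (ℕ → ℝ) × (ℕ → ℝ)) (j : ℕ) : interleave p (2 * j + 1) = p.2 j := by
  change Sum.elim p.1 p.2 (Equiv.natSumNatEquivNat.symm (2 * j + 1)) = _
  have h : Equiv.natSumNatEquivNat.symm (2 * j + 1) = Sum.inr j := by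
    rw [Equiv.symm_apply_eq]; simp
  rw [h]; rfl

theorem spreadEven_even (x : ℕ → ℝ) (j : ℕ) : spreadEven x (2 * j) = x j := interleave_even _ _
theorem spreadEven_odd (x : ℕ → ℝ) (j : ℕ) : spreadEven x (2 * j + 1) = 0 := interleave_odd _ _
theorem spreadOdd_even (x : ℕ → ℝ) (j : ℕ) : spreadOdd x (2 * j) = 0 := interleave_even _ _
theorem spreadOdd_odd (x : ℕ → ℝ) (j : ℕ) : spreadOdd x (2 * j + 1) = x j := interleave_odd _ _

theorem continuous_spreadEven : Continuous spreadEven :=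
  continuous_interleave.comp (continuous_id.prodMk continuous_const)

theorem continuous_spreadOdd : Continuous spreadOdd :=
  continuous_interleave.comp (continuous_const.prodMk continuous_id)

/-- Comparing coordinates, `x_{2j}` is determined by `x_j`, and `j < 2j` unless `j = 0`. The index
`0` is fixed by doubling and gives `(a + b) x₀ = 0`, which is why a positive sum is assumed. -/
theorem eq_zero_of_spreadEven {a b : ℝ} (ha : 0 ≤ a) (hb : 0 ≤ b) (hab : 0 < a + b) {x : ℕ → ℝ}
    (h : a • x + b • spreadEven x = 0) : x = 0 := by
  have he : ∀ j, a * x (2 * j) + b * x j = 0 := fun j => by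
    simpa [spreadEven_even] using congrFun h (2 * j)
  have ho : ∀ j, a * x (2 * j + 1) = 0 := fun j => by
    simpa [spreadEven_odd] using congrFun h (2 * j + 1)
  funext k
  rcases ha.eq_or_lt with ha | ha
  · have hb : b ≠ 0 := by rintro rfl; simp [← ha] at hab
    have := he k
    rw [← ha, zero_mul, zero_add] at this
    exact (mul_eq_zero.1 this).resolve_left hb
  · induction k using Nat.strong_induction_on with
    | _ k ih =>
      obtain ⟨j, rfl | rfl⟩ := Nat.even_or_odd' k
      · rcases Nat.eq_zero_or_pos j with rfl | hj
        · have := he 0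
          rw [mul_zero, ← add_mul] at this
          exact (mul_eq_zero.1 this).resolve_left hab.ne'
        · have h1 := he j
          rw [show x j = 0 from ih j (by omega), mul_zero, add_zero] at h1
          exact (mul_eq_zero.1 h1).resolve_left ha.ne'
      · exact (mul_eq_zero.1 (ho j)).resolve_left ha.ne'

/-- Now `x_{2j+1}` is determined by `x_j`. No index is fixed by `j ↦ 2j + 1`, so no condition on
signs is needed. -/
theorem eq_zero_of_spreadOdd {a b : ℝ} (hab : a ≠ 0 ∨ b ≠ 0) {x : ℕ → ℝ}
    (h : a • x + b • spreadOdd x = 0) : x = 0 := by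
  have he : ∀ j, a * x (2 * j) = 0 := fun j => by
    simpa [spreadOdd_even] using congrFun h (2 * j)
  have ho : ∀ j, a * x (2 * j + 1) + b * x j = 0 := fun j => by
    simpa [spreadOdd_odd] using congrFun h (2 * j + 1)
  funext k
  by_cases ha : a = 0
  · have := ho k
    rw [ha, zero_mul, zero_add] at this
    exact (mul_eq_zero.1 this).resolve_left (hab.resolve_left (by simpa using ha))
  · induction k using Nat.strong_induction_on with
    | _ k ih =>
      obtain ⟨j, rfl | rfl⟩ := Nat.even_or_odd' k
      · exact (mul_eq_zero.1 (he j)).resolve_left ha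
      · have h1 := ho j
        rw [show x j = 0 from ih j (by omega), mul_zero, add_zero] at h1
        exact (mul_eq_zero.1 h1).resolve_left ha

/-! ### Paths of injective linear maps to `ℝ^ℕ`. -/

section Blend

variable {V : Type*} [AddCommGroup V] [Module ℝ V]

/-- A path of linear maps from `g` to `γ`, through the even coordinates of `g` and the odd
coordinates of `γ`. -/
def blend (r : ℝ) (g γ : V →ₗ[ℝ] (ℕ → ℝ)) : V →ₗ[ℝ] (ℕ → ℝ) :=
  (max (1 - 3 * r) 0 • g + max (min (3 * r) (2 - 3 * r)) 0 • (spreadEven ∘ₗ g)) +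
    (max (min (3 * r - 1) (3 - 3 * r)) 0 • (spreadOdd ∘ₗ γ) + max (3 * r - 2) 0 • γ)

theorem blend_zero (g γ : V →ₗ[ℝ] (ℕ → ℝ)) : blend 0 g γ = g := by
  norm_num [blend]

theorem blend_one (g γ : V →ₗ[ℝ] (ℕ → ℝ)) : blend 1 g γ = γ := by
  norm_num [blend]

/-- The three thirds of the path are linear: from `g` to its even spread, from there to the odd
spread of `γ`, and from there to `γ`. On the outer thirds the lemmas above apply; between them the
even coordinates still show a positive multiple of `g`. -/
theorem blend_injective (r : ℝ) {g γ : V →ₗ[ℝ] (ℕ → ℝ)} (hg : Injective g) (hγ : Injective γ) :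
    Injective (blend r g γ) := by
  rw [← LinearMap.ker_eq_bot, LinearMap.ker_eq_bot']
  intro v hv
  change (max (1 - 3 * r) 0 • g v + max (min (3 * r) (2 - 3 * r)) 0 • spreadEven (g v)) +
    (max (min (3 * r - 1) (3 - 3 * r)) 0 • spreadOdd (γ v) + max (3 * r - 2) 0 • γ v) = 0 at hv
  rcases le_or_gt (3 * r) 1 with h1 | h1
  · have h2 : max (min (3 * r - 1) (3 - 3 * r)) 0 = 0 :=
      max_eq_right ((min_le_left _ _).trans (by linarith))
    have h3 : max (3 * r - 2) 0 = 0 := max_eq_right (by linarith)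
    rw [h2, h3, zero_smul, zero_smul, add_zero, add_zero] at hv
    refine (map_eq_zero_iff g hg).1 (eq_zero_of_spreadEven (le_max_right _ _) (le_max_right _ _)
      ?_ hv)
    rcases lt_or_ge (3 * r) 1 with h4 | h4
    · have h5 : 0 < max (1 - 3 * r) 0 := lt_max_of_lt_left (by linarith)
      have h6 := le_max_right (min (3 * r) (2 - 3 * r)) 0
      linarith
    · have h5 : 0 < max (min (3 * r) (2 - 3 * r)) 0 :=
        lt_max_of_lt_left (lt_min (by linarith) (by linarith))
      have h6 := le_max_right (1 - 3 * r) 0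
      linarith
  rcases lt_or_ge (3 * r) 2 with h4 | h4
  · have h2 : max (1 - 3 * r) 0 = 0 := max_eq_right (by linarith)
    have h3 : max (3 * r - 2) 0 = 0 := max_eq_right (by linarith)
    rw [h2, h3, zero_smul, zero_smul, add_zero, zero_add] at hv
    have hb : 0 < max (min (3 * r) (2 - 3 * r)) 0 :=
      lt_max_of_lt_left (lt_min (by linarith) (by linarith))
    have h5 : g v = 0 := by
      funext j
      have := congrFun hv (2 * j)
      simpa [spreadEven_even, spreadOdd_even, hb.ne'] using this
    exact (map_eq_zero_iff g hg).1 h5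
  · have h2 : max (1 - 3 * r) 0 = 0 := max_eq_right (by linarith)
    have h3 : max (min (3 * r) (2 - 3 * r)) 0 = 0 :=
      max_eq_right ((min_le_right _ _).trans (by linarith))
    rw [h2, h3, zero_smul, zero_smul, zero_add, zero_add, add_comm] at hv
    refine (map_eq_zero_iff γ hγ).1 (eq_zero_of_spreadOdd ?_ hv)
    rcases h4.eq_or_lt with h5 | h5
    · exact Or.inr (lt_max_of_lt_left (lt_min (by linarith) (by linarith))).ne'
    · exact Or.inl (lt_max_of_lt_left (by linarith)).ne'

theorem continuous_blend {Z : Type*} [TopologicalSpace Z] {r : Z → ℝ} (hr : Continuous r)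
    {V : Z → Type*} [∀ z, AddCommGroup (V z)] [∀ z, Module ℝ (V z)]
    {g γ : ∀ z, V z →ₗ[ℝ] (ℕ → ℝ)} {v : ∀ z, V z}
    (hg : Continuous fun z => g z (v z)) (hγ : Continuous fun z => γ z (v z)) :
    Continuous fun z => blend (r z) (g z) (γ z) (v z) := by
  have h1 := continuous_spreadEven
  have h2 := continuous_spreadOdd
  change Continuous fun z => (max (1 - 3 * r z) 0 • g z (v z) +
    max (min (3 * r z) (2 - 3 * r z)) 0 • spreadEven (g z (v z))) +
    (max (min (3 * r z - 1) (3 - 3 * r z)) 0 • spreadOdd (γ z (v z)) +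
      max (3 * r z - 2) 0 • γ z (v z))
  fun_prop

end Blend

/-! ### Contractibility of the space of frames. -/

namespace Frame

variable {m : ℕ}

theorem continuous_iff {Z : Type*} [TopologicalSpace Z] {F : Z → Frame m} :
    Continuous F ↔ ∀ x, Continuous fun z => (F z).1 x := by
  rw [continuous_induced_rng, continuous_pi_iff]
  rfl

instance : ContractibleSpace (Frame m) := by
  rw [contractible_iff_id_nullhomotopic]
  refine ⟨std m, ⟨⟨⟨fun z => ⟨blend z.1 z.2.1 (std m).1, blend_injective _ z.2.2 (std m).2⟩,
    continuous_iff.2 fun x => ?_⟩, fun L => ?_, fun L => ?_⟩⟩⟩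
  · exact continuous_blend (V := fun _ => Fin m → ℝ) (by fun_prop)
      ((continuous_apply x).comp continuous_snd) continuous_const
  · exact Subtype.ext (blend_zero _ _)
  · exact Subtype.ext (blend_one _ _)

theorem continuous_stab : Continuous (stab (m := m)) := by
  refine continuous_iff.2 fun x => continuous_pi fun k => ?_
  cases k with
  | zero => exact continuous_const
  | succ k => exact (_root_.continuous_apply k).comp (continuous_apply (m := m) _)

end Frame

end

/-! ### Contractions of charts of `BSO` -/

noncomputable section

open scoped unitInterval

namespace Frame

theorem exists_leftInverse {m : ℕ} (L : Frame m) :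
    ∃ P : (ℕ → ℝ) →L[ℝ] (Fin m → ℝ), ∀ x, P (L.1 x) = x := by
  have h := (SeparatingDual.dualMap_surjective_iff (R := ℝ) (f := L.1)).2 L.2
  choose f hf using fun j : Fin m => h (LinearMap.proj j)
  exact ⟨ContinuousLinearMap.pi f, fun x => funext fun j => congrArg (fun A => A x) (hf j)⟩

/-- The standard `k`-frame together with its left inverse etc.: a frame and a projection. -/
def stabProj {m : ℕ} (P : (ℕ → ℝ) →L[ℝ] (Fin m → ℝ)) : (ℕ → ℝ) →L[ℝ] (Fin (m + 1) → ℝ) :=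
  (LinearMap.toContinuousLinearMap ((splitFin (rfl : m + 1 = m + 1)).symm.toLinearMap)).comp
    ((P.comp (ContinuousLinearMap.pi fun j => ContinuousLinearMap.proj (j + 1))).prod
      (ContinuousLinearMap.pi fun _ => ContinuousLinearMap.proj 0))

/-- `L ⊕ id_ℝ` for a linear map `L`. -/
def stabLin {m : ℕ} (L : (Fin m → ℝ) →ₗ[ℝ] (ℕ → ℝ)) : (Fin (m + 1) → ℝ) →ₗ[ℝ] (ℕ → ℝ) :=
  shift ∘ₗ (L.prodMap (LinearEquiv.funUnique (Fin 1) ℝ ℝ).toLinearMap) ∘ₗ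
      (splitFin rfl).toLinearMap

theorem stabProj_stabLin {m : ℕ} (P : (ℕ → ℝ) →L[ℝ] (Fin m → ℝ))
    (L : (Fin m → ℝ) →ₗ[ℝ] (ℕ → ℝ)) (x : Fin (m + 1) → ℝ) :
    stabProj P (stabLin L x) =
      (splitFin rfl).symm (P (L (splitFin rfl x).1), (splitFin rfl x).2) := by
  change (splitFin rfl).symm (P (L (splitFin rfl x).1), fun _ => (splitFin rfl x).2 default) = _
  refine congrArg (splitFin rfl).symm (Prod.ext rfl (funext fun j => ?_))
  rw [Subsingleton.elim default j]

/-- The stabilised composite is `(P ∘ L) ⊕ id`. Positivity of the determinant is thus a condition on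
points of `BSO`. -/
theorem det_stabProj_stabLin {m : ℕ} (P : (ℕ → ℝ) →L[ℝ] (Fin m → ℝ))
    (L : (Fin m → ℝ) →ₗ[ℝ] (ℕ → ℝ)) :
    LinearMap.det ((stabProj P).toLinearMap ∘ₗ stabLin L) =
      LinearMap.det (P.toLinearMap ∘ₗ L) := by
  have h1 := LinearMap.det_conj ((P.toLinearMap ∘ₗ L).prodMap (LinearMap.id (M := Fin 1 → ℝ)))
    (splitFin (rfl : m + 1 = m + 1)).symm
  rw [LinearMap.det_prodMap, LinearMap.det_id, mul_one] at h1
  rw [← h1]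
  congr 1
  refine LinearMap.ext fun x => ?_
  exact stabProj_stabLin P L x

theorem stabLin_comp {m : ℕ} (L : (Fin m → ℝ) →ₗ[ℝ] (ℕ → ℝ)) (A : (Fin m → ℝ) →ₗ[ℝ] (Fin m → ℝ)) :
    stabLin (L ∘ₗ A) = stabLin L ∘ₗ (splitFin rfl).symm.toLinearMap ∘ₗ
      (A.prodMap LinearMap.id) ∘ₗ (splitFin rfl).toLinearMap := by
  refine LinearMap.ext fun x => ?_
  simp [stabLin]

/-- The linear deformation commutes with stabilisation because the weights `1 - t` and `t` add up to
`1` in the new coordinate. -/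
theorem stabLin_combine {m : ℕ} (P : (ℕ → ℝ) →L[ℝ] (Fin m → ℝ))
    (L L' : (Fin m → ℝ) →ₗ[ℝ] (ℕ → ℝ)) (t : ℝ) (x : Fin (m + 1) → ℝ) :
    (1 - t) • stabLin L' (stabProj P (stabLin L x)) + t • stabLin L x =
      stabLin ((1 - t) • (L' ∘ₗ P.toLinearMap ∘ₗ L) + t • L) x := by
  rw [stabProj_stabLin]
  simp only [stabLin, LinearMap.comp_apply, LinearEquiv.coe_coe, LinearEquiv.apply_symm_apply,
    LinearMap.prodMap_apply]
  rw [← map_smul, ← map_smul, ← map_add]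
  refine congrArg _ (Prod.ext rfl ?_)
  change (1 - t) • _ + t • _ = _
  rw [← add_smul, sub_add_cancel, one_smul]

end Frame

namespace BSO

/-- Frames of all ranks. -/
abbrev Frames : Type := Σ m, Frame m

/-- Stabilisation. -/
def stabS (z : Frames) : Frames := ⟨z.1 + 1, z.2.stab⟩

/-- The quotient map to `BSO`. -/
def proj : Frames → BSO := Quot.mk Rel

theorem isQuotientMap_proj : IsQuotientMap proj := isQuotientMap_quot_mk

/-- The stable oriented subspace spanned by a frame. -/
def ofFrame {m : ℕ} (L : Frame m) : BSO := of (BSOm.mk L)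

theorem continuous_ofFrame {m : ℕ} : Continuous (ofFrame (m := m)) :=
  continuous_quot_mk.comp (continuous_sigmaMk : Continuous (Sigma.mk m : Frame m → Frames))

theorem continuous_of {m : ℕ} : Continuous (of (m := m)) :=
  (BSOm.isOpenQuotientMap_mk m).isQuotientMap.continuous_iff.2 continuous_ofFrame

theorem ofFrame_comp {m : ℕ} (L : Frame m) (A : (Fin m → ℝ) ≃ₗ[ℝ] (Fin m → ℝ))
    (hA : 0 < LinearMap.det A.toLinearMap) : ofFrame (L.comp A) = ofFrame L :=
  (Quot.sound (Rel.basis L A hA)).symm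

theorem ofFrame_stab {m : ℕ} (L : Frame m) : ofFrame L.stab = ofFrame L :=
  (Quot.sound (Rel.stab L)).symm

theorem exists_ofFrame (x : BSO) : ∃ (m : ℕ) (L : Frame m), ofFrame L = x := by
  obtain ⟨⟨m, L⟩, rfl⟩ := Quot.exists_rep x
  exact ⟨m, L, rfl⟩

/-- Frames that differ by a change of basis of positive determinant. -/
def SameSpan (z z' : Frames) : Prop :=
  ∃ (m : ℕ) (L : Frame m) (A : (Fin m → ℝ) ≃ₗ[ℝ] (Fin m → ℝ)), 0 < LinearMap.det A.toLinearMap ∧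
    z = ⟨m, L⟩ ∧ z' = ⟨m, L.comp A⟩

theorem SameSpan.stabS {z z' : Frames} (h : SameSpan z z') : SameSpan (stabS z) (stabS z') := by
  obtain ⟨m, L, A, hA, rfl, rfl⟩ := h
  refine ⟨m + 1, L.stab, (splitFin rfl).trans ((A.prodCongr (LinearEquiv.refl ℝ _)).trans
    (splitFin rfl).symm), ?_, rfl, ?_⟩
  · have h1 := LinearMap.det_conj (A.toLinearMap.prodMap LinearMap.id)
      (splitFin (rfl : m + 1 = m + 1)).symm
    refine lt_of_lt_of_eq ?_ h1.symm
    rw [LinearMap.det_prodMap]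
    simpa using hA
  · refine congrArg (Sigma.mk (m + 1)) (Subtype.ext ?_)
    exact Frame.stabLin_comp L.1 A.toLinearMap

theorem SameSpan.iterate {z z' : Frames} (h : SameSpan z z') (j : ℕ) :
    SameSpan (BSO.stabS^[j] z) (BSO.stabS^[j] z') := by
  induction j with
  | zero => exact h
  | succ j ih =>
    rw [iterate_succ_apply', iterate_succ_apply']
    exact ih.stabS

theorem ofFrame_iterate (j : ℕ) (z : Frames) : ofFrame (stabS^[j] z).2 = ofFrame z.2 := by
  induction j with
  | zero => rfl
  | succ j ih =>
    rw [iterate_succ_apply', ← ih]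
    exact ofFrame_stab _

theorem le_iterate (j : ℕ) (z : Frames) : j ≤ (stabS^[j] z).1 := by
  induction j with
  | zero => exact Nat.zero_le _
  | succ j ih =>
    rw [iterate_succ_apply']
    exact Nat.succ_le_succ ih

theorem exists_iterate (j k : ℕ) : ∃ (K : ℕ) (g : Frame k → Frame K), j ≤ K ∧ Continuous g ∧
    ∀ L : Frame k, stabS^[j] ⟨k, L⟩ = ⟨K, g L⟩ := by
  induction j with
  | zero => exact ⟨k, id, Nat.zero_le _, continuous_id, fun _ => rfl⟩
  | succ j ih =>
    obtain ⟨K, g, hK, hg, h⟩ := ih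
    refine ⟨K + 1, fun L => (g L).stab, Nat.succ_le_succ hK, Frame.continuous_stab.comp hg,
      fun L => ?_⟩
    rw [iterate_succ_apply', h]
    rfl

/-- A reference frame in each rank at least `m`, compatible with stabilisation, and projections
to the subspaces so spanned. -/
structure Reference (m : ℕ) (L₀ : Frame m) where
  L : ∀ k, Frame k
  P : ∀ k, (ℕ → ℝ) →L[ℝ] (Fin k → ℝ)
  L_self : L m = L₀
  L_stab : ∀ k, m ≤ k → L (k + 1) = (L k).stab
  P_stab : ∀ k, m ≤ k → P (k + 1) = Frame.stabProj (P k)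
  P_L : ∀ k, m ≤ k → ∀ x, P k ((L k).1 x) = x

theorem exists_reference {m : ℕ} (L₀ : Frame m) : Nonempty (Reference m L₀) := by
  obtain ⟨P₀, hP₀⟩ := L₀.exists_leftInverse
  -- Below rank `m` the values `Frame.std k` and `0` are placeholders; the properties recorded in
  -- `Reference` concern ranks at least `m` only.
  let L : ∀ k, Frame k := fun k => if h : m ≤ k then
    Nat.leRec (motive := fun k _ => Frame k) L₀ (fun _ _ L => L.stab) h else Frame.std k
  let P : ∀ k, (ℕ → ℝ) →L[ℝ] (Fin k → ℝ) := fun k => if h : m ≤ k then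
    Nat.leRec (motive := fun k _ => (ℕ → ℝ) →L[ℝ] (Fin k → ℝ)) P₀
      (fun _ _ P => Frame.stabProj P) h else 0
  have hL0 : L m = L₀ := by simp [L]
  have hP0 : P m = P₀ := by simp [P]
  have hLs : ∀ k, m ≤ k → L (k + 1) = (L k).stab := fun k h => by
    simp only [L, dif_pos h, dif_pos (h.trans (Nat.le_succ k))]
    rw [Nat.leRec_succ]
  have hPs : ∀ k, m ≤ k → P (k + 1) = Frame.stabProj (P k) := fun k h => by
    simp only [P, dif_pos h, dif_pos (h.trans (Nat.le_succ k))]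
    rw [Nat.leRec_succ]
  refine ⟨⟨L, P, hL0, hLs, hPs, fun k hk => ?_⟩⟩
  induction k, hk using Nat.le_induction with
  | base => rw [hL0, hP0]; exact hP₀
  | succ k hk ih =>
    intro x
    rw [hPs k hk, hLs k hk]
    refine (Frame.stabProj_stabLin (P k) (L k).1 x).trans ?_
    rw [ih, Prod.mk.eta, LinearEquiv.symm_apply_apply]

namespace Reference

variable {m : ℕ} {L₀ : Frame m} (ρ : Reference m L₀)

/-- The determinant of the projection to the reference subspace. -/
def D (z : Frames) : ℝ := LinearMap.det ((ρ.P z.1).toLinearMap ∘ₗ z.2.1)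

/-- The linear map `(1 - t) L P z + t z`. -/
def lin (z : Frames) (t : ℝ) : (Fin z.1 → ℝ) →ₗ[ℝ] (ℕ → ℝ) :=
  (1 - t) • ((ρ.L z.1).1 ∘ₗ (ρ.P z.1).toLinearMap ∘ₗ z.2.1) + t • z.2.1

/-- Since `P ∘ L = id` for the reference, `P ∘ lin z t` equals `P ∘ z` for all `t`, and the latter
is invertible. -/
theorem lin_injective {z : Frames} (hz : m ≤ z.1) (hD : 0 < ρ.D z) (t : ℝ) :
    Injective (ρ.lin z t) := by
  have h1 : ∀ x, ρ.P z.1 (ρ.lin z t x) = ρ.P z.1 (z.2.1 x) := fun x => by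
    change ρ.P z.1 ((1 - t) • (ρ.L z.1).1 (ρ.P z.1 (z.2.1 x)) + t • z.2.1 x) = _
    rw [map_add, map_smul, map_smul, ρ.P_L z.1 hz, ← add_smul, sub_add_cancel, one_smul]
  have h2 := (LinearMap.equivOfDetNeZero _ hD.ne').bijective
  intro x y hxy
  exact h2.1 (by
    change ρ.P z.1 (z.2.1 x) = ρ.P z.1 (z.2.1 y)
    rw [← h1, ← h1, hxy])

open Classical in
/-- The deformation of a frame to the reference frame, where it is defined. -/
def G (z : Frames) (t : ℝ) : Frames :=
  ⟨z.1, if h : Injective (ρ.lin z t) then ⟨ρ.lin z t, h⟩ else z.2⟩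

theorem G_eq {z : Frames} {t : ℝ} (h : Injective (ρ.lin z t)) :
    ρ.G z t = ⟨z.1, ⟨ρ.lin z t, h⟩⟩ := congrArg (Sigma.mk z.1) (dif_pos h)

theorem D_stabS {z : Frames} (hz : m ≤ z.1) : ρ.D (stabS z) = ρ.D z := by
  change LinearMap.det ((ρ.P (z.1 + 1)).toLinearMap ∘ₗ Frame.stabLin z.2.1) = _
  rw [ρ.P_stab z.1 hz]
  exact Frame.det_stabProj_stabLin _ _

theorem G_stabS {z : Frames} (hz : m ≤ z.1) (hD : 0 < ρ.D z) (t : ℝ) :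
    ρ.G (stabS z) t = stabS (ρ.G z t) := by
  rw [ρ.G_eq (ρ.lin_injective hz hD t), ρ.G_eq (ρ.lin_injective (z := stabS z)
    (hz.trans (Nat.le_succ _)) (by rwa [ρ.D_stabS hz]) t)]
  refine congrArg (Sigma.mk (z.1 + 1)) ?_
  refine Frame.ext_apply fun x => ?_
  change (1 - t) • (ρ.L (z.1 + 1)).1 (ρ.P (z.1 + 1) (Frame.stabLin z.2.1 x)) +
    t • Frame.stabLin z.2.1 x = Frame.stabLin (ρ.lin z t) x
  have h1 := congrArg (fun P => P (Frame.stabLin z.2.1 x)) (ρ.P_stab z.1 hz)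
  have h2 := fun y => congrArg (fun L : Frame (z.1 + 1) => L.1 y) (ρ.L_stab z.1 hz)
  refine Eq.trans ?_ (Frame.stabLin_combine (ρ.P z.1) z.2.1 (ρ.L z.1).1 t x)
  exact congrArg (fun y => (1 - t) • y + t • Frame.stabLin z.2.1 x)
    ((congrArg (ρ.L (z.1 + 1)).1 h1).trans (h2 _))

theorem D_sameSpan {z z' : Frames} (h : SameSpan z z') : 0 < ρ.D z ↔ 0 < ρ.D z' := by
  obtain ⟨k, L, A, hA, rfl, rfl⟩ := h
  have h1 : ρ.D ⟨k, L.comp A⟩ = ρ.D ⟨k, L⟩ * LinearMap.det A.toLinearMap :=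
    LinearMap.det_comp ((ρ.P k).toLinearMap ∘ₗ L.1) A.toLinearMap
  rw [h1]
  exact (mul_pos_iff_of_pos_right hA).symm

theorem G_sameSpan {z z' : Frames} (h : SameSpan z z') (hz : m ≤ z.1) (hD : 0 < ρ.D z) (t : ℝ) :
    SameSpan (ρ.G z t) (ρ.G z' t) := by
  have hD' := (ρ.D_sameSpan h).1 hD
  obtain ⟨k, L, A, hA, rfl, rfl⟩ := h
  refine ⟨k, ⟨ρ.lin ⟨k, L⟩ t, ρ.lin_injective hz hD t⟩, A, hA, ?_, ?_⟩
  · exact ρ.G_eq _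
  · exact ρ.G_eq (ρ.lin_injective (z := ⟨k, L.comp A⟩) hz hD' t)

theorem ofFrame_eq {z z' : Frames} (h : SameSpan z z') : ofFrame z.2 = ofFrame z'.2 := by
  obtain ⟨k, L, A, hA, rfl, rfl⟩ := h
  exact (ofFrame_comp L A hA).symm

open Classical in
/-- The deformation on `BSO`. -/
def defo : BSO → ℝ → BSO :=
  Quot.lift (fun z t => if 0 < ρ.D (stabS^[m] z) then ofFrame (ρ.G (stabS^[m] z) t).2
    else ofFrame z.2) (by
    rintro _ _ h
    funext t
    obtain ⟨L, A, hA⟩ | L := h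
    · have h1 : SameSpan ⟨_, L⟩ ⟨_, L.comp A⟩ := ⟨_, L, A, hA, rfl, rfl⟩
      have h2 := h1.iterate m
      simp only [ρ.D_sameSpan h2]
      by_cases hD : 0 < ρ.D (stabS^[m] ⟨_, L.comp A⟩)
      · rw [if_pos hD, if_pos hD]
        exact ofFrame_eq (ρ.G_sameSpan h2 (le_iterate _ _) ((ρ.D_sameSpan h2).2 hD) t)
      · rw [if_neg hD, if_neg hD]
        exact ofFrame_eq h1
    · have h1 : stabS^[m] ⟨_, L.stab⟩ = stabS (stabS^[m] ⟨_, L⟩) :=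
        iterate_succ_apply' stabS m ⟨_, L⟩
      rw [h1, ρ.D_stabS (le_iterate _ _)]
      by_cases hD : 0 < ρ.D (stabS^[m] ⟨_, L⟩)
      · rw [if_pos hD, if_pos hD, ρ.G_stabS (le_iterate _ _) hD]
        exact (ofFrame_stab _).symm
      · rw [if_neg hD, if_neg hD]
        exact (ofFrame_stab L).symm)

/-- The neighbourhood of the reference subspace on which the deformation is defined. -/
def nhd : Set BSO := {x | Quot.lift (fun z : Frames => 0 < ρ.D (stabS^[m] z)) (by
    rintro _ _ (⟨L, A, hA⟩ | L)
    · exact propext (ρ.D_sameSpan (SameSpan.iterate ⟨_, L, A, hA, rfl, rfl⟩ m))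
    · have h1 : stabS^[m] ⟨_, L.stab⟩ = stabS (stabS^[m] ⟨_, L⟩) :=
        iterate_succ_apply' stabS m ⟨_, L⟩
      rw [h1, ρ.D_stabS (le_iterate _ _)]) x}

theorem mem_nhd {k : ℕ} {L : Frame k} : ofFrame L ∈ ρ.nhd ↔ 0 < ρ.D (stabS^[m] ⟨k, L⟩) := Iff.rfl

theorem defo_ofFrame {k : ℕ} {L : Frame k} (h : ofFrame L ∈ ρ.nhd) (t : ℝ) :
    ρ.defo (ofFrame L) t = ofFrame (ρ.G (stabS^[m] ⟨k, L⟩) t).2 := if_pos h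

/-- After `m` stabilisations a representative has rank at least `m`, and the whole deformation takes
place among frames of this one rank. At time `0` the frame is the reference frame up to the
automorphism `P ∘ z`, of positive determinant. -/
theorem exists_path {x : BSO} (hx : x ∈ ρ.nhd) : ∃ (k : ℕ) (p : ℝ → Frame k), Continuous p ∧
    (∀ t, ofFrame (p t) = ρ.defo x t) ∧ ofFrame (p 0) = ofFrame L₀ ∧ ofFrame (p 1) = x := by
  obtain ⟨k, L, rfl⟩ := exists_ofFrame x
  have hL := ofFrame_iterate m ⟨k, L⟩
  have hd := fun t => ρ.defo_ofFrame hx t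
  have hD : 0 < ρ.D (stabS^[m] ⟨k, L⟩) := hx
  have hm := le_iterate m ⟨k, L⟩
  set z := stabS^[m] ⟨k, L⟩ with hz
  have hinj := ρ.lin_injective hm hD
  refine ⟨z.1, fun t => ⟨ρ.lin z t, hinj t⟩, ?_, fun t => ?_, ?_, ?_⟩
  · refine Frame.continuous_iff.2 fun x => ?_
    change Continuous fun t : ℝ => (1 - t) • (ρ.L z.1).1 (ρ.P z.1 (z.2.1 x)) + t • z.2.1 x
    fun_prop
  · rw [hd]
    exact congrArg ofFrame (dif_pos (hinj t)).symm
  · let A := LinearMap.equivOfDetNeZero _ hD.ne'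
    have h1 : (⟨ρ.lin z 0, hinj 0⟩ : Frame z.1) = (ρ.L z.1).comp A := by
      refine Frame.ext_apply fun x => ?_
      change (1 - (0 : ℝ)) • (ρ.L z.1).1 (ρ.P z.1 (z.2.1 x)) + (0 : ℝ) • z.2.1 x = _
      rw [sub_zero, one_smul, zero_smul, add_zero]
      rfl
    have h2 : ∀ k, m ≤ k → ofFrame (ρ.L k) = ofFrame L₀ := fun k hk => by
      induction k, hk using Nat.le_induction with
      | base => rw [ρ.L_self]
      | succ k hk ih => rw [ρ.L_stab k hk, ofFrame_stab, ih]
    exact (congrArg ofFrame h1).trans ((ofFrame_comp _ A hD).trans (h2 _ hm))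
  · rw [← hL]
    refine congrArg ofFrame (Frame.ext_apply fun x => ?_)
    change (1 - (1 : ℝ)) • (ρ.L z.1).1 (ρ.P z.1 (z.2.1 x)) + (1 : ℝ) • z.2.1 x = _
    rw [sub_self, one_smul, zero_smul, zero_add]

theorem continuous_D_frame (k : ℕ) : Continuous fun L : Frame k => ρ.D ⟨k, L⟩ := by
  have h : ∀ L : Frame k, ρ.D ⟨k, L⟩ =
      (LinearMap.toMatrix' ((ρ.P k).toLinearMap ∘ₗ L.1)).det := fun L =>
    (LinearMap.det_toMatrix' _).symm
  simp_rw [h]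
  refine Continuous.matrix_det (continuous_matrix fun a b => ?_)
  simp only [LinearMap.toMatrix'_apply]
  exact (continuous_apply a).comp ((ρ.P k).continuous.comp (Frame.continuous_apply _))

theorem isOpen_nhd : IsOpen ρ.nhd := by
  refine isQuotientMap_proj.isOpen_preimage.1 (isOpen_sigma_iff.2 fun k => ?_)
  obtain ⟨K, g, -, hg, h⟩ := exists_iterate m k
  have h1 : (Sigma.mk k ⁻¹' (proj ⁻¹' ρ.nhd) : Set (Frame k)) =
      {L | 0 < ρ.D ⟨K, g L⟩} := by
    ext L
    change 0 < ρ.D (stabS^[m] ⟨k, L⟩) ↔ _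
    rw [h]
    rfl
  rw [h1]
  exact isOpen_lt continuous_const ((ρ.continuous_D_frame K).comp hg)

theorem continuousOn_defo : ContinuousOn (fun z : BSO × I => ρ.defo z.1 z.2)
    (ρ.nhd ×ˢ Set.univ) := by
  have hq : IsQuotientMap (ρ.nhd.restrictPreimage (proj)) :=
    isQuotientMap_proj.restrictPreimage_isOpen ρ.isOpen_nhd
  have key : Continuous fun z : ρ.nhd × I => ρ.defo z.1.1 z.2 := by
    -- The product of a quotient map with the locally compact space `I` is a quotient map, so
    -- continuity can be checked on frames, rank by rank.
    refine hq.continuous_lift_prod_left ?_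
    change Continuous fun z : (proj ⁻¹' ρ.nhd) × I => ρ.defo (proj z.1.1) z.2
    rw [continuous_iff_continuousAt]
    rintro ⟨⟨⟨k, L⟩, hL⟩, t⟩
    have he : IsOpenEmbedding (Prod.map ((proj ⁻¹' ρ.nhd).restrictPreimage
        (Sigma.mk k : Frame k → Frames)) (id : I → I)) :=
      ((IsOpenEmbedding.sigmaMk : IsOpenEmbedding (Sigma.mk k : Frame k → Frames)).restrictPreimage _).prodMap .id
    refine (he.continuousAt_iff (x := (⟨L, hL⟩, t))).1 (Continuous.continuousAt ?_)
    obtain ⟨K, g, hK, hg, h⟩ := exists_iterate m k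
    have hinj : ∀ (L : Frame k) (t : ℝ), ofFrame L ∈ ρ.nhd → Injective (ρ.lin ⟨K, g L⟩ t) :=
      fun L t hL => ρ.lin_injective hK (by rw [← h]; exact hL) t
    let Q : (Sigma.mk k ⁻¹' (proj ⁻¹' ρ.nhd) : Set (Frame k)) × I → Frame K :=
      fun z => ⟨ρ.lin ⟨K, g z.1.1⟩ z.2, hinj _ _ z.1.2⟩
    have h1 : Continuous Q := by
      refine Frame.continuous_iff.2 fun x => ?_
      change Continuous fun z : (Sigma.mk k ⁻¹' (proj ⁻¹' ρ.nhd)) × I =>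
        (1 - (z.2 : ℝ)) • (ρ.L K).1 (ρ.P K ((g z.1.1).1 x)) + (z.2 : ℝ) • (g z.1.1).1 x
      have h2 : Continuous fun z : (Sigma.mk k ⁻¹' (proj ⁻¹' ρ.nhd)) × I =>
          (g z.1.1).1 x := (Frame.continuous_apply x).comp
        (hg.comp (continuous_subtype_val.comp continuous_fst))
      have h3 := (ρ.L K).1.continuous_of_finiteDimensional
      fun_prop
    refine (continuous_ofFrame.comp h1).congr fun z => ?_
    refine Eq.trans ?_ (ρ.defo_ofFrame z.1.2 z.2).symm
    rw [h]
    exact congrArg ofFrame (dif_pos (hinj _ _ z.1.2)).symm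
  rw [continuousOn_iff_continuous_domRestrict]
  let j : (ρ.nhd ×ˢ (Set.univ : Set I) : Set (BSO × I)) → ρ.nhd × I :=
    fun z => (⟨z.1.1, z.2.1⟩, z.1.2)
  have hj : Continuous j := by fun_prop
  exact key.comp hj

theorem self_mem_nhd : ofFrame L₀ ∈ ρ.nhd := by
  rw [mem_nhd]
  have h : ∀ j, stabS^[j] ⟨m, L₀⟩ = ⟨m + j, ρ.L (m + j)⟩ := fun j => by
    induction j with
    | zero => rw [add_zero, ρ.L_self]; rfl
    | succ j ih =>
      rw [iterate_succ_apply', ih]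
      exact congrArg (Sigma.mk (m + j + 1)) (ρ.L_stab _ (Nat.le_add_right _ _)).symm
  rw [h]
  have h1 : (ρ.P (m + m)).toLinearMap ∘ₗ (ρ.L (m + m)).1 = LinearMap.id :=
    LinearMap.ext (ρ.P_L _ (Nat.le_add_right _ _))
  change 0 < LinearMap.det ((ρ.P (m + m)).toLinearMap ∘ₗ (ρ.L (m + m)).1)
  rw [h1, LinearMap.det_id]
  exact one_pos

end Reference

/-- Local contractions of `BSO` along paths of frames. -/
theorem exists_contraction (x₀ : BSO) : ∃ (U : Set BSO) (F : BSO → I → BSO), IsOpen U ∧ x₀ ∈ U ∧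
    ContinuousOn (fun z : BSO × I => F z.1 z.2) (U ×ˢ Set.univ) ∧
    ∀ x ∈ U, F x 0 = x₀ ∧ F x 1 = x ∧
      ∃ (k : ℕ) (p : C(I, Frame k)), ∀ t, ofFrame (p t) = F x t := by
  obtain ⟨m, L₀, rfl⟩ := exists_ofFrame x₀
  obtain ⟨ρ⟩ := exists_reference L₀
  refine ⟨ρ.nhd, fun x t => ρ.defo x t, ρ.isOpen_nhd, ρ.self_mem_nhd, ρ.continuousOn_defo,
    fun x hx => ?_⟩
  obtain ⟨k, p, hp, h, h0, h1⟩ := ρ.exists_path hx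
  refine ⟨?_, ?_, k, ⟨fun t => p t, by fun_prop⟩, fun t => h t⟩
  · exact (h 0).symm.trans h0
  · exact (h 1).symm.trans h1

end BSO

end

/-! ### The fibre of `BO⟨n⟩ → BSO` over the base point -/

noncomputable section

open scoped unitInterval

/-- A retract of a retract of a complex. -/
def CubRetract.ofRetract {X Y : Type} [TopologicalSpace X] [TopologicalSpace Y] (c : CubRetract X)
    (i : Y → X) (r : X → Y) (hi : Continuous i) (hr : Continuous r) (h : ∀ y, r (i y) = y) :
    CubRetract Y where
  ι := c.ι
  S := c.S
  finite := c.finite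
  isComplex := c.isComplex
  i y := c.i (i y)
  r x := r (c.r x)
  continuous_i := c.continuous_i.comp hi
  continuousOn_r := hr.comp_continuousOn c.continuousOn_r
  i_mem y := c.i_mem _
  r_i y := by rw [c.r_i, h]

/-- A point as a complex. -/
def CubRetract.unit : CubRetract Unit :=
  CubRetract.interval.ofRetract (fun _ => 0) (fun _ => ()) continuous_const continuous_const
    fun _ => rfl

namespace ConnectedCover

variable {n : ℕ} (𝔅 : ConnectedCover n)

/-- The point `b` can be reached from the base point along a lift of a path of frames from the
standard frame to `L`. -/
def Reach {m : ℕ} (L : Frame m) (b : 𝔅.B) : Prop :=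
  ∃ (p : Path (Frame.std m) L) (β : Path 𝔅.pt b), ∀ t, 𝔅.θ (β t) = BSO.ofFrame (p t)

variable {𝔅} {m : ℕ} {L L' : Frame m} {b b' : 𝔅.B}

theorem Reach.θ_eq (h : 𝔅.Reach L b) : 𝔅.θ b = BSO.ofFrame L := by
  obtain ⟨p, β, h⟩ := h
  simpa using h 1

theorem Reach.trans (h : 𝔅.Reach L b) (q : Path L L') (β : Path b b')
    (hβ : ∀ t, 𝔅.θ (β t) = BSO.ofFrame (q t)) : 𝔅.Reach L' b' := by
  obtain ⟨p, α, h⟩ := h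
  refine ⟨p.trans q, α.trans β, fun t => ?_⟩
  simp only [Path.trans_apply]
  split_ifs
  · exact h _
  · exact hβ _

theorem exists_lift_path (q : Path L L') (hb : 𝔅.θ b = BSO.ofFrame L) :
    ∃ (b' : 𝔅.B) (β : Path b b'), ∀ t, 𝔅.θ (β t) = BSO.ofFrame (q t) := by
  obtain ⟨v, hv, hv0, hvu⟩ := CubRetract.unit.lift_homotopy 𝔅.serre
    (u := fun z => BSO.ofFrame (q z.2)) (BSO.continuous_ofFrame.comp (by fun_prop))
    (a := fun _ => b) continuous_const (fun _ => by simpa using hb)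
  exact ⟨v ((), 1), ⟨⟨fun t => v ((), t), by fun_prop⟩, hv0 (), rfl⟩, fun t => hvu ((), t)⟩

theorem exists_reach (L : Frame m) : ∃ b, 𝔅.Reach L b := by
  have q : Path (Frame.std m) L := (PathConnectedSpace.joined _ _).somePath
  obtain ⟨b, β, h⟩ := exists_lift_path (𝔅 := 𝔅) (b := 𝔅.pt) q
    (𝔅.θ_pt.trans (BSO.of_std m).symm)
  exact ⟨b, q, β, h⟩

/-- Frames form a simply connected space, so the two paths of frames are homotopic relative to their
ends. Lifting this homotopy with the two given lifts as sides yields, on the last edge, a path in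
the fibre. -/
theorem Reach.unique (h : 𝔅.Reach L b) (h' : 𝔅.Reach L b') :
    ∃ f : Path b b', ∀ t, 𝔅.θ (f t) = BSO.ofFrame L := by
  obtain ⟨p, β, h⟩ := h
  obtain ⟨p', β', h'⟩ := h'
  obtain ⟨H⟩ := SimplyConnectedSpace.paths_homotopic p p'
  obtain ⟨v, hv, hvu, -, hv0, hv1⟩ := CubRetract.unit.lift_square 𝔅.serre
    (u := fun z => BSO.ofFrame (H z.2)) (BSO.continuous_ofFrame.comp (by fun_prop))
    (a := fun _ => 𝔅.pt) (a₀ := fun z => β z.2) (a₁ := fun z => β' z.2) continuous_const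
    (by fun_prop) (by fun_prop) (fun _ s => by
      rw [H.source]
      exact 𝔅.θ_pt.trans (BSO.of_std m).symm) (fun _ t => by simpa using h t)
    (fun _ t => by simpa using h' t) (fun _ => by simp) (fun _ => by simp)
  refine ⟨⟨⟨fun s => v ((), s, 1), by fun_prop⟩, ?_, ?_⟩, fun s => ?_⟩
  · exact (hv0 () 1).trans (by simp)
  · exact (hv1 () 1).trans (by simp)
  · exact (hvu ((), s, 1)).trans (by simp)

theorem Reach.of_fibre (h : 𝔅.Reach L b) (f : Path b b') (hf : ∀ t, 𝔅.θ (f t) = BSO.ofFrame L) :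
    𝔅.Reach L b' :=
  h.trans (Path.refl L) f hf

theorem Reach.stab (h : 𝔅.Reach L b) : 𝔅.Reach L.stab b := by
  obtain ⟨p, β, h⟩ := h
  exact ⟨p.map Frame.continuous_stab, β, fun t => (h t).trans (BSO.ofFrame_stab _).symm⟩

/-- A path of frames of rank `m + 1` need not be a stabilisation. But some point can be reached
along frames of rank `m`, and `Reach.unique`, after stabilisation, joins it to `b` in the fibre. -/
theorem reach_stab : 𝔅.Reach L.stab b ↔ 𝔅.Reach L b := by
  refine ⟨fun h => ?_, Reach.stab⟩
  obtain ⟨b₀, h₀⟩ := exists_reach (𝔅 := 𝔅) L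
  obtain ⟨f, hf⟩ := h₀.stab.unique h
  exact h₀.of_fibre f fun t => (hf t).trans (BSO.ofFrame_stab L)

/-- Linear paths of changes of basis. -/
theorem Reach.comp_of_linear (h : 𝔅.Reach L b) (A : (Fin m → ℝ) ≃ₗ[ℝ] (Fin m → ℝ))
    (hA : ∀ t ∈ Set.Icc (0 : ℝ) 1, Injective
      ((1 - t) • LinearMap.id + t • A.toLinearMap : (Fin m → ℝ) →ₗ[ℝ] (Fin m → ℝ))) :
    𝔅.Reach (L.comp A) b := by
  let C : ℝ → ((Fin m → ℝ) →ₗ[ℝ] (Fin m → ℝ)) := fun t => (1 - t) • LinearMap.id + t • A.toLinearMap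
  have hdet : ∀ t, LinearMap.det (C t) = (LinearMap.toMatrix' (C t)).det := fun t =>
    (LinearMap.det_toMatrix' _).symm
  have hc : Continuous fun t => LinearMap.det (C t) := by
    simp_rw [hdet]
    refine Continuous.matrix_det (continuous_matrix fun i j => ?_)
    change Continuous fun t : ℝ => LinearMap.toMatrix' (C t) i j
    simp only [LinearMap.toMatrix'_apply, C, LinearMap.add_apply, LinearMap.smul_apply, Pi.add_apply,
      Pi.smul_apply]
    fun_prop
  have h0 : C 0 = LinearMap.id := by simp [C]
  have h1 : C 1 = A.toLinearMap := by simp [C]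
  -- The determinant is `1` at the start and never vanishes, hence is positive. All frames of `q`
  -- thus span the same oriented subspace, and the lift of `q` can be constant.
  have hpos : ∀ t ∈ Set.Icc (0 : ℝ) 1, 0 < LinearMap.det (C t) := by
    intro t ht
    by_contra hcon
    have h2 : (0 : ℝ) ∈ Set.Icc (LinearMap.det (C t)) (LinearMap.det (C 0)) := by
      rw [h0, LinearMap.det_id]
      exact ⟨not_lt.1 hcon, zero_le_one⟩
    obtain ⟨s, hs, hs0⟩ := intermediate_value_Icc' ht.1 hc.continuousOn h2
    have h3 := LinearMap.isUnit_det (C s) ((LinearMap.isUnit_iff_ker_eq_bot _).2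
      (LinearMap.ker_eq_bot.2 (hA s ⟨hs.1, hs.2.trans ht.2⟩)))
    exact h3.ne_zero hs0
  let q : Path L (L.comp A) :=
    { toFun := fun t => ⟨L.1 ∘ₗ C t, L.2.comp (hA t t.2)⟩
      continuous_toFun := Frame.continuous_iff.2 fun x => by
        have h2 := L.1.continuous_of_finiteDimensional
        change Continuous fun t : I => L.1 ((1 - (t : ℝ)) • x + (t : ℝ) • A x)
        fun_prop
      source' := Frame.ext_apply fun x => by
        change L.1 (C ((0 : I) : ℝ) x) = _
        rw [Set.Icc.coe_zero, h0]
        rfl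
      target' := Frame.ext_apply fun x => by
        change L.1 (C ((1 : I) : ℝ) x) = _
        rw [Set.Icc.coe_one, h1]
        rfl }
  refine h.trans q (Path.refl b) fun t => ?_
  change 𝔅.θ b = _
  rw [h.θ_eq]
  exact (BSO.ofFrame_comp L (LinearMap.equivOfDetNeZero _ (hpos t t.2).ne') (hpos t t.2)).symm

end ConnectedCover

/-! ### Generation of `SL` by transvections. -/

namespace Matrix.SpecialLinearGroup

variable {ι : Type*} [Fintype ι] [DecidableEq ι]

theorem transvection_mulVec {i j : ι} (hij : i ≠ j) (c : ℝ) (x : ι → ℝ) :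
    (transvection hij c).1.mulVec x = Function.update x i (x i + c * x j) := by
  rw [transvection_coe]
  funext k
  by_cases hk : k = i
  · subst hk
    simp [Matrix.add_mulVec, Matrix.single_mulVec]
  · simp [Matrix.add_mulVec, Matrix.single_mulVec, hk]

/-- Whitehead's factorisation: `diag(c, c⁻¹) = w(c) w(-1)`, where `w(c) = e_ij(c) e_ji(-c⁻¹)
e_ij(c)`. -/
theorem diag2n_eq {i j : ι} (hij : i ≠ j) {c : ℝ} (hc : c ≠ 0) :
    diag2n hij c hc = transvection hij c * transvection hij.symm (-c⁻¹) * transvection hij c *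
      transvection hij (-1) * transvection hij.symm 1 * transvection hij (-1) := by
  refine Subtype.ext (Matrix.ext_of_mulVec_single fun k => ?_)
  generalize (Pi.single k 1 : ι → ℝ) = x
  simp only [coe_mul, ← Matrix.mulVec_mulVec, transvection_mulVec, diag2n_coe]
  funext l
  rw [Matrix.mulVec_diagonal]
  by_cases h1 : l = i
  · subst h1
    simp [hij, hij.symm]
    field_simp
    ring
  · by_cases h2 : l = j
    · subst h2
      simp [hij, hij.symm]
      field_simp
      ring
    · simp [h1, h2]

/-- `SL(n, ℝ)` is generated by transvections. -/
theorem transvection_induction [Nontrivial ι] {P : SpecialLinearGroup ι ℝ → Prop}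
    (ht : ∀ (i j : ι) (hij : i ≠ j) (a : ℝ), P (transvection hij a))
    (hmul : ∀ A B, P A → P B → P (A * B)) (M : SpecialLinearGroup ι ℝ) : P M := by
  refine diagonal_transvection_induction' P M (fun i j hij c hc => ?_) ht hmul
  rw [diag2n_eq hij hc]
  exact hmul _ _ (hmul _ _ (hmul _ _ (hmul _ _ (hmul _ _ (ht _ _ _ _) (ht _ _ _ _)) (ht _ _ _ _))
    (ht _ _ _ _)) (ht _ _ _ _)) (ht _ _ _ _)

end Matrix.SpecialLinearGroup

namespace ConnectedCover

variable {n : ℕ} {𝔅 : ConnectedCover n} {m : ℕ} {L L' : Frame m} {b b' : 𝔅.B}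

/-- The linear path from the identity to `e_ij(c)` consists of the transvections `e_ij(tc)`, so
`Reach.comp_of_linear` treats the generators. -/
theorem Reach.comp_sl [Nontrivial (Fin m)] (M : Matrix.SpecialLinearGroup (Fin m) ℝ)
    (h : 𝔅.Reach L b) : 𝔅.Reach (L.comp (Matrix.SpecialLinearGroup.toLin' M)) b := by
  have key := Matrix.SpecialLinearGroup.transvection_induction (P := fun M => ∀ (L : Frame m),
    𝔅.Reach L b → 𝔅.Reach (L.comp (Matrix.SpecialLinearGroup.toLin' M)) b) ?_ ?_ M
  · exact key L h
  · intro i j hij c L h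
    refine h.comp_of_linear _ fun t _ => ?_
    have h1 := (Matrix.SpecialLinearGroup.toLin'
      (Matrix.SpecialLinearGroup.transvection hij (t * c))).injective
    refine (congrArg Injective (funext fun x => ?_)).mp h1
    have h2 := Matrix.SpecialLinearGroup.transvection_mulVec hij (t * c) x
    have h3 := Matrix.SpecialLinearGroup.transvection_mulVec hij c x
    change (Matrix.SpecialLinearGroup.transvection hij (t * c)).1.mulVec x =
      (1 - t) • x + t • (Matrix.SpecialLinearGroup.transvection hij c).1.mulVec x
    rw [h2, h3]
    funext k
    by_cases hk : k = i
    · subst hk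
      simp
      ring
    · simp [hk]
      ring
  · intro A B hA hB L h
    have h1 : L.comp (Matrix.SpecialLinearGroup.toLin' (A * B)) =
        (L.comp (Matrix.SpecialLinearGroup.toLin' A)).comp
          (Matrix.SpecialLinearGroup.toLin' B) := by
      rw [map_mul]
      rfl
    rw [h1]
    exact hB _ (hA _ h)

/-- An automorphism of positive determinant is a positive scalar, the `m`-th root of its
determinant, times an element of `SL`. A positive scalar is joined to the identity by a linear path.
-/
theorem Reach.comp_of_nontrivial [Nontrivial (Fin m)] (h : 𝔅.Reach L b)
    (A : (Fin m → ℝ) ≃ₗ[ℝ] (Fin m → ℝ)) (hA : 0 < LinearMap.det A.toLinearMap) :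
    𝔅.Reach (L.comp A) b := by
  have hm : m ≠ 0 := by
    rintro rfl
    exact not_nontrivial (Fin 0) inferInstance
  set d := LinearMap.det A.toLinearMap with hd
  set s : ℝ := d ^ ((m : ℝ)⁻¹) with hs
  have hs0 : 0 < s := Real.rpow_pos_of_pos hA _
  have hsm : s ^ m = d := Real.rpow_inv_natCast_pow hA.le hm
  let M : Matrix.SpecialLinearGroup (Fin m) ℝ := ⟨s⁻¹ • LinearMap.toMatrix' A.toLinearMap, by
    rw [Matrix.det_smul, LinearMap.det_toMatrix', ← hd, Fintype.card_fin, inv_pow, hsm,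
      inv_mul_cancel₀ hA.ne']⟩
  let S : (Fin m → ℝ) ≃ₗ[ℝ] (Fin m → ℝ) := LinearEquiv.smulOfNeZero ℝ _ s hs0.ne'
  have h1 : 𝔅.Reach (L.comp S) b := by
    refine h.comp_of_linear S fun t ht => ?_
    have h2 : 0 < 1 - t + t * s := by
      rcases ht.1.eq_or_lt with h | h
      · simp [← h]
      · have := mul_pos h hs0
        linarith [ht.2]
    intro x y hxy
    have h3 : ∀ x : Fin m → ℝ, ((1 - t) • LinearMap.id + t • S.toLinearMap :
        (Fin m → ℝ) →ₗ[ℝ] (Fin m → ℝ)) x = (1 - t + t * s) • x := fun x => by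
      change (1 - t) • x + t • s • x = _
      rw [add_smul, mul_smul]
    rw [h3, h3] at hxy
    exact smul_right_injective _ h2.ne' hxy
  have h4 := h1.comp_sl M
  convert h4 using 1
  refine Frame.ext_apply fun x => ?_
  change L.1 (A x) = L.1 (s • (s⁻¹ • LinearMap.toMatrix' A.toLinearMap).mulVec x)
  rw [Matrix.smul_mulVec, smul_smul, mul_inv_cancel₀ hs0.ne', one_smul]
  exact congrArg L.1 (congrArg (fun f => f x) (Matrix.toLin'_toMatrix' A.toLinearMap)).symm

/-- Two stabilisations make the rank at least `2`, as the generation by transvections requires;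
`reach_stab` undoes them. -/
theorem Reach.comp (h : 𝔅.Reach L b) (A : (Fin m → ℝ) ≃ₗ[ℝ] (Fin m → ℝ))
    (hA : 0 < LinearMap.det A.toLinearMap) : 𝔅.Reach (L.comp A) b := by
  have key : ∀ {z z' : BSO.Frames}, BSO.SameSpan z z' → 2 ≤ z.1 → 𝔅.Reach z.2 b →
      𝔅.Reach z'.2 b := by
    rintro z z' ⟨k, L, A, hA, rfl, rfl⟩ hk h
    have : Nontrivial (Fin k) := Fin.nontrivial_iff_two_le.2 hk
    exact h.comp_of_nontrivial A hA
  have h1 : BSO.SameSpan ⟨m, L⟩ ⟨m, L.comp A⟩ := ⟨m, L, A, hA, rfl, rfl⟩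
  exact reach_stab.1 (reach_stab.1 (key h1.stabS.stabS (by simp [BSO.stabS]) h.stab.stab))

variable (𝔅) in
/-- The point `b` can be reached from the base point along a lift of a path of frames which ends in
a frame of `x`. -/
def ReachOver : BSO → 𝔅.B → Prop :=
  Quot.lift (fun z b => 𝔅.Reach z.2 b) (by
    rintro _ _ (⟨L, A, hA⟩ | L) <;> funext b
    · refine propext ⟨fun h => h.comp A hA, fun h => ?_⟩
      have hA' : 0 < LinearMap.det A.symm.toLinearMap := by
        have h1 : LinearMap.det A.symm.toLinearMap * LinearMap.det A.toLinearMap = 1 := by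
          rw [← LinearMap.det_comp]; simp
        exact pos_of_mul_pos_left (h1 ▸ one_pos) hA.le
      have h2 := h.comp A.symm hA'
      have h3 : (L.comp A).comp A.symm = L := Frame.ext_apply fun x => by simp [Frame.comp]
      exact h3 ▸ h2
    · exact propext reach_stab.symm)

theorem ReachOver.trans (p : C(I, Frame m)) (v : C(I, 𝔅.B))
    (hv : ∀ t, 𝔅.θ (v t) = BSO.ofFrame (p t)) (h : 𝔅.ReachOver (𝔅.θ (v 0)) (v 0)) :
    𝔅.ReachOver (𝔅.θ (v 1)) (v 1) := by
  rw [hv] at h ⊢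
  exact Reach.trans (L := p 0) (L' := p 1) h ⟨p, rfl, rfl⟩ ⟨v, rfl, rfl⟩ hv

/-- The image of `γ` in `BSO` need not come from a path of frames of one rank. The condition is
shown to be both open and closed along `γ`: in a contractible neighbourhood, contracting a piece of
`γ` to the centre and lifting this homotopy replaces the piece by two lifts of paths of frames and a
path in the fibre over the centre. -/
theorem reachOver_of_path (γ : C(I, 𝔅.B)) (h : 𝔅.ReachOver (𝔅.θ (γ 0)) (γ 0)) :
    𝔅.ReachOver (𝔅.θ (γ 1)) (γ 1) := by
  let T : Set I := {t | 𝔅.ReachOver (𝔅.θ (γ t)) (γ t)}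
  have hloc : ∀ t₀ : I, ∃ ε > 0, ∀ t ∈ ball t₀ ε, ∀ t' ∈ ball t₀ ε, t ∈ T → t' ∈ T := by
    intro t₀
    obtain ⟨U, F, hU, hx, hF, h⟩ := BSO.exists_contraction (𝔅.θ (γ t₀))
    obtain ⟨ε, hε, hball⟩ := Metric.isOpen_iff.1 (hU.preimage (𝔅.θ.continuous.comp γ.continuous))
      t₀ hx
    refine ⟨ε, hε, fun t ht t' ht' htT => ?_⟩
    let c : I → I := fun r => clampI ((1 - (r : ℝ)) * t + r * t')
    have hclamp := continuous_clampI
    have hc : Continuous c := by fun_prop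
    have hc0 : c 0 = t := by simp [c]
    have hc1 : c 1 = t' := by simp [c]
    have hcU : ∀ r, 𝔅.θ (γ (c r)) ∈ U := fun r => hball (by
      have h1 := (convex_ball (t₀ : ℝ) ε) (x := t) ht (y := t') ht' (a := 1 - (r : ℝ)) (b := (r : ℝ))
        (by linarith [r.2.2]) r.2.1 (by ring)
      have h2 := (convex_Icc (0 : ℝ) 1) t.2 t'.2 (a := 1 - (r : ℝ)) (b := (r : ℝ))
        (by linarith [r.2.2]) r.2.1 (by ring)
      have h3 : ((c r : I) : ℝ) = (1 - (r : ℝ)) * t + r * t' := coe_clampI h2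
      change ((c r : I) : ℝ) ∈ ball (t₀ : ℝ) ε
      rw [h3]
      exact h1)
    obtain ⟨v, hv, hv0, hvu⟩ := CubRetract.interval.lift_homotopy 𝔅.serre
      (u := fun z => F (𝔅.θ (γ (c z.1))) (unitInterval.symm z.2))
      (hF.comp_continuous (f := fun z : I × I => (𝔅.θ (γ (c z.1)), unitInterval.symm z.2))
        (by fun_prop) fun z => ⟨hcU _, trivial⟩)
      (a := fun r => γ (c r)) (by fun_prop) (fun r => by simp [(h _ (hcU r)).2.1])
    -- along the contraction to the centre, in the fibre, and back
    have h1 : 𝔅.ReachOver (𝔅.θ (v (0, 1))) (v (0, 1)) := by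
      obtain ⟨k, p, hp⟩ := (h _ (hcU 0)).2.2
      refine ReachOver.trans (p.comp ⟨unitInterval.symm, by fun_prop⟩)
        ⟨fun s => v (0, s), by fun_prop⟩ (fun s => (hvu (0, s)).trans (hp _).symm) ?_
      change 𝔅.ReachOver (𝔅.θ (v (0, 0))) (v (0, 0))
      rw [hv0, hc0]
      exact htT
    have h2 : 𝔅.ReachOver (𝔅.θ (v (1, 1))) (v (1, 1)) := by
      obtain ⟨k, L, hL⟩ := BSO.exists_ofFrame (𝔅.θ (γ t₀))
      refine ReachOver.trans (ContinuousMap.const _ L) ⟨fun r => v (r, 1), by fun_prop⟩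
        (fun r => ?_) h1
      refine (hvu (r, 1)).trans (Eq.trans ?_ hL.symm)
      simp [(h _ (hcU r)).1]
    have h3 : 𝔅.ReachOver (𝔅.θ (v (1, 0))) (v (1, 0)) := by
      obtain ⟨k, p, hp⟩ := (h _ (hcU 1)).2.2
      have := ReachOver.trans p ⟨fun s => v (1, unitInterval.symm s), by fun_prop⟩ (fun s => by
        refine (hvu (1, unitInterval.symm s)).trans (Eq.trans ?_ (hp _).symm)
        simp) (by simpa using h2)
      simpa using this
    rw [hv0, hc1] at h3
    exact h3
  have hclopen : IsClopen T := by
    constructor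
    · rw [← isOpen_compl_iff, Metric.isOpen_iff]
      intro t ht
      obtain ⟨ε, hε, h⟩ := hloc t
      exact ⟨ε, hε, fun t' ht' hT => ht (h t' ht' t (mem_ball_self hε) hT)⟩
    · rw [Metric.isOpen_iff]
      intro t ht
      obtain ⟨ε, hε, h⟩ := hloc t
      exact ⟨ε, hε, fun t' ht' => h t (mem_ball_self hε) t' ht' ht⟩
  have hT := hclopen.eq_univ ⟨0, h⟩
  exact hT.symm.subset (Set.mem_univ (1 : I))

/-- The fibre over the base point is path connected. -/
theorem exists_path_fibre {b : 𝔅.B} (hb : 𝔅.θ b = BSO.base) :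
    ∃ f : C(I, 𝔅.B), f 0 = 𝔅.pt ∧ f 1 = b ∧ ∀ t, 𝔅.θ (f t) = BSO.base := by
  have h0 : 𝔅.Reach (Frame.std 0) 𝔅.pt := ⟨Path.refl _, Path.refl _, fun _ => 𝔅.θ_pt⟩
  -- A path in the total space, whose image in `BSO` is merely a loop. Propagating `ReachOver` along
  -- it shows that `b` is reachable over the base point, and there `Reach.unique` gives a path in
  -- the fibre.
  let γ : Path 𝔅.pt b := (𝔅.joined 𝔅.pt b).somePath
  have h1 := reachOver_of_path γ.toContinuousMap (by
    change 𝔅.ReachOver (𝔅.θ (γ 0)) (γ 0)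
    rw [γ.source, 𝔅.θ_pt]
    exact h0)
  change 𝔅.ReachOver (𝔅.θ (γ 1)) (γ 1) at h1
  rw [γ.target, hb] at h1
  obtain ⟨f, hf⟩ := h0.unique h1
  exact ⟨f.toContinuousMap, f.source, f.target, hf⟩

end ConnectedCover

end

/-! ### Oriented images of families of injective linear maps -/

noncomputable section

open scoped unitInterval

namespace BSOm

variable {m : ℕ}

theorem mk_eq_mk_iff {L L' : Frame m} : mk L = mk L' ↔
    ∃ A : (Fin m → ℝ) ≃ₗ[ℝ] (Fin m → ℝ), 0 < LinearMap.det A.toLinearMap ∧ L' = L.comp A :=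
  (equivalence m).quot_mk_eq_iff _ _

theorem mk_comp {L : Frame m} {A : (Fin m → ℝ) ≃ₗ[ℝ] (Fin m → ℝ)}
    (hA : 0 < LinearMap.det A.toLinearMap) : mk (L.comp A) = mk L :=
  (mk_eq_mk_iff.2 ⟨A, hA, rfl⟩).symm

theorem mk_eq_mk_comp_iff {L : Frame m} {A : (Fin m → ℝ) ≃ₗ[ℝ] (Fin m → ℝ)} :
    mk L = mk (L.comp A) ↔ 0 < LinearMap.det A.toLinearMap := by
  refine ⟨fun h => ?_, fun h => (mk_comp h).symm⟩
  obtain ⟨A', hA', h⟩ := mk_eq_mk_iff.1 h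
  have h1 : A = A' := LinearEquiv.ext fun x => L.2 (congrArg (fun L : Frame m => L.1 x) h)
  rwa [h1]

/-- The oriented subspaces which `P` maps isomorphically to `ℝ^m`, preserving orientations. -/
def posSet (P : (ℕ → ℝ) →L[ℝ] (Fin m → ℝ)) : Set (BSOm m) :=
  {κ | Quot.lift (fun L : Frame m => 0 < LinearMap.det (P.toLinearMap ∘ₗ L.1)) (by
    rintro L _ ⟨A, hA, rfl⟩
    refine propext ?_
    have h : LinearMap.det (P.toLinearMap ∘ₗ (L.comp A).1) =
        LinearMap.det (P.toLinearMap ∘ₗ L.1) * LinearMap.det A.toLinearMap :=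
      LinearMap.det_comp (P.toLinearMap ∘ₗ L.1) A.toLinearMap
    rw [h]
    exact (mul_pos_iff_of_pos_right hA).symm) κ}

variable {P : (ℕ → ℝ) →L[ℝ] (Fin m → ℝ)}

theorem mk_mem_posSet {L : Frame m} :
    mk L ∈ posSet P ↔ 0 < LinearMap.det (P.toLinearMap ∘ₗ L.1) := Iff.rfl

theorem isOpen_posSet : IsOpen (posSet P) := by
  refine (isOpenQuotientMap_mk m).isQuotientMap.isOpen_preimage.1 ?_
  have h : ∀ L : Frame m, LinearMap.det (P.toLinearMap ∘ₗ L.1) =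
      (LinearMap.toMatrix' (P.toLinearMap ∘ₗ L.1)).det := fun L =>
    (LinearMap.det_toMatrix' _).symm
  change IsOpen {L : Frame m | 0 < LinearMap.det (P.toLinearMap ∘ₗ L.1)}
  simp_rw [h]
  refine isOpen_lt continuous_const (Continuous.matrix_det (continuous_matrix fun a b => ?_))
  simp only [LinearMap.toMatrix'_apply]
  exact (continuous_apply a).comp (P.continuous.comp (Frame.continuous_apply _))

theorem det_pos_of_mem {L : Frame m} {A : (Fin m → ℝ) ≃ₗ[ℝ] (Fin m → ℝ)} (h : mk L ∈ posSet P)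
    (h' : mk (L.comp A) ∈ posSet P) : 0 < LinearMap.det A.toLinearMap := by
  rw [mk_mem_posSet] at h h'
  have h1 : LinearMap.det (P.toLinearMap ∘ₗ (L.comp A).1) =
      LinearMap.det (P.toLinearMap ∘ₗ L.1) * LinearMap.det A.toLinearMap :=
    LinearMap.det_comp (P.toLinearMap ∘ₗ L.1) A.toLinearMap
  rw [h1] at h'
  exact pos_of_mul_pos_right h' h.le

theorem mk_mem_posSet_self {L : Frame m} (h : ∀ x, P (L.1 x) = x) : mk L ∈ posSet P := by
  have h1 : P.toLinearMap ∘ₗ L.1 = LinearMap.id := LinearMap.ext h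
  rw [mk_mem_posSet, h1, LinearMap.det_id]
  exact one_pos

/-- `κ` and `κ'` are the same subspace, possibly with different orientations. -/
def SameImage (κ κ' : BSOm m) : Prop :=
  ∃ (L : Frame m) (A : (Fin m → ℝ) ≃ₗ[ℝ] (Fin m → ℝ)), κ = mk L ∧ κ' = mk (L.comp A)

/-- Where the orientations agree, both families stay in one `posSet P`, and two frames of one
subspace that are positive for `P` differ by a positive determinant. Where they differ, by `A` with
`det A` not positive, they lie in the open sets of `P` and of `A⁻¹ ∘ P`, which are disjoint. -/
theorem isClopen_eq {Y : Type*} [TopologicalSpace Y] {κ κ' : Y → BSOm m} (hκ : Continuous κ)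
    (hκ' : Continuous κ') (h : ∀ y, SameImage (κ y) (κ' y)) : IsClopen {y | κ y = κ' y} := by
  constructor
  · rw [← isOpen_compl_iff, isOpen_iff_mem_nhds]
    intro y hy
    obtain ⟨L, A, hL, hA⟩ := h y
    obtain ⟨P, hP⟩ := L.exists_leftInverse
    let P' := (LinearMap.toContinuousLinearMap A.symm.toLinearMap).comp P
    have hneg : ¬ 0 < LinearMap.det A.toLinearMap := fun hpos => hy (by
      change κ y = κ' y
      rw [hL, hA, mk_comp hpos])
    have h1 : mk (L.comp A) ∈ posSet P' := mk_mem_posSet_self fun x => by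
      change A.symm (P (L.1 (A x))) = x
      rw [hP, A.symm_apply_apply]
    have h2 : κ y ∈ posSet P := by rw [hL]; exact mk_mem_posSet_self hP
    rw [← hA] at h1
    filter_upwards [hκ.continuousAt.preimage_mem_nhds (isOpen_posSet.mem_nhds h2),
      hκ'.continuousAt.preimage_mem_nhds (isOpen_posSet.mem_nhds h1)] with z hz hz' hzz
    have hz : κ z ∈ posSet P := hz
    have hz' : κ' z ∈ posSet P' := hz'
    have hzz : κ z = κ' z := hzz
    rw [← hzz] at hz'
    obtain ⟨L', hL'⟩ := Quot.exists_rep (κ z)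
    change mk L' = κ z at hL'
    rw [← hL', mk_mem_posSet] at hz hz'
    have h3 : LinearMap.det (P'.toLinearMap ∘ₗ L'.1) =
        LinearMap.det A.symm.toLinearMap * LinearMap.det (P.toLinearMap ∘ₗ L'.1) :=
      LinearMap.det_comp A.symm.toLinearMap (P.toLinearMap ∘ₗ L'.1)
    rw [h3] at hz'
    have h4 := pos_of_mul_pos_left hz' hz.le
    have h5 : LinearMap.det A.symm.toLinearMap * LinearMap.det A.toLinearMap = 1 := by
      rw [← LinearMap.det_comp]; simp
    exact hneg (pos_of_mul_pos_right (h5 ▸ one_pos) h4.le)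
  · rw [isOpen_iff_mem_nhds]
    intro y hy
    obtain ⟨L, A, hL, hA⟩ := h y
    obtain ⟨P, hP⟩ := L.exists_leftInverse
    have h2 : κ y ∈ posSet P := by rw [hL]; exact mk_mem_posSet_self hP
    have h1 : κ' y ∈ posSet P := (show κ y = κ' y from hy) ▸ h2
    filter_upwards [hκ.continuousAt.preimage_mem_nhds (isOpen_posSet.mem_nhds h2),
      hκ'.continuousAt.preimage_mem_nhds (isOpen_posSet.mem_nhds h1)] with z hz hz'
    obtain ⟨L', A', hL', hA'⟩ := h z
    have hz : κ z ∈ posSet P := hz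
    have hz' : κ' z ∈ posSet P := hz'
    rw [hL'] at hz
    rw [hA'] at hz'
    change κ z = κ' z
    rw [hL', hA', mk_comp (det_pos_of_mem hz hz')]

/-- Orientations of a family of subspaces over a connected space agree if they agree at a point. -/
theorem eq_of_sameImage {Y : Type*} [TopologicalSpace Y] [PreconnectedSpace Y] {κ κ' : Y → BSOm m}
    (hκ : Continuous κ) (hκ' : Continuous κ') (h : ∀ y, SameImage (κ y) (κ' y)) {y₀ : Y}
    (h0 : κ y₀ = κ' y₀) (y : Y) : κ y = κ' y :=
  ((isClopen_eq hκ hκ' h).eq_univ ⟨y₀, h0⟩).symm.subset (Set.mem_univ y)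

end BSOm

namespace Frame

variable {m : ℕ} {W : Type*} [AddCommGroup W] [Module ℝ W]

/-- The frame obtained from an injective linear map and an isomorphism. -/
def ofIso (g : W →ₗ[ℝ] (ℕ → ℝ)) (hg : Injective g) (F : (Fin m → ℝ) ≃ₗ[ℝ] W) : Frame m :=
  ⟨g ∘ₗ F.toLinearMap, hg.comp F.injective⟩

theorem ofIso_comp {g : W →ₗ[ℝ] (ℕ → ℝ)} (hg : Injective g) (F F' : (Fin m → ℝ) ≃ₗ[ℝ] W) :
    ofIso g hg F' = (ofIso g hg F).comp (F'.trans F.symm) :=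
  Frame.ext_apply fun x => by simp [ofIso, comp]

/-- Whether `F` and `F'` define the same orientation is decided by the determinant of `F⁻¹ ∘ F'`,
which does not involve `g`. -/
theorem mk_ofIso_congr {g g' : W →ₗ[ℝ] (ℕ → ℝ)} (hg : Injective g) (hg' : Injective g')
    {F F' : (Fin m → ℝ) ≃ₗ[ℝ] W} (h : BSOm.mk (ofIso g hg F) = BSOm.mk (ofIso g hg F')) :
    BSOm.mk (ofIso g' hg' F) = BSOm.mk (ofIso g' hg' F') := by
  rw [ofIso_comp hg F F', BSOm.mk_eq_mk_comp_iff] at h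
  rw [ofIso_comp hg' F F', BSOm.mk_comp h]

theorem sameImage_ofIso {g : W →ₗ[ℝ] (ℕ → ℝ)} (hg : Injective g) (F F' : (Fin m → ℝ) ≃ₗ[ℝ] W) :
    BSOm.SameImage (BSOm.mk (ofIso g hg F)) (BSOm.mk (ofIso g hg F')) :=
  ⟨_, _, rfl, by rw [ofIso_comp hg F F']⟩

end Frame

/-! ### Continuity of oriented images over a manifold. -/

section LocalFrames

variable {d m : ℕ} {X : Mfd d} {U : Type} [AddCommGroup U] [Module ℝ U] [TopologicalSpace U]
  {Z : Type*} [TopologicalSpace Z]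

/-- Families of linear maps on the fibres of `TX ⊕ U` that are continuous on the total space. -/
def ContFamily (g : Z → ∀ x : X.carrier, (X.T x × U) →ₗ[ℝ] (ℕ → ℝ)) : Prop :=
  Continuous fun z : Z × (TangentBundle X.model X.carrier × U) => g z.1 z.2.1.1 (z.2.1.2, z.2.2)

/-- The isomorphisms `F z x` are chosen pointwise, without continuity. Near `x₀` they can be
replaced by translates of `F z₀ x₀` in a trivialisation of `TX`; continuity of `κ` and of these
translates keeps both in one set `posSet P`, so the orientations still agree nearby. -/
theorem exists_local_frame {κ : Z × X.carrier → BSOm m} (hκ : Continuous κ)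
    {g : Z → ∀ x : X.carrier, (X.T x × U) →ₗ[ℝ] (ℕ → ℝ)} (hg : ContFamily g)
    (hinj : ∀ z x, Injective (g z x)) {F : ∀ (_ : Z) (x : X.carrier), (Fin m → ℝ) ≃ₗ[ℝ] (X.T x × U)}
    (hF : ∀ z x, κ (z, x) = BSOm.mk (Frame.ofIso (g z x) (hinj z x) (F z x)))
    (z₀ : Z) (x₀ : X.carrier) :
    ∃ (f : ∀ x : X.carrier, (Fin m → ℝ) ≃ₗ[ℝ] (X.T x × U)) (N : Set X.carrier), N ∈ 𝓝 x₀ ∧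
      (∀ v, ContinuousOn (fun x => (((⟨x, (f x v).1⟩ : TangentBundle X.model X.carrier),
        (f x v).2) : TangentBundle X.model X.carrier × U)) N) ∧
      ∀ᶠ y in 𝓝 (z₀, x₀), κ y = BSOm.mk (Frame.ofIso (g y.1 y.2) (hinj y.1 y.2) (f y.2)) := by
  classical
  let e := trivializationAt X.V (TangentSpace X.model) x₀
  have hx₀ : x₀ ∈ e.baseSet := FiberBundle.mem_baseSet_trivializationAt' x₀
  let B : (Fin m → ℝ) ≃ₗ[ℝ] (X.V × U) := (F z₀ x₀).trans
    ((e.continuousLinearEquivAt ℝ x₀ hx₀).toLinearEquiv.prodCongr (LinearEquiv.refl ℝ U))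
  let f : ∀ x : X.carrier, (Fin m → ℝ) ≃ₗ[ℝ] (X.T x × U) := fun x =>
    if hx : x ∈ e.baseSet then B.trans
      ((e.continuousLinearEquivAt ℝ x hx).toLinearEquiv.symm.prodCongr (LinearEquiv.refl ℝ U))
    else F z₀ x
  have hf0 : f x₀ = F z₀ x₀ := by
    refine LinearEquiv.ext fun v => ?_
    simp only [f, dif_pos hx₀]
    refine Prod.ext ?_ rfl
    exact (e.continuousLinearEquivAt ℝ x₀ hx₀).symm_apply_apply _
  have hfc : ∀ v, ContinuousOn (fun x => (((⟨x, (f x v).1⟩ : TangentBundle X.model X.carrier),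
      (f x v).2) : TangentBundle X.model X.carrier × U)) e.baseSet := by
    intro v
    have h1 : ContinuousOn (fun x => ((⟨x, e.symm x (B v).1⟩ : TangentBundle X.model X.carrier),
        (B v).2)) e.baseSet := by
      refine ContinuousOn.prodMk ?_ continuousOn_const
      exact e.continuousOn_symm.comp (by fun_prop : Continuous fun x : X.carrier =>
        (x, (B v).1)).continuousOn fun x hx => ⟨hx, trivial⟩
    refine h1.congr fun x hx => ?_
    simp only [f, dif_pos hx]
    rfl
  have hN : e.baseSet ∈ 𝓝 x₀ := e.open_baseSet.mem_nhds hx₀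
  refine ⟨f, e.baseSet, hN, hfc, ?_⟩
  obtain ⟨P, hP⟩ := (Frame.ofIso (g z₀ x₀) (hinj z₀ x₀) (F z₀ x₀)).exists_leftInverse
  have hκ0 : κ (z₀, x₀) ∈ BSOm.posSet P := by rw [hF]; exact BSOm.mk_mem_posSet_self hP
  -- the local frames
  have hc : ContinuousAt (fun y : Z × X.carrier =>
      BSOm.mk (Frame.ofIso (g y.1 y.2) (hinj y.1 y.2) (f y.2))) (z₀, x₀) := by
    refine BSOm.continuous_mk.continuousAt.comp ?_
    refine (Topology.IsInducing.continuousAt_iff ⟨rfl⟩).2 ?_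
    refine continuousAt_pi.2 fun v => ?_
    have h1 : ContinuousAt (fun y : Z × X.carrier => (y.1,
        (((⟨y.2, (f y.2 v).1⟩ : TangentBundle X.model X.carrier),
          (f y.2 v).2) : TangentBundle X.model X.carrier × U))) (z₀, x₀) :=
      continuousAt_fst.prodMk (((hfc v).continuousAt hN).comp (x := (z₀, x₀)) continuousAt_snd)
    exact hg.continuousAt.comp h1
  have hκ1 : BSOm.mk (Frame.ofIso (g z₀ x₀) (hinj z₀ x₀) (f x₀)) ∈ BSOm.posSet P := by
    rw [hf0]
    exact BSOm.mk_mem_posSet_self hP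
  filter_upwards [hκ.continuousAt.preimage_mem_nhds (BSOm.isOpen_posSet.mem_nhds hκ0),
    hc.preimage_mem_nhds (BSOm.isOpen_posSet.mem_nhds hκ1)] with y hy hy'
  have hy : κ (y.1, y.2) ∈ BSOm.posSet P := hy
  change κ (y.1, y.2) = _
  rw [hF] at hy ⊢
  change BSOm.mk (Frame.ofIso (g y.1 y.2) (hinj y.1 y.2) (f y.2)) ∈ BSOm.posSet P at hy'
  rw [Frame.ofIso_comp (hinj y.1 y.2) (F y.1 y.2) (f y.2)] at hy' ⊢
  exact (BSOm.mk_comp (BSOm.det_pos_of_mem hy hy')).symm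

/-- The oriented subspaces spanned by a family of linear maps are continuous for any family, if they
are so for one family. -/
theorem continuous_class {κ : Z × X.carrier → BSOm m} (hκ : Continuous κ)
    {g : Z → ∀ x : X.carrier, (X.T x × U) →ₗ[ℝ] (ℕ → ℝ)} (hg : ContFamily g)
    (hinj : ∀ z x, Injective (g z x)) {F : ∀ (_ : Z) (x : X.carrier), (Fin m → ℝ) ≃ₗ[ℝ] (X.T x × U)}
    (hF : ∀ z x, κ (z, x) = BSOm.mk (Frame.ofIso (g z x) (hinj z x) (F z x)))
    {G : Z → ∀ x : X.carrier, (X.T x × U) →ₗ[ℝ] (ℕ → ℝ)} (hG : ContFamily G)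
    (hinj' : ∀ z x, Injective (G z x)) :
    Continuous fun y : Z × X.carrier =>
      BSOm.mk (Frame.ofIso (G y.1 y.2) (hinj' y.1 y.2) (F y.1 y.2)) := by
  rw [continuous_iff_continuousAt]
  rintro ⟨z₀, x₀⟩
  obtain ⟨f, N, hN, hf, h⟩ := exists_local_frame hκ hg hinj hF z₀ x₀
  have hc : ContinuousAt (fun y : Z × X.carrier =>
      BSOm.mk (Frame.ofIso (G y.1 y.2) (hinj' y.1 y.2) (f y.2))) (z₀, x₀) := by
    refine BSOm.continuous_mk.continuousAt.comp ?_
    refine (Topology.IsInducing.continuousAt_iff ⟨rfl⟩).2 ?_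
    refine continuousAt_pi.2 fun v => ?_
    have h1 : ContinuousAt (fun y : Z × X.carrier => (y.1,
        (((⟨y.2, (f y.2 v).1⟩ : TangentBundle X.model X.carrier),
          (f y.2 v).2) : TangentBundle X.model X.carrier × U))) (z₀, x₀) :=
      continuousAt_fst.prodMk (((hf v).continuousAt hN).comp (x := (z₀, x₀)) continuousAt_snd)
    exact hG.continuousAt.comp h1
  refine hc.congr ?_
  filter_upwards [h] with y hy
  change κ (y.1, y.2) = _ at hy
  rw [hF] at hy
  exact (Frame.mk_ofIso_congr _ _ hy).symm

end LocalFrames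

end

/-! ### Homotopies of tangential structures -/

noncomputable section

open scoped unitInterval

/-- The topology on frames is only that of pointwise convergence; joint continuity comes from
expanding the argument in the standard basis of `ℝ^m`. -/
theorem Frame.continuous_eval {m : ℕ} : Continuous fun p : Frame m × (Fin m → ℝ) => p.1.1 p.2 := by
  have h : ∀ p : Frame m × (Fin m → ℝ), p.1.1 p.2 = ∑ j, p.2 j • p.1.1 (Pi.single j 1) := fun p => by
    have h1 := p.1.1.pi_apply_eq_sum_univ p.2
    refine h1.trans (Finset.sum_congr rfl fun j _ => ?_)
    congr 2
    funext k
    simp [Pi.single_apply, eq_comm]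
  simp_rw [h]
  exact continuous_finsetSum _ fun j _ => ((_root_.continuous_apply j).comp continuous_snd).smul
    ((Frame.continuous_apply (Pi.single j 1)).comp continuous_fst)

namespace TangStr

variable {n : ℕ} {𝔅 : ConnectedCover n} {d e k : ℕ} {X : Mfd d} {Y : Mfd e}
  {U U' : Type} [AddCommGroup U] [Module ℝ U] [TopologicalSpace U]
  [AddCommGroup U'] [Module ℝ U'] [TopologicalSpace U'] {m : ℕ}

theorem ext_of_eq {s s' : TangStr 𝔅 X U m} (h : ∀ x, s.lift x = s'.lift x)
    (h' : ∀ x v, s.gauss x v = s'.gauss x v) : s = s' := by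
  have h1 : s.lift = s'.lift := ContinuousMap.ext h
  have h2 : s.gauss = s'.gauss := funext fun x => LinearMap.ext (h' x)
  cases s
  cases s'
  congr

/-- The oriented subspace of `ℝ^ℕ` at a point. -/
def cl (s : TangStr 𝔅 X U m) (x : X.carrier) : BSOm m := (s.lift x).1.2

/-- The point of `BO⟨n⟩` at a point. -/
def pt (s : TangStr 𝔅 X U m) (x : X.carrier) : 𝔅.B := (s.lift x).1.1

theorem continuous_cl (s : TangStr 𝔅 X U m) : Continuous s.cl :=
  continuous_snd.comp (continuous_subtype_val.comp s.lift.continuous)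

theorem continuous_pt (s : TangStr 𝔅 X U m) : Continuous s.pt :=
  continuous_fst.comp (continuous_subtype_val.comp s.lift.continuous)

theorem θ_pt (s : TangStr 𝔅 X U m) (x : X.carrier) : 𝔅.θ (s.pt x) = BSO.of (s.cl x) :=
  (s.lift x).2

theorem exists_frames (s : TangStr 𝔅 X U m) :
    ∃ F : ∀ x : X.carrier, (Fin m → ℝ) ≃ₗ[ℝ] (X.T x × U),
      ∀ x, s.cl x = BSOm.mk (Frame.ofIso (s.gauss x) (s.injective_gauss x) (F x)) := by
  choose F hF using s.lift_eq
  exact ⟨F, hF⟩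

theorem contFamily (s : TangStr 𝔅 X U m) {Z : Type*} [TopologicalSpace Z] :
    ContFamily fun _ : Z => s.gauss := s.continuous_gauss.comp continuous_snd

/-- Pulling back along a map of manifolds and an isomorphism of stabilised tangent bundles. -/
def pullback (s : TangStr 𝔅 X U m) (f : C(Y.carrier, X.carrier))
    (Λ : ∀ y, (Y.T y × U') ≃ₗ[ℝ] (X.T (f y) × U))
    (hΛ : Continuous fun p : TangentBundle Y.model Y.carrier × U' =>
      (((⟨f p.1.1, (Λ p.1.1 (p.1.2, p.2)).1⟩ : TangentBundle X.model X.carrier),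
        (Λ p.1.1 (p.1.2, p.2)).2) : TangentBundle X.model X.carrier × U)) :
    TangStr 𝔅 Y U' m where
  lift := s.lift.comp f
  gauss y := s.gauss (f y) ∘ₗ (Λ y).toLinearMap
  continuous_gauss := s.continuous_gauss.comp hΛ
  injective_gauss y := (s.injective_gauss _).comp (Λ y).injective
  lift_eq y := by
    obtain ⟨F, hF⟩ := s.lift_eq (f y)
    exact ⟨F.trans (Λ y).symm, hF.trans (congrArg BSOm.mk (Frame.ext_apply fun x => by simp))⟩

/-- The structure given by a framing, a frame `L` and a constant lift. -/
def ofFrame (q : 𝔅.Pull m) (L : Frame m) (hq : q.1.2 = BSOm.mk L)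
    (τ : ∀ x : X.carrier, (X.T x × U) ≃ₗ[ℝ] (Fin m → ℝ))
    (hτ : Continuous fun p : TangentBundle X.model X.carrier × U => τ p.1.1 (p.1.2, p.2)) :
    TangStr 𝔅 X U m where
  lift := ContinuousMap.const _ q
  gauss x := L.1 ∘ₗ (τ x).toLinearMap
  continuous_gauss := L.1.continuous_of_finiteDimensional.comp hτ
  injective_gauss x := L.2.comp (τ x).injective
  lift_eq x := ⟨(τ x).symm, hq.trans (congrArg BSOm.mk (Frame.ext_apply fun y => by simp))⟩

/-- The relation of homotopy of structures. -/
def Homotopic (s s' : TangStr 𝔅 X U m) : Prop :=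
  ∃ h : I → TangStr 𝔅 X U m, IsHomotopy h ∧ h 0 = s ∧ h 1 = s'

theorem Homotopic.symm {s s' : TangStr 𝔅 X U m} (h : Homotopic s s') : Homotopic s' s := by
  obtain ⟨h, ⟨h1, h2⟩, h0, h1'⟩ := h
  have hs : Continuous unitInterval.symm := unitInterval.continuous_symm
  refine ⟨fun t => h (unitInterval.symm t), ⟨?_, ?_⟩, by simpa using h1', by simpa using h0⟩
  · exact h1.comp ((hs.comp continuous_fst).prodMk continuous_snd)
  · exact h2.comp ((hs.comp continuous_fst).prodMk continuous_snd)

theorem Homotopic.trans {s s' s'' : TangStr 𝔅 X U m} (h : Homotopic s s')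
    (h' : Homotopic s' s'') : Homotopic s s'' := by
  obtain ⟨h, ⟨h1, h2⟩, h0, h1'⟩ := h
  obtain ⟨k, ⟨k1, k2⟩, k0, k1'⟩ := h'
  have hc := continuous_clampI
  let a : I → I := fun t => clampI (2 * (t : ℝ))
  let b : I → I := fun t => clampI (2 * (t : ℝ) - 1)
  have ha : Continuous a := by fun_prop
  have hb : Continuous b := by fun_prop
  have hab : ∀ t : I, (t : ℝ) = 1 / 2 → h (a t) = k (b t) := fun t ht => by
    have h3 : a t = 1 := by simp [a, ht]
    have h4 : b t = 0 := by simp [b, ht]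
    rw [h3, h4, h1', k0]
  refine ⟨fun t => if (t : ℝ) ≤ 1 / 2 then h (a t) else k (b t), ⟨?_, ?_⟩, ?_, ?_⟩
  · have h5 : Continuous fun p : I × X.carrier =>
        if (p.1 : ℝ) ≤ 1 / 2 then (h (a p.1)).lift p.2 else (k (b p.1)).lift p.2 :=
      Continuous.if_le (h1.comp ((ha.comp continuous_fst).prodMk continuous_snd))
        (k1.comp ((hb.comp continuous_fst).prodMk continuous_snd)) (by fun_prop) continuous_const
        fun p hp => by rw [hab _ hp]
    refine h5.congr fun p => ?_
    by_cases hp : (p.1 : ℝ) ≤ 1 / 2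
    · simp only [if_pos hp]
    · simp only [if_neg hp]
  · have h5 : Continuous fun p : I × (TangentBundle X.model X.carrier × U) =>
        if (p.1 : ℝ) ≤ 1 / 2 then (h (a p.1)).gauss p.2.1.1 (p.2.1.2, p.2.2)
          else (k (b p.1)).gauss p.2.1.1 (p.2.1.2, p.2.2) :=
      Continuous.if_le (h2.comp ((ha.comp continuous_fst).prodMk continuous_snd))
        (k2.comp ((hb.comp continuous_fst).prodMk continuous_snd)) (by fun_prop) continuous_const
        fun p hp => by rw [hab _ hp]
    refine h5.congr fun p => ?_
    by_cases hp : (p.1 : ℝ) ≤ 1 / 2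
    · simp only [if_pos hp]
    · simp only [if_neg hp]
  · simp [a, h0]
  · have : ¬ (1 : ℝ) ≤ 1 / 2 := by norm_num
    have h6 : b 1 = 1 := by
      change clampI (2 * (1 : ℝ) - 1) = 1
      norm_num
    simp only [Set.Icc.coe_one, if_neg this, h6, k1']

theorem isHomotopy_ofFrame {q : I → 𝔅.Pull m} (hq : Continuous q) {L : I → Frame m}
    (hL : Continuous L) (h : ∀ t, (q t).1.2 = BSOm.mk (L t))
    {τ : I → ∀ x : X.carrier, (X.T x × U) ≃ₗ[ℝ] (Fin m → ℝ)}
    (hτ : ∀ t, Continuous fun p : TangentBundle X.model X.carrier × U => τ t p.1.1 (p.1.2, p.2))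
    (hτ' : Continuous fun z : I × (TangentBundle X.model X.carrier × U) =>
      τ z.1 z.2.1.1 (z.2.1.2, z.2.2)) :
    IsHomotopy fun t => TangStr.ofFrame (𝔅 := 𝔅) (q t) (L t) (h t) (τ t) (hτ t) :=
  ⟨hq.comp continuous_fst, Frame.continuous_eval.comp ((hL.comp continuous_fst).prodMk hτ')⟩

/-- A structure can be deformed along a family of Gauss maps. -/
theorem exists_homotopy (c : CubRetract X.carrier) (s : TangStr 𝔅 X U m)
    {G : I → ∀ x : X.carrier, (X.T x × U) →ₗ[ℝ] (ℕ → ℝ)} (hG : ContFamily G)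
    (hinj : ∀ t x, Injective (G t x)) (h0 : G 0 = s.gauss) :
    ∃ h : I → TangStr 𝔅 X U m, IsHomotopy h ∧ h 0 = s ∧ (∀ t, (h t).gauss = G t) ∧
      ∀ t x (F : (Fin m → ℝ) ≃ₗ[ℝ] (X.T x × U)),
        s.cl x = BSOm.mk (Frame.ofIso (s.gauss x) (s.injective_gauss x) F) →
          (h t).cl x = BSOm.mk (Frame.ofIso (G t x) (hinj t x) F) := by
  obtain ⟨F, hF⟩ := s.exists_frames
  have hκ := continuous_class (Z := I) (κ := fun z => s.cl z.2) (s.continuous_cl.comp continuous_snd)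
    s.contFamily (fun _ => s.injective_gauss) (F := fun _ => F) (fun _ => hF) hG hinj
  set κ : I × X.carrier → BSOm m := fun y => BSOm.mk (Frame.ofIso (G y.1 y.2) (hinj y.1 y.2) (F y.2))
    with hκdef
  have hκ0 : ∀ x, κ (0, x) = s.cl x := fun x => by
    rw [hF]
    simp only [hκdef, h0]
  -- The new Gauss maps with the orientations transported by `F` give a homotopy of classifying maps
  -- to `BSO`; homotopy lifting supplies the points of `BO⟨n⟩`.
  obtain ⟨v, hv, hv0, hvu⟩ := c.lift_homotopy 𝔅.serre (u := fun z => BSO.of (κ (z.2, z.1)))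
    (BSO.continuous_of.comp (hκ.comp (by fun_prop))) (a := s.pt) s.continuous_pt
    (fun x => (s.θ_pt x).trans (congrArg BSO.of (hκ0 x).symm))
  have hl : Continuous fun y : I × X.carrier =>
      (⟨(v (y.2, y.1), κ y), hvu (y.2, y.1)⟩ : 𝔅.Pull m) :=
    Continuous.subtype_mk ((hv.comp (by fun_prop)).prodMk hκ) _
  let h : I → TangStr 𝔅 X U m := fun t =>
    { lift := ⟨fun x => ⟨(v (x, t), κ (t, x)), hvu (x, t)⟩, hl.comp (by fun_prop :
        Continuous fun x : X.carrier => (t, x))⟩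
      gauss := G t
      continuous_gauss := hG.comp (by fun_prop : Continuous fun p :
        TangentBundle X.model X.carrier × U => (t, p))
      injective_gauss := hinj t
      lift_eq := fun x => ⟨F x, rfl⟩ }
  refine ⟨h, ⟨hl, hG⟩, ext_of_eq (fun x => ?_) (fun x v => ?_), fun t => rfl,
    fun t x F' hF' => Frame.mk_ofIso_congr (s.injective_gauss x) _ ((hF x).symm.trans hF')⟩
  · exact Subtype.ext (Prod.ext (hv0 x) (hκ0 x))
  · exact congrArg (fun g => g x v) h0

/-- Structures with the same Gauss map and the same orientation, whose lifts are fibrewise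
homotopic, are homotopic. -/
theorem homotopic_of_fibrewise {s s' : TangStr 𝔅 X U m} (hg : s.gauss = s'.gauss)
    (hcl : s.cl = s'.cl) {H : X.carrier × I → 𝔅.B} (hH : Continuous H)
    (hHθ : ∀ x t, 𝔅.θ (H (x, t)) = 𝔅.θ (s.pt x)) (hH0 : ∀ x, H (x, 0) = s.pt x)
    (hH1 : ∀ x, H (x, 1) = s'.pt x) : Homotopic s s' := by
  have hl : Continuous fun y : I × X.carrier =>
      (⟨(H (y.2, y.1), s.cl y.2), (hHθ _ _).trans (s.θ_pt _)⟩ : 𝔅.Pull m) :=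
    Continuous.subtype_mk ((hH.comp (by fun_prop)).prodMk (s.continuous_cl.comp continuous_snd)) _
  let h : I → TangStr 𝔅 X U m := fun t =>
    { s with
      lift := ⟨fun x => ⟨(H (x, t), s.cl x), (hHθ _ _).trans (s.θ_pt _)⟩, hl.comp (by fun_prop :
        Continuous fun x : X.carrier => (t, x))⟩ }
  refine ⟨h, ⟨hl, s.continuous_gauss.comp continuous_snd⟩, ext_of_eq (fun x => ?_) fun x v => rfl,
    ext_of_eq (fun x => ?_) fun x v => ?_⟩
  · exact Subtype.ext (Prod.ext (hH0 x) rfl)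
  · exact Subtype.ext (Prod.ext (hH1 x) (congrFun hcl x))
  · exact congrArg (fun g => g x v) hg

end TangStr

end

/-! ### Diffeomorphic closed manifolds are bordant -/

noncomputable section

namespace TangStr

variable {n : ℕ} {𝔅 : ConnectedCover n} {d c m : ℕ} {X Y : Mfd d}
  {U : Type} [AddCommGroup U] [Module ℝ U] [TopologicalSpace U]

/-- The isomorphism of stabilised tangent bundles induced by a diffeomorphism. -/
def diffeoIso (U : Type) [AddCommGroup U] [Module ℝ U]
    (g : Diffeomorph X.model Y.model X.carrier Y.carrier ∞) (x : X.carrier) :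
    (X.T x × U) ≃ₗ[ℝ] (Y.T (g x) × U) :=
  (g.mfderivToContinuousLinearEquiv (by simp) x).toLinearEquiv.prodCongr (LinearEquiv.refl ℝ U)

theorem diffeoIso_apply {U : Type} [AddCommGroup U] [Module ℝ U]
    (g : Diffeomorph X.model Y.model X.carrier Y.carrier ∞) (x : X.carrier)
    (v : X.T x) (u : U) : diffeoIso U g x (v, u) = (mfderiv X.model Y.model g x v, u) :=
  Prod.ext (congrArg (fun A => A v) (g.mfderivToContinuousLinearEquiv_coe (by simp))) rfl

theorem continuous_diffeoIso (g : Diffeomorph X.model Y.model X.carrier Y.carrier ∞) :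
    Continuous fun p : TangentBundle X.model X.carrier × U =>
      (((⟨g p.1.1, (diffeoIso U g p.1.1 (p.1.2, p.2)).1⟩ : TangentBundle Y.model Y.carrier),
        (diffeoIso U g p.1.1 (p.1.2, p.2)).2) : TangentBundle Y.model Y.carrier × U) := by
  have h := (g.contMDiff.continuous_tangentMap (by simp)).comp
    (continuous_fst : Continuous (Prod.fst : TangentBundle X.model X.carrier × U → _))
  refine (h.prodMk continuous_snd).congr fun p => ?_
  exact congrArg (fun q : Y.T (g p.1.1) × U => ((⟨g p.1.1, q.1⟩, q.2) :
    TangentBundle Y.model Y.carrier × U)) (diffeoIso_apply g p.1.1 p.1.2 p.2).symm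

/-- Pulling back along a diffeomorphism. -/
def pullbackDiffeo (g : Diffeomorph X.model Y.model X.carrier Y.carrier ∞)
    (s : TangStr 𝔅 Y U m) : TangStr 𝔅 X U m :=
  s.pullback ⟨g, g.continuous⟩ (diffeoIso U g) (continuous_diffeoIso g)

theorem pullbackDiffeo_gauss (g : Diffeomorph X.model Y.model X.carrier Y.carrier ∞)
    (s : TangStr 𝔅 Y U m) (x : X.carrier) (v : X.T x) (u : U) :
    (s.pullbackDiffeo g).gauss x (v, u) = s.gauss (g x) (mfderiv X.model Y.model g x v, u) :=
  congrArg (s.gauss (g x)) (diffeoIso_apply g x v u)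

/-- The structure on `Y × ℝ` that is constant in the direction of `ℝ`. -/
def cylinder (s : TangStr 𝔅 Y (ℝ × (Fin c → ℝ)) m) :
    TangStr 𝔅 (Mfd.prod rfl Y Mfd.line) (Fin c → ℝ) m where
  lift := s.lift.comp ⟨Prod.fst, continuous_fst⟩
  gauss z := s.gauss z.1 ∘ₗ (LinearEquiv.prodAssoc ℝ (Y.T z.1) ℝ (Fin c → ℝ)).toLinearMap
  continuous_gauss := by
    have h1 : Continuous fun p : TangentBundle (Mfd.prod rfl Y Mfd.line).model
          (Mfd.prod rfl Y Mfd.line).carrier =>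
        ((⟨p.1.1, p.2.1⟩, ⟨p.1.2, p.2.2⟩) :
          TangentBundle Y.model Y.carrier × TangentBundle 𝓘(ℝ, ℝ) ℝ) :=
      (contMDiff_equivTangentBundleProd (I := Y.model) (I' := 𝓘(ℝ, ℝ)) (M := Y.carrier)
        (M' := ℝ) (n := 0)).continuous
    have h2 : Continuous fun p : TangentBundle 𝓘(ℝ, ℝ) ℝ => ((p.1, p.2) : ℝ × ℝ) :=
      (tangentBundleModelSpaceHomeomorph 𝓘(ℝ, ℝ)).continuous
    exact s.continuous_gauss.comp (((continuous_fst.comp h1).comp continuous_fst).prodMk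
      (((continuous_snd.comp h2).comp
        ((continuous_snd.comp h1).comp continuous_fst)).prodMk continuous_snd))
  injective_gauss z := (s.injective_gauss z.1).comp (LinearEquiv.injective _)
  lift_eq z := by
    obtain ⟨F, hF⟩ := s.lift_eq z.1
    refine ⟨F.trans (LinearEquiv.prodAssoc ℝ (Y.T z.1) ℝ (Fin c → ℝ)).symm, ?_⟩
    exact hF.trans (congrArg BSOm.mk (Frame.ext_apply fun x => rfl))

/-- The slice at height `r` may be parametrised by any diffeomorphism `g`, with the unit vector
along `ℝ` as `ν`. So one cylinder over `Y` can have differently parametrised ends. -/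
theorem isLevel_cylinder [CompactSpace X.carrier]
    (g : Diffeomorph X.model Y.model X.carrier Y.carrier ∞)
    (s : TangStr 𝔅 Y (ℝ × (Fin c → ℝ)) (rk d c)) (s' : TangStr 𝔅 X (ℝ × (Fin c → ℝ)) (rk d c))
    (hl : ∀ x, s'.lift x = s.lift (g x))
    (hg : ∀ x (v : X.T x) u, s'.gauss x (v, u) = s.gauss (g x) (mfderiv X.model Y.model g x v, u))
    (r : ℝ) : IsLevel s.cylinder (fun z => z.2) r ⟨X, s'⟩ := by
  refine ⟨fun x => (g x, r), fun x => (0, (1 : ℝ)), g.contMDiff.prodMk contMDiff_const,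
    fun x y hxy => g.injective (congrArg Prod.fst hxy), ?_, fun x => ⟨?_, ?_, ?_⟩⟩
  · ext z
    constructor
    · rintro ⟨x, rfl⟩
      rfl
    · intro hz
      exact ⟨g.symm z.1, Prod.ext (g.apply_symm_apply z.1) hz.symm⟩
  · have h1 := mfderiv_snd (I := Y.model) (I' := 𝓘(ℝ, ℝ)) (M := Y.carrier) (M' := ℝ)
      (x := (g x, r))
    have h2 := congrArg (fun A => A (0, 1)) h1
    exact lt_of_lt_of_eq zero_lt_one h2.symm
  · exact (hl x).symm
  · intro v a u
    have h1 : HasMFDerivAt X.model (Y.model.prod 𝓘(ℝ, ℝ)) (fun x : X.carrier => (g x, r)) x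
        ((mfderiv X.model Y.model g x).prod 0) :=
      ((g.contMDiff.mdifferentiableAt (by simp)).hasMFDerivAt).prodMk (hasMFDerivAt_const _ x)
    have h2 : (mfderiv X.model (Y.model.prod 𝓘(ℝ, ℝ)) (fun x : X.carrier => (g x, r)) x v
        + a • (0, 1) : Y.T (g x) × ℝ) = (mfderiv X.model Y.model g x v, a) := by
      rw [h1.mfderiv]
      refine Prod.ext ?_ ?_
      · exact (congrArg (fun b => mfderiv X.model Y.model g x v + b) (smul_zero a)).trans
          (add_zero _)
      · exact (zero_add (a * 1)).trans (mul_one a)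
    refine Eq.trans ?_ (congrArg (fun b => s.cylinder.gauss (g x, r) (b, u)) h2.symm)
    exact hg x v (a, u)

end TangStr

namespace ClosedStr

variable {n : ℕ} {𝔅 : ConnectedCover n} {d c : ℕ} {X Y : Mfd d} [CompactSpace X.carrier]
  [CompactSpace Y.carrier]

/-- Diffeomorphic closed `⟨n⟩`-manifolds are bordant. -/
theorem mk_pullbackDiffeo (g : Diffeomorph X.model Y.model X.carrier Y.carrier ∞)
    (s : TangStr 𝔅 Y (ℝ × (Fin c → ℝ)) (rk d c)) :
    Omega.mk (⟨X, s.pullbackDiffeo g⟩ : ClosedStr 𝔅 d c) = Omega.mk ⟨Y, s⟩ := by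
  -- The end at `0` is parametrised by `g`, the end at `1` by the identity.
  refine Quot.sound ⟨⟨_, s.cylinder, fun z => z.2, contMDiff_snd, ?_,
    TangStr.isLevel_cylinder g s _ (fun _ => rfl) (s.pullbackDiffeo_gauss g) 0,
    TangStr.isLevel_cylinder (Diffeomorph.refl _ _ _) s _ (fun _ => rfl) (fun x v u => ?_) 1⟩⟩
  · have := (isCompact_univ (X := Y.carrier)).prod (isCompact_Icc (a := (0 : ℝ)) (b := 1))
    convert this using 1
    ext z
    simp
  · have h := congrArg (fun A => A v) (mfderiv_id (I := Y.model) (x := x))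
    exact congrArg (fun w => s.gauss x (w, u)) h.symm

theorem mk_eq_of_homotopic {s s' : TangStr 𝔅 X (ℝ × (Fin c → ℝ)) (rk d c)}
    (h : TangStr.Homotopic s s') : Omega.mk (⟨X, s⟩ : ClosedStr 𝔅 d c) = Omega.mk ⟨X, s'⟩ := by
  obtain ⟨h, hh, rfl, rfl⟩ := h
  exact mk_eq_of_isHomotopy h hh

end ClosedStr

end

/-! ### Structures on products with a sphere -/

noncomputable section

open scoped unitInterval

namespace TangStr

variable {n : ℕ} {𝔅 : ConnectedCover n} {d e m : ℕ} {X : Mfd d} {S : Mfd e}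
  {U U' : Type} [AddCommGroup U] [Module ℝ U] [TopologicalSpace U]
  [AddCommGroup U'] [Module ℝ U'] [TopologicalSpace U']

theorem sameImage_cl {s s' : TangStr 𝔅 X U m} (h : s.gauss = s'.gauss) (x : X.carrier) :
    BSOm.SameImage (s.cl x) (s'.cl x) := by
  obtain ⟨F, hF⟩ := s.exists_frames
  obtain ⟨F', hF'⟩ := s'.exists_frames
  have h1 : Frame.ofIso (s'.gauss x) (s'.injective_gauss x) (F' x) =
      Frame.ofIso (s.gauss x) (s.injective_gauss x) (F' x) :=
    Frame.ext_apply fun v => congrArg (fun g => g x (F' x v)) h.symm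
  rw [hF, hF', h1]
  exact Frame.sameImage_ofIso _ _ _

/-- Deformation of a structure to any prescribed Gauss map. -/
theorem exists_homotopy_blend (c : CubRetract X.carrier) (s : TangStr 𝔅 X U m)
    {γ : ∀ x : X.carrier, (X.T x × U) →ₗ[ℝ] (ℕ → ℝ)}
    (hγ : Continuous fun p : TangentBundle X.model X.carrier × U => γ p.1.1 (p.1.2, p.2))
    (hinj : ∀ x, Injective (γ x)) :
    ∃ h : I → TangStr 𝔅 X U m, IsHomotopy h ∧ h 0 = s ∧ (h 1).gauss = γ ∧
      ∀ (t : I) x (F : (Fin m → ℝ) ≃ₗ[ℝ] (X.T x × U)),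
        s.cl x = BSOm.mk (Frame.ofIso (s.gauss x) (s.injective_gauss x) F) →
          (h t).cl x = BSOm.mk (Frame.ofIso (blend t (s.gauss x) (γ x))
            (blend_injective t (s.injective_gauss x) (hinj x)) F) := by
  obtain ⟨h, h1, h2, h3, h4⟩ := s.exists_homotopy c
    (G := fun t x => blend t (s.gauss x) (γ x))
    (continuous_blend (r := fun z : I × (TangentBundle X.model X.carrier × U) => (z.1 : ℝ))
      (V := fun z => X.T z.2.1.1 × U) (v := fun z => (z.2.1.2, z.2.2)) (by fun_prop)
      (s.continuous_gauss.comp continuous_snd) (hγ.comp continuous_snd))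
    (fun t x => blend_injective t (s.injective_gauss x) (hinj x))
    (funext fun x => blend_zero _ _)
  exact ⟨h, h1, h2, (h3 1).trans (funext fun x => blend_one _ _), h4⟩

/-- Two structures on `X ≅ S × M` are homotopic if their restrictions to `S` are, provided that `M`
is `(n - 1)`-connected. -/
theorem homotopic_of_pullback (cX : CubRetract X.carrier) [PreconnectedSpace X.carrier]
    (cS : CubRetract S.carrier) {M : Type} [TopologicalSpace M] (cM : CubRetract M) {m₀ : M}
    (hM : ∀ m : M, Joined m m₀) (hM' : ∀ k < n, Subsingleton (HomotopyGroup.Pi k M m₀))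
    {f : C(S.carrier, X.carrier)} {Λ : ∀ y, (S.T y × U') ≃ₗ[ℝ] (X.T (f y) × U)}
    (hΛ : Continuous fun p : TangentBundle S.model S.carrier × U' =>
      (((⟨f p.1.1, (Λ p.1.1 (p.1.2, p.2)).1⟩ : TangentBundle X.model X.carrier),
        (Λ p.1.1 (p.1.2, p.2)).2) : TangentBundle X.model X.carrier × U))
    (φ : X.carrier ≃ₜ S.carrier × M) (hφ : ∀ y, φ (f y) = (y, m₀)) (y₀ : S.carrier)
    {s s' : TangStr 𝔅 X U m} (hs : Homotopic (s.pullback f Λ hΛ) (s'.pullback f Λ hΛ)) :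
    Homotopic s s' := by
  obtain ⟨k, hk, hk0, hk1⟩ := hs
  -- Both structures are deformed by `blend` to this common Gauss map. For `s'` the deformation is
  -- in general not constant, but using one formula for both makes them restrict to the two sides of
  -- a deformation of the homotopy `k` on `S`.
  let γ := s'.gauss
  have hγ := s'.continuous_gauss
  have hγi := s'.injective_gauss
  obtain ⟨h, hh, h0, h1, hF⟩ := s.exists_homotopy_blend cX hγ hγi
  obtain ⟨h', hh', h0', h1', hF'⟩ := s'.exists_homotopy_blend cX hγ hγi
  choose F hkF using fun t => (k t).exists_frames
  -- the Gauss maps over the square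
  let g : I × I → ∀ y : S.carrier, (S.T y × U') →ₗ[ℝ] (ℕ → ℝ) := fun z => (k z.1).gauss
  let G : I × I → ∀ y : S.carrier, (S.T y × U') →ₗ[ℝ] (ℕ → ℝ) := fun z y =>
    blend z.2 ((k z.1).gauss y) (γ (f y) ∘ₗ (Λ y).toLinearMap)
  have hγΛ : ∀ y, Injective (γ (f y) ∘ₗ (Λ y).toLinearMap) := fun y =>
    (hγi (f y)).comp (Λ y).injective
  have hGi : ∀ z y, Injective (G z y) := fun z y =>
    blend_injective z.2 ((k z.1).injective_gauss y) (hγΛ y)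
  have hg : ContFamily g := hk.2.comp (by fun_prop : Continuous
    fun z : (I × I) × (TangentBundle S.model S.carrier × U') => (z.1.1, z.2))
  have hG : ContFamily G :=
    continuous_blend (r := fun z : (I × I) × (TangentBundle S.model S.carrier × U') => (z.1.2 : ℝ))
      (V := fun z => S.T z.2.1.1 × U') (v := fun z => (z.2.1.2, z.2.2)) (by fun_prop) hg
      ((hγ.comp hΛ).comp continuous_snd)
  have hκ : Continuous fun y : (I × I) × S.carrier =>
      BSOm.mk (Frame.ofIso (G y.1 y.2) (hGi y.1 y.2) (F y.1.1 y.2)) :=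
    continuous_class (Z := I × I) (κ := fun y => (k y.1.1).cl y.2) (m := m)
      (continuous_snd.comp (continuous_subtype_val.comp (hk.1.comp (by fun_prop : Continuous
        fun y : (I × I) × S.carrier => (y.1.1, y.2)))))
      hg (fun z y => (k z.1).injective_gauss y) (F := fun z => F z.1) (fun z y => hkF z.1 y) hG hGi
  let κ : (I × I) × S.carrier → BSOm m := fun y =>
    BSOm.mk (Frame.ofIso (G y.1 y.2) (hGi y.1 y.2) (F y.1.1 y.2))
  have hκ0 : ∀ t y, κ ((t, 0), y) = (k t).cl y := fun t y => by
    refine Eq.trans ?_ (hkF t y).symm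
    exact congrArg BSOm.mk (Frame.ext_apply fun v => congrArg (fun A => A (F t y v))
      (blend_zero ((k t).gauss y) _))
  -- On the sides `j = 0, 1` of the square, the class of the deformed `k` is that of the deformation
  -- of `s` or `s'` along `f`. An isomorphism `F` transported through `Λ` represents the orientation
  -- on `X`.
  have hside : ∀ (j : I) (τ : TangStr 𝔅 X U m) (η : I → TangStr 𝔅 X U m)
      (_ : k j = τ.pullback f Λ hΛ)
      (_ : ∀ (t : I) x (F : (Fin m → ℝ) ≃ₗ[ℝ] (X.T x × U)),
        τ.cl x = BSOm.mk (Frame.ofIso (τ.gauss x) (τ.injective_gauss x) F) →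
          (η t).cl x = BSOm.mk (Frame.ofIso (blend t (τ.gauss x) (γ x))
            (blend_injective t (τ.injective_gauss x) (hγi x)) F)) (r : I) (y : S.carrier),
      κ ((j, r), y) = (η r).cl (f y) := by
    intro j τ η hj hη r y
    have e1 : ∀ v, (k j).gauss y v = τ.gauss (f y) (Λ y v) := fun v => by rw [hj]; rfl
    have e2 : (k j).cl y = τ.cl (f y) := by rw [hj]; rfl
    refine Eq.trans ?_ (hη r (f y) ((F j y).trans (Λ y)) ?_).symm
    · refine congrArg BSOm.mk (Frame.ext_apply fun v => ?_)
      have e3 : (k j).gauss y = τ.gauss (f y) ∘ₗ (Λ y).toLinearMap := LinearMap.ext e1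
      exact congrArg (fun A => blend r A (γ (f y) ∘ₗ (Λ y).toLinearMap) (F j y v)) e3
    · refine e2.symm.trans ((hkF j y).trans (congrArg BSOm.mk (Frame.ext_apply fun v => ?_)))
      exact e1 _
  have hκl := hside 0 s h hk0 hF
  have hκr := hside 1 s' h' hk1 hF'
  have hpt : ∀ {η : I → TangStr 𝔅 X U m}, IsHomotopy η →
      Continuous fun z : S.carrier × I => (η z.2).pt (f z.1) := fun hη =>
    continuous_fst.comp (continuous_subtype_val.comp (hη.1.comp (by fun_prop : Continuous
      fun z : S.carrier × I => (z.2, f z.1))))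
  -- Three edges are prescribed: `k`, and the restrictions of `h` and `h'`. The fourth edge joins
  -- the restrictions of `h 1` and `h' 1`, and by `hconst` it does so fibrewise.
  obtain ⟨v, hv, hvu, hva, hv0, hv1⟩ := cS.lift_square 𝔅.serre
    (u := fun z => BSO.of (κ ((z.2.1, z.2.2), z.1)))
    (BSO.continuous_of.comp (hκ.comp (by fun_prop : Continuous
      fun z : S.carrier × I × I => ((z.2.1, z.2.2), z.1))))
    (a := fun z => (k z.2).pt z.1) (a₀ := fun z => (h z.2).pt (f z.1))
    (a₁ := fun z => (h' z.2).pt (f z.1))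
    (continuous_fst.comp (continuous_subtype_val.comp (hk.1.comp (by fun_prop : Continuous
      fun z : S.carrier × I => (z.2, z.1))))) (hpt hh) (hpt hh')
    (fun y t => ((k t).θ_pt y).trans (congrArg BSO.of (hκ0 t y).symm))
    (fun y r => ((h r).θ_pt (f y)).trans (congrArg BSO.of (hκl r y).symm))
    (fun y r => ((h' r).θ_pt (f y)).trans (congrArg BSO.of (hκr r y).symm))
    (fun y => by simp only [hk0, h0]; rfl) (fun y => by simp only [hk1, h0']; rfl)
  -- the classes at the end of the deformation
  have hconst : ∀ y t, κ ((t, 1), y) = κ ((0, 1), y) := fun y t => by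
    have e1 : ∀ t, κ ((t, 1), y) = BSOm.mk (Frame.ofIso (γ (f y) ∘ₗ (Λ y).toLinearMap)
        (hγΛ y) (F t y)) := fun t =>
      congrArg BSOm.mk (Frame.ext_apply fun v => congrArg (fun A => A (F t y v))
        (blend_one ((k t).gauss y) _))
    refine BSOm.eq_of_sameImage (Y := I) (κ := fun t => κ ((t, 1), y))
      (κ' := fun _ => κ ((0, 1), y)) (hκ.comp (by fun_prop : Continuous
        fun t : I => (((t, 1), y) : (I × I) × S.carrier))) continuous_const (fun t => ?_)
      (y₀ := 0) rfl t
    simp only [e1]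
    exact Frame.sameImage_ofIso _ _ _
  have hgauss : (h 1).gauss = (h' 1).gauss := h1.trans h1'.symm
  -- With equal Gauss maps only the orientations could differ. They agree at the point `f y₀`, being
  -- connected there through the fourth edge, hence everywhere on the connected space `X`.
  have hcl : (h 1).cl = (h' 1).cl := funext fun x =>
    BSOm.eq_of_sameImage (h 1).continuous_cl (h' 1).continuous_cl (sameImage_cl hgauss)
      (y₀ := f y₀) ((hκl 1 y₀).symm.trans ((hconst y₀ 1).symm.trans (hκr 1 y₀))) x
  have hφs : ∀ y, φ.symm (y, m₀) = f y := fun y => by rw [← hφ, φ.symm_apply_apply]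
  obtain ⟨H, hH, hHp, hH0, hH1⟩ := CubRetract.lift_unique cS cM 𝔅.serre 𝔅.θ.continuous
    (fun k hk => 𝔅.hasLift_boxBd hk) hM hM' (l := fun z => (h 1).pt (φ.symm z))
    (l' := fun z => (h' 1).pt (φ.symm z)) ((h 1).continuous_pt.comp φ.symm.continuous)
    ((h' 1).continuous_pt.comp φ.symm.continuous)
    (fun z => by rw [θ_pt, θ_pt, hcl]) (H := fun z => v (z.1, z.2, 1)) (by fun_prop)
    (fun y t => by
      rw [hvu, θ_pt, hφs, ← hκl 1 y]
      exact congrArg BSO.of (hconst y t))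
    (fun y => by rw [hv0, hφs]) (fun y => by rw [hv1, hφs])
  have hend : Homotopic (h 1) (h' 1) := homotopic_of_fibrewise hgauss hcl
    (H := fun z => H (φ z.1, z.2)) (by fun_prop)
    (fun x t => (hHp _ _).trans (by rw [φ.symm_apply_apply]))
    (fun x => (hH0 _).trans (by rw [φ.symm_apply_apply]))
    (fun x => (hH1 _).trans (by rw [φ.symm_apply_apply]))
  have e1 : Homotopic s (h 1) := ⟨h, hh, h0, rfl⟩
  have e2 : Homotopic s' (h' 1) := ⟨h', hh', h0', rfl⟩
  exact (e1.trans hend).trans e2.symm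

end TangStr

end

/-! ### Uniqueness of the structure on the total space -/

noncomputable section

namespace DiscBundle

variable {n : ℕ} {𝔅 : ConnectedCover n} {d i c : ℕ} {M : Mfd d}
  {e : EuclideanSpace ℝ (Fin d) → M.carrier} (E : DiscBundle M e i)

/-- The centres of the discs. -/
def core : C((Mfd.sphere i).carrier, E.tot.carrier) :=
  ⟨fun x => E.disc (x, 0), E.embedding.smooth.continuous.comp (Continuous.prodMk_left 0)⟩

/-- The normal framing of the centres of the discs. -/
def coreIso (U : Type) [AddCommGroup U] [Module ℝ U] (x : (Mfd.sphere i).carrier) :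
    ((Mfd.sphere i).T x × (EuclideanSpace ℝ (Fin d) × U)) ≃ₗ[ℝ] (E.tot.T (E.core x) × U) :=
  (LinearEquiv.prodAssoc ℝ ((Mfd.sphere i).T x) (EuclideanSpace ℝ (Fin d)) U).symm.trans
    ((LinearEquiv.ofBijective
      (mfderiv ((𝓡 i).prod (𝓡 d)) E.tot.model E.disc (x, 0)).toLinearMap
      (E.embedding.bijective (x, 0))).prodCongr (LinearEquiv.refl ℝ U))

theorem continuous_coreIso (U : Type) [AddCommGroup U] [Module ℝ U] [TopologicalSpace U] :
    Continuous fun p : TangentBundle (𝓡 i) (Mfd.sphere i).carrier ×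
        (EuclideanSpace ℝ (Fin d) × U) =>
      (((⟨E.core p.1.1, (E.coreIso U p.1.1 (p.1.2, p.2)).1⟩ :
        TangentBundle E.tot.model E.tot.carrier),
        (E.coreIso U p.1.1 (p.1.2, p.2)).2) : TangentBundle E.tot.model E.tot.carrier × U) := by
  have h1 : Continuous fun p : TangentBundle (𝓡 i) (Mfd.sphere i).carrier ×
      EuclideanSpace ℝ (Fin d) => (⟨(p.1.1, 0), (p.1.2, p.2)⟩ : TangentBundle ((𝓡 i).prod (𝓡 d))
        ((Mfd.sphere i).carrier × EuclideanSpace ℝ (Fin d))) := by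
    have h2 : Continuous fun w : EuclideanSpace ℝ (Fin d) =>
        (⟨0, w⟩ : TangentBundle (𝓡 d) (EuclideanSpace ℝ (Fin d))) :=
      (tangentBundleModelSpaceHomeomorph (𝓡 d)).symm.continuous.comp (Continuous.prodMk_right 0)
    exact (contMDiff_equivTangentBundleProd_symm (I := 𝓡 i) (I' := 𝓡 d)
      (M := (Mfd.sphere i).carrier) (M' := EuclideanSpace ℝ (Fin d)) (n := 0)).continuous.comp
        (continuous_fst.prodMk (h2.comp continuous_snd))
  have h3 := (E.embedding.smooth.continuous_tangentMap (by simp)).comp h1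
  have h4 : Continuous fun p : TangentBundle (𝓡 i) (Mfd.sphere i).carrier ×
      (EuclideanSpace ℝ (Fin d) × U) => p.2.2 := continuous_snd.comp continuous_snd
  exact (h3.comp (continuous_fst.prodMk (continuous_fst.comp continuous_snd))).prodMk h4

/-- The restriction of a structure to the centres of the discs. -/
def restrict {m : ℕ} (s : TangStr 𝔅 E.tot (ℝ × (Fin c → ℝ)) m) :
    TangStr 𝔅 (Mfd.sphere i) (EuclideanSpace ℝ (Fin d) × (ℝ × (Fin c → ℝ))) m :=
  s.pullback E.core (E.coreIso _) (E.continuous_coreIso _)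

theorem extendsStandard_iff (s : TangStr 𝔅 E.tot (ℝ × (Fin c → ℝ)) (rk (i + d) c)) :
    E.ExtendsStandard s ↔ TangStr.Homotopic (E.restrict s)
      (TangStr.ofFraming 𝔅 stdFraming (continuous_stdFraming i d c)) := by
  constructor
  · rintro ⟨h, hh, h0, h1⟩
    refine ⟨h, hh, TangStr.ext_of_eq (fun x => (h0 x).1) (fun x v => ?_), h1⟩
    exact (h0 x).2 v.1 v.2.1 v.2.2
  · rintro ⟨h, hh, h0, h1⟩
    refine ⟨h, hh, fun x => ?_, h1⟩
    rw [h0]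
    exact ⟨rfl, fun v w u => rfl⟩

/-- The bordism class of a structure extending the standard one is unique. -/
theorem ExtendsStandard.mk_eq {E : DiscBundle M e i} [CompactSpace M.carrier] (hn : 1 ≤ n)
    (hi : 1 ≤ i)
    (hM : ∀ k < n, ∀ x : M.carrier, Subsingleton (HomotopyGroup.Pi k M.carrier x))
    {m₀ : M.carrier} (g : E.tot.carrier ≃ₜ (Mfd.sphere i).carrier × M.carrier)
    (hg : ∀ x, g (E.disc (x, 0)) = (x, m₀))
    {s s' : TangStr 𝔅 E.tot (ℝ × (Fin c → ℝ)) (rk (i + d) c)}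
    (hs : E.ExtendsStandard s) (hs' : E.ExtendsStandard s') :
    Omega.mk (⟨E.tot, s⟩ : ClosedStr 𝔅 (i + d) c) = Omega.mk ⟨E.tot, s'⟩ := by
  have hJ : ∀ m : M.carrier, Joined m m₀ := fun m => joined_of_pi_zero (hM 0 (by omega)) m m₀
  have : Nonempty M.carrier := ⟨m₀⟩
  have : Nonempty (Mfd.sphere i).carrier := ⟨Mfd.basePt i⟩
  have : Nonempty E.tot.carrier := ⟨E.disc (Mfd.basePt i, 0)⟩
  have hMc : PathConnectedSpace M.carrier := ⟨⟨m₀⟩, fun x y => (hJ x).trans (hJ y).symm⟩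
  have hSc : PreconnectedSpace (Mfd.sphere i).carrier :=
    isPreconnected_iff_preconnectedSpace.1 (isPreconnected_sphere (by
      rw [← Module.finrank_eq_rank, finrank_euclideanSpace_fin]
      exact_mod_cast Nat.lt_succ_of_le hi) 0 1)
  have : PreconnectedSpace E.tot.carrier := g.symm.surjective.denseRange.preconnectedSpace
    g.symm.continuous
  obtain ⟨cX⟩ := E.tot.nonempty_cubRetract
  obtain ⟨cS⟩ := (Mfd.sphere i).nonempty_cubRetract
  obtain ⟨cM⟩ := M.nonempty_cubRetract
  refine ClosedStr.mk_eq_of_homotopic (TangStr.homotopic_of_pullback cX cS cM hJ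
    (fun k hk => hM k hk m₀) (E.continuous_coreIso _) g hg (Mfd.basePt i) ?_)
  exact ((E.extendsStandard_iff s).1 hs).trans ((E.extendsStandard_iff s').1 hs').symm

end DiscBundle

end

/-! ### Linear algebra of the twisted framing -/

noncomputable section

/-! ### Exchange of two even-dimensional summands. -/

section Swap

variable {W V V' B : Type*} [AddCommGroup W] [Module ℝ W] [FiniteDimensional ℝ W]
  [AddCommGroup V] [Module ℝ V] [FiniteDimensional ℝ V]
  [AddCommGroup V'] [Module ℝ V'] [FiniteDimensional ℝ V']
  [AddCommGroup B] [Module ℝ B] [FiniteDimensional ℝ B]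

/-- The exchange of two copies of an even-dimensional space preserves orientations. -/
theorem det_prodComm_pos (hW : Even (Module.finrank ℝ W)) :
    0 < LinearMap.det (LinearEquiv.prodComm ℝ W W).toLinearMap := by
  let T : (W × W) →ₗ[ℝ] (W × W) :=
    (LinearMap.fst ℝ W W - LinearMap.snd ℝ W W).prod (LinearMap.fst ℝ W W + LinearMap.snd ℝ W W)
  let D : (W × W) →ₗ[ℝ] (W × W) :=
    ((-1 / 2 : ℝ) • (LinearMap.id : W →ₗ[ℝ] W)).prodMap ((1 / 2 : ℝ) • LinearMap.id)
  -- `T²` maps `(x, y)` to `(-2y, 2x)`, and `D` corrects sign and scale. So the determinant is a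
  -- square times `(-1/2)^{dim W} (1/2)^{dim W}`, which is nonnegative for even `dim W`.
  have h1 : (LinearEquiv.prodComm ℝ W W).toLinearMap = D ∘ₗ (T ∘ₗ T) := by
    refine LinearMap.ext fun x => Prod.ext ?_ ?_
    · change x.2 = (-1 / 2 : ℝ) • ((x.1 - x.2) - (x.1 + x.2))
      module
    · change x.1 = (1 / 2 : ℝ) • ((x.1 - x.2) + (x.1 + x.2))
      module
  have h2 : 0 ≤ LinearMap.det (LinearEquiv.prodComm ℝ W W).toLinearMap := by
    rw [h1, LinearMap.det_comp, LinearMap.det_comp, LinearMap.det_prodMap, LinearMap.det_smul,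
      LinearMap.det_smul, LinearMap.det_id, mul_one, mul_one]
    exact mul_nonneg (mul_nonneg (hW.pow_nonneg _) (by positivity)) (mul_self_nonneg _)
  exact h2.lt_of_ne' (LinearEquiv.isUnit_det' _).ne_zero

/-- The exchange of the first two summands. -/
def swapMiddle (W B : Type*) [AddCommGroup W] [Module ℝ W] [AddCommGroup B] [Module ℝ B] :
    (W × (W × B)) ≃ₗ[ℝ] (W × (W × B)) :=
  (LinearEquiv.prodAssoc ℝ W W B).symm.trans
    (((LinearEquiv.prodComm ℝ W W).prodCongr (LinearEquiv.refl ℝ B)).trans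
      (LinearEquiv.prodAssoc ℝ W W B))

theorem det_swapMiddle_pos (hW : Even (Module.finrank ℝ W)) :
    0 < LinearMap.det (swapMiddle W B).toLinearMap := by
  have h := LinearMap.det_conj ((LinearEquiv.prodComm ℝ W W).toLinearMap.prodMap
    (LinearMap.id : B →ₗ[ℝ] B)) (LinearEquiv.prodAssoc ℝ W W B)
  refine lt_of_lt_of_eq ?_ h.symm
  rw [LinearMap.det_prodMap, LinearMap.det_id, mul_one]
  exact det_prodComm_pos hW

end Swap

theorem splitFin_symm_apply {a b m : ℕ} (h : a + b = m) (p : (Fin a → ℝ) × (Fin b → ℝ))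
    (j : Fin m) : (splitFin h).symm p j =
      if hj : j.1 < a then p.1 ⟨j.1, hj⟩ else p.2 ⟨j.1 - a, by omega⟩ := by
  subst h
  change Sum.elim p.1 p.2 (finSumFinEquiv.symm j) = _
  refine Fin.addCases (fun k => ?_) (fun k => ?_) j
  · rw [finSumFinEquiv_symm_apply_castAdd]
    simp
  · rw [finSumFinEquiv_symm_apply_natAdd]
    simp

/-! ### Order of the summands in the product structure. -/

section Concat

theorem rk_eq (d c : ℕ) : d + (1 + c) = rk d c := rfl

variable (i d c : ℕ)

/-- Concatenation `(r, w, a, b) ↦ (r w a b)`. -/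
def concat : ((Fin (i + 1) → ℝ) × ((Fin d → ℝ) × ((Fin d → ℝ) × (Fin (1 + c) → ℝ)))) ≃ₗ[ℝ]
    (Fin (rk (i + d) (d + (1 + c))) → ℝ) :=
  ((LinearEquiv.refl ℝ _).prodCongr
    (((LinearEquiv.refl ℝ _).prodCongr (splitFin rfl).symm).trans (splitFin rfl).symm)).trans
  (splitFin (by unfold rk; omega : i + 1 + (d + (d + (1 + c))) = rk (i + d) (d + (1 + c)))).symm

/-- Concatenation `(r, w, a, b) ↦ ((r a) (w b))`. -/
def concatPairs : ((Fin (i + 1) → ℝ) × ((Fin d → ℝ) × ((Fin d → ℝ) × (Fin (1 + c) → ℝ)))) ≃ₗ[ℝ]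
    (Fin (rk (i + d) (d + (1 + c))) → ℝ) :=
  ((LinearEquiv.refl ℝ _).prodCongr (swapMiddle _ _)).trans
  ((LinearEquiv.prodAssoc ℝ _ _ _).symm.trans
  (((splitFin (by unfold rk; omega : i + 1 + d = rk i d)).symm.prodCongr
    (splitFin (rk_eq d c)).symm).trans (splitFin (rk_add i d d c)).symm))

theorem concatPairs_apply (r : Fin (i + 1) → ℝ) (w a : Fin d → ℝ) (b : Fin (1 + c) → ℝ) :
    concatPairs i d c (r, (w, (a, b))) = (splitFin (rk_add i d d c)).symm
      ((splitFin (by unfold rk; omega : i + 1 + d = rk i d)).symm (r, a),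
        (splitFin (rk_eq d c)).symm (w, b)) := rfl

theorem concatPairs_eq (r : Fin (i + 1) → ℝ) (w a : Fin d → ℝ) (b : Fin (1 + c) → ℝ) :
    concatPairs i d c (r, (w, (a, b))) = concat i d c (r, (a, (w, b))) := by
  rw [concatPairs_apply]
  change _ = (splitFin _).symm (r, (splitFin rfl).symm (a, (splitFin rfl).symm (w, b)))
  funext j
  simp only [splitFin_symm_apply]
  have hrk : rk i d = i + 1 + d := by unfold rk; omega
  split_ifs <;> first | omega | (congr 2; omega) | rfl

/-- The comparison of the two concatenations. -/
def concatSwap : (Fin (rk (i + d) (d + (1 + c))) → ℝ) ≃ₗ[ℝ]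
    (Fin (rk (i + d) (d + (1 + c))) → ℝ) :=
  (concat i d c).symm.trans (concatPairs i d c)

/-- The comparison is conjugate to the exchange of two blocks of size `d`. It is here that the
dimension of `M` being even enters. -/
theorem det_concatSwap_pos (hd : Even d) :
    0 < LinearMap.det (concatSwap i d c).toLinearMap := by
  have h := LinearMap.det_conj ((LinearMap.id : (Fin (i + 1) → ℝ) →ₗ[ℝ] _).prodMap
    (swapMiddle (Fin d → ℝ) (Fin (1 + c) → ℝ)).toLinearMap) (concat i d c)
  rw [LinearMap.det_prodMap, LinearMap.det_id, one_mul] at h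
  have h1 : (concatSwap i d c).toLinearMap = (concat i d c).toLinearMap ∘ₗ
      ((LinearMap.id : (Fin (i + 1) → ℝ) →ₗ[ℝ] _).prodMap
        (swapMiddle (Fin d → ℝ) (Fin (1 + c) → ℝ)).toLinearMap) ∘ₗ
        (concat i d c).symm.toLinearMap := by
    refine LinearMap.ext fun x => ?_
    exact concatPairs_eq i d c _ _ _ _
  rw [h1, h]
  exact det_swapMiddle_pos (by simpa using hd)

end Concat

/-! ### The null homotopy of `f ⊕ f⁻¹`. -/

section Rotation

variable {W : Type*} [AddCommGroup W] [Module ℝ W]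

/-- Rotation by the angle `θ` in `W ⊕ W`. -/
def rotPair (θ : ℝ) : (W × W) ≃ₗ[ℝ] (W × W) where
  toFun x := (Real.cos θ • x.1 - Real.sin θ • x.2, Real.sin θ • x.1 + Real.cos θ • x.2)
  map_add' x y := by
    refine Prod.ext ?_ ?_
    · simp only [Prod.fst_add, Prod.snd_add]; module
    · simp only [Prod.fst_add, Prod.snd_add]; module
  map_smul' r x := by
    refine Prod.ext ?_ ?_
    · simp only [Prod.smul_fst, Prod.smul_snd, RingHom.id_apply]; module
    · simp only [Prod.smul_fst, Prod.smul_snd, RingHom.id_apply]; module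
  invFun x := (Real.cos θ • x.1 + Real.sin θ • x.2, -Real.sin θ • x.1 + Real.cos θ • x.2)
  left_inv x := by
    have h := Real.sin_sq_add_cos_sq θ
    refine Prod.ext ?_ ?_
    · refine Eq.trans ?_ (one_smul ℝ x.1)
      rw [← h]
      module
    · refine Eq.trans ?_ (one_smul ℝ x.2)
      rw [← h]
      module
  right_inv x := by
    have h := Real.sin_sq_add_cos_sq θ
    refine Prod.ext ?_ ?_
    · refine Eq.trans ?_ (one_smul ℝ x.1)
      rw [← h]
      module
    · refine Eq.trans ?_ (one_smul ℝ x.2)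
      rw [← h]
      module

/-- A path of automorphisms of `W ⊕ W` from the identity to `f ⊕ f⁻¹`. -/
def shear (f : W ≃ₗ[ℝ] W) (θ : ℝ) : (W × W) ≃ₗ[ℝ] (W × W) :=
  (rotPair θ).trans ((f.symm.prodCongr (LinearEquiv.refl ℝ W)).trans
    ((rotPair θ).symm.trans (f.prodCongr (LinearEquiv.refl ℝ W))))

theorem shear_apply (f : W ≃ₗ[ℝ] W) (θ : ℝ) (x : W × W) : shear f θ x =
    (f (Real.cos θ • f.symm (Real.cos θ • x.1 - Real.sin θ • x.2) +
        Real.sin θ • (Real.sin θ • x.1 + Real.cos θ • x.2)),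
      -Real.sin θ • f.symm (Real.cos θ • x.1 - Real.sin θ • x.2) +
        Real.cos θ • (Real.sin θ • x.1 + Real.cos θ • x.2)) := rfl

theorem shear_zero (f : W ≃ₗ[ℝ] W) (x : W × W) : shear f 0 x = x := by
  simp [shear_apply]

/-- Conjugation by a quarter turn moves the factor `f⁻¹` from the first summand to the second,
whereas at angle `0` it cancels against `f`. -/
theorem shear_pi_div_two (f : W ≃ₗ[ℝ] W) (x : W × W) :
    shear f (Real.pi / 2) x = (f x.1, f.symm x.2) := by
  simp [shear_apply]

end Rotation

end

/-! ### Framings of the sphere -/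

noncomputable section

open scoped unitInterval

namespace TangStr

variable {n : ℕ} {𝔅 : ConnectedCover n} {d m : ℕ} {X : Mfd d}
  {U : Type} [AddCommGroup U] [Module ℝ U] [TopologicalSpace U]

/-- The structure of a framing does not depend on the frame and on the constant lift. -/
theorem homotopic_ofFraming (q : 𝔅.Pull m) (L : Frame m) (hq : q.1.2 = BSOm.mk L)
    (τ : ∀ x : X.carrier, (X.T x × U) ≃ₗ[ℝ] (Fin m → ℝ))
    (hτ : Continuous fun p : TangentBundle X.model X.carrier × U => τ p.1.1 (p.1.2, p.2)) :
    Homotopic (TangStr.ofFrame q L hq τ hτ) (TangStr.ofFraming 𝔅 τ hτ) := by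
  have hq0 : 𝔅.θ q.1.1 = BSO.ofFrame L := q.2.trans (congrArg BSO.of hq)
  -- The frame is first moved to the standard one, with the lift following it (`q₁`). The lift then
  -- ends at some point `b` over the base point, and a path in the fibre moves it to `𝔅.pt` (`q₂`).
  let γ : Path L (Frame.std m) := PathConnectedSpace.somePath _ _
  obtain ⟨b, β, hβ⟩ := ConnectedCover.exists_lift_path γ hq0
  have hb : 𝔅.θ b = BSO.base := by
    have h := hβ 1
    rw [β.target, γ.target] at h
    exact h.trans (BSO.of_std m)
  obtain ⟨f, hf0, hf1, hf⟩ := ConnectedCover.exists_path_fibre hb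
  let q₁ : I → 𝔅.Pull m := fun t => ⟨(β t, BSOm.mk (γ t)), hβ t⟩
  let q₂ : I → 𝔅.Pull m := fun t =>
    ⟨(f (unitInterval.symm t), BSOm.mk (Frame.std m)), (hf _).trans (BSO.of_std m).symm⟩
  have hτ' : Continuous fun z : I × (TangentBundle X.model X.carrier × U) =>
      τ z.2.1.1 (z.2.1.2, z.2.2) := hτ.comp continuous_snd
  have h1 : Homotopic (TangStr.ofFrame q L hq τ hτ)
      (TangStr.ofFrame (q₁ 1) (Frame.std m) (congrArg BSOm.mk γ.target) τ hτ) := by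
    refine ⟨_, isHomotopy_ofFrame (q := q₁) (Continuous.subtype_mk
      (β.continuous.prodMk (BSOm.continuous_mk.comp γ.continuous)) _) γ.continuous (fun _ => rfl)
      (fun _ => hτ) hτ', ext_of_eq (fun x => Subtype.ext (Prod.ext β.source ?_)) fun x v => ?_,
      ext_of_eq (fun x => rfl) fun x v => ?_⟩
    · exact (congrArg BSOm.mk γ.source).trans hq.symm
    · exact congrArg (fun L : Frame m => L.1 (τ x v)) γ.source
    · exact congrArg (fun L : Frame m => L.1 (τ x v)) γ.target
  refine h1.trans ⟨_, isHomotopy_ofFrame (q := q₂) (Continuous.subtype_mk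
      ((f.continuous.comp unitInterval.continuous_symm).prodMk continuous_const) _)
      (L := fun _ => Frame.std m) continuous_const (fun _ => rfl)
      (fun _ => hτ) hτ', ext_of_eq (fun x => Subtype.ext (Prod.ext ?_ ?_)) fun x v => rfl,
      ext_of_eq (fun x => Subtype.ext (Prod.ext ?_ rfl)) fun x v => rfl⟩
  · change f (unitInterval.symm 0) = β 1
    rw [unitInterval.symm_zero, hf1, β.target]
  · exact (congrArg BSOm.mk γ.target).symm
  · change f (unitInterval.symm 1) = 𝔅.pt
    rw [unitInterval.symm_one, hf0]

end TangStr

/-! ### The pair of opposite twists on the sphere. -/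

section Framing

variable {i d c : ℕ}

/-- The coordinates of `TS^i ⊕ ℝ^d ⊕ ℝ ⊕ ℝ^{d + 1 + c}`. -/
def sphereCoord (x : (Mfd.sphere i).carrier) :
    ((Mfd.sphere i).T x × (EuclideanSpace ℝ (Fin d) × (ℝ × (Fin (d + (1 + c)) → ℝ)))) ≃ₗ[ℝ]
      ((Fin (i + 1) → ℝ) × ((Fin d → ℝ) × ((Fin d → ℝ) × (Fin (1 + c) → ℝ)))) :=
  (stdFraming x).trans (concat i d c).symm

theorem sphereCoord_apply (x : (Mfd.sphere i).carrier) (v : (Mfd.sphere i).T x)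
    (w : EuclideanSpace ℝ (Fin d)) (t : ℝ) (y : Fin (d + (1 + c)) → ℝ) :
    sphereCoord x (v, (w, (t, y))) = (radial x (v, t), (w.ofLp, splitFin rfl y)) := by
  rw [sphereCoord, LinearEquiv.trans_apply, LinearEquiv.symm_apply_eq]
  change _ = (splitFin _).symm (radial x (v, t), (splitFin rfl).symm (w.ofLp,
    (splitFin rfl).symm (splitFin rfl y)))
  rw [LinearEquiv.symm_apply_apply]
  rfl

/-- The framing with the first summand `ℝ^d` twisted by `φ` and the second one by `φ⁻¹`, and its
deformation to the untwisted one. -/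
def pairFraming (φ : C((Mfd.sphere i).carrier, Matrix.specialOrthogonalGroup (Fin d) ℝ)) (θ : ℝ)
    (x : (Mfd.sphere i).carrier) :
    ((Mfd.sphere i).T x × (EuclideanSpace ℝ (Fin d) × (ℝ × (Fin (d + (1 + c)) → ℝ)))) ≃ₗ[ℝ]
      (Fin (rk (i + d) (d + (1 + c))) → ℝ) :=
  (sphereCoord x).trans (((LinearEquiv.refl ℝ _).prodCongr
    ((LinearEquiv.prodAssoc ℝ _ _ _).symm.trans
      (((shear (rotInv (φ x)).symm θ).prodCongr (LinearEquiv.refl ℝ _)).trans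
        (LinearEquiv.prodAssoc ℝ _ _ _)))).trans (concatPairs i d c))

variable (φ : C((Mfd.sphere i).carrier, Matrix.specialOrthogonalGroup (Fin d) ℝ))

theorem pairFraming_apply (θ : ℝ) (x : (Mfd.sphere i).carrier)
    (p : (Mfd.sphere i).T x × (EuclideanSpace ℝ (Fin d) × (ℝ × (Fin (d + (1 + c)) → ℝ)))) :
    pairFraming φ θ x p = concatPairs i d c ((sphereCoord x p).1,
      ((shear (rotInv (φ x)).symm θ ((sphereCoord x p).2.1, (sphereCoord x p).2.2.1)).1,
      ((shear (rotInv (φ x)).symm θ ((sphereCoord x p).2.1, (sphereCoord x p).2.2.1)).2,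
        (sphereCoord x p).2.2.2))) := rfl

theorem continuous_pairFraming {Z : Type*} [TopologicalSpace Z] {θ : Z → ℝ} (hθ : Continuous θ) :
    Continuous fun z : Z × (TangentBundle (𝓡 i) (Mfd.sphere i).carrier ×
      (EuclideanSpace ℝ (Fin d) × (ℝ × (Fin (d + (1 + c)) → ℝ)))) =>
        pairFraming φ (θ z.1) z.2.1.1 (z.2.1.2, z.2.2) := by
  have h1 : Continuous fun z : Z × (TangentBundle (𝓡 i) (Mfd.sphere i).carrier ×
      (EuclideanSpace ℝ (Fin d) × (ℝ × (Fin (d + (1 + c)) → ℝ)))) =>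
        sphereCoord z.2.1.1 (z.2.1.2, z.2.2) := by
    have h : Continuous (concat i d c).symm :=
      LinearMap.continuous_of_finiteDimensional (LinearEquiv.toLinearMap _)
    exact (h.comp (continuous_stdFraming i d (d + (1 + c)))).comp continuous_snd
  have h2 : Continuous (concatPairs i d c) :=
    LinearMap.continuous_of_finiteDimensional (LinearEquiv.toLinearMap _)
  have hA : Continuous fun z : Z × (TangentBundle (𝓡 i) (Mfd.sphere i).carrier ×
      (EuclideanSpace ℝ (Fin d) × (ℝ × (Fin (d + (1 + c)) → ℝ)))) => (φ z.2.1.1).1 :=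
    continuous_subtype_val.comp (φ.continuous.comp ((FiberBundle.continuous_proj
      (EuclideanSpace ℝ (Fin i)) (TangentSpace (𝓡 i) (M := (Mfd.sphere i).carrier))).comp
      (continuous_fst.comp continuous_snd)))
  have hc : Continuous fun z : Z × (TangentBundle (𝓡 i) (Mfd.sphere i).carrier ×
      (EuclideanSpace ℝ (Fin d) × (ℝ × (Fin (d + (1 + c)) → ℝ)))) => Real.cos (θ z.1) := by fun_prop
  have hs : Continuous fun z : Z × (TangentBundle (𝓡 i) (Mfd.sphere i).carrier ×
      (EuclideanSpace ℝ (Fin d) × (ℝ × (Fin (d + (1 + c)) → ℝ)))) => Real.sin (θ z.1) := by fun_prop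
  have hw := continuous_fst.comp (continuous_snd.comp h1)
  have ha := continuous_fst.comp (continuous_snd.comp (continuous_snd.comp h1))
  have hb := continuous_snd.comp (continuous_snd.comp (continuous_snd.comp h1))
  have h3 := hA.matrix_transpose.matrix_mulVec ((hc.smul hw).sub (hs.smul ha))
  have h4 := (hs.smul hw).add (hc.smul ha)
  exact h2.comp ((continuous_fst.comp h1).prodMk
    ((hA.matrix_mulVec ((hc.smul h3).add (hs.smul h4))).prodMk
      (((hs.neg.smul h3).add (hc.smul h4)).prodMk hb)))

theorem pairFraming_zero (x : (Mfd.sphere i).carrier)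
    (p : (Mfd.sphere i).T x × (EuclideanSpace ℝ (Fin d) × (ℝ × (Fin (d + (1 + c)) → ℝ)))) :
    pairFraming φ 0 x p = concatSwap i d c (stdFraming x p) := by
  rw [pairFraming_apply, shear_zero]
  rfl

/-- This is the shape of the product structure along the centres of the discs: `φ` on the normal
summand comes from the disc bundle, `φ⁻¹` on the stabilising summand from `twistedSphere`. -/
theorem pairFraming_pi_div_two (x : (Mfd.sphere i).carrier) (v : (Mfd.sphere i).T x)
    (w : EuclideanSpace ℝ (Fin d)) (t : ℝ) (y : Fin (d + (1 + c)) → ℝ) :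
    pairFraming φ (Real.pi / 2) x (v, (w, (t, y))) = concatPairs i d c (radial x (v, t),
      (Matrix.mulVec (φ x).1 w.ofLp, (rotInv (φ x) (splitFin rfl y).1, (splitFin rfl y).2))) := by
  rw [pairFraming_apply, shear_pi_div_two, sphereCoord_apply]
  rfl

attribute [local irreducible] pairFraming

theorem continuous_pairFraming_const (θ : ℝ) :
    Continuous fun z : TangentBundle (𝓡 i) (Mfd.sphere i).carrier ×
      (EuclideanSpace ℝ (Fin d) × (ℝ × (Fin (d + (1 + c)) → ℝ))) =>
        pairFraming φ θ z.1.1 (z.1.2, z.2) :=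
  Continuous.comp (f := fun p => ((), p))
    (continuous_pairFraming φ (Z := Unit) (θ := fun _ => θ) continuous_const)
    (Continuous.prodMk_right ())

/-- Turning the angle back to `0` removes both twists. The remaining permutation `concatSwap` has
positive determinant and is absorbed into the frame `L`, whose choice does not matter by
`homotopic_ofFraming`. -/
theorem homotopic_pairFraming {n : ℕ} {𝔅 : ConnectedCover n} (hd : Even d)
    (q : 𝔅.Pull (rk (i + d) (d + (1 + c)))) (L : Frame (rk (i + d) (d + (1 + c))))
    (hq : q.1.2 = BSOm.mk L) :
    TangStr.Homotopic (X := Mfd.sphere i) (TangStr.ofFrame q L hq (pairFraming φ (Real.pi / 2))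
        (continuous_pairFraming_const φ _))
      (TangStr.ofFraming 𝔅 stdFraming (continuous_stdFraming i d (d + (1 + c)))) := by
  have h1 : TangStr.Homotopic (X := Mfd.sphere i)
      (TangStr.ofFrame q L hq (pairFraming φ 0) (continuous_pairFraming_const φ 0))
      (TangStr.ofFrame q L hq (pairFraming φ (Real.pi / 2))
        (continuous_pairFraming_const φ _)) := by
    refine ⟨_, TangStr.isHomotopy_ofFrame (q := fun _ => q) continuous_const (L := fun _ => L)
      continuous_const (fun _ => hq) (τ := fun t => pairFraming φ ((t : ℝ) * (Real.pi / 2)))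
      (fun t => continuous_pairFraming_const φ _) (continuous_pairFraming φ
        (θ := fun t : I => (t : ℝ) * (Real.pi / 2)) (by fun_prop)),
      TangStr.ext_of_eq (fun x => rfl) fun x v => ?_,
      TangStr.ext_of_eq (fun x => rfl) fun x v => ?_⟩
    · exact congrArg (fun θ => L.1 (pairFraming φ θ x v)) (zero_mul (Real.pi / 2))
    · exact congrArg (fun θ => L.1 (pairFraming φ θ x v)) (one_mul (Real.pi / 2))
  have hq' : q.1.2 = BSOm.mk (L.comp (concatSwap i d c)) :=
    hq.trans (BSOm.mk_comp (det_concatSwap_pos i d c hd)).symm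
  have h2 : TangStr.ofFrame (X := Mfd.sphere i) q L hq (pairFraming φ 0)
      (continuous_pairFraming_const φ 0) = TangStr.ofFrame q (L.comp (concatSwap i d c)) hq'
        stdFraming (continuous_stdFraming i d (d + (1 + c))) :=
    TangStr.ext_of_eq (fun x => rfl) fun x v => congrArg L.1 (pairFraming_zero φ x v)
  refine h1.symm.trans ?_
  rw [h2]
  exact TangStr.homotopic_ofFraming _ _ _ _ _

end Framing

end

/-! ### The collar twist -/

noncomputable section

namespace DiscBundle

variable {d i : ℕ} {M : Mfd d} {o : Orient M} {e : OrientedDisc M o} {φ : SmoothSO i d}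
  {E : DiscBundle M e.toFun i}

/-- The derivative of the trivialised disc bundle in a trivialisation as in the definition of the
collar twist. -/
theorem mfderiv_collar {g : Diffeomorph E.tot.model ((𝓡 i).prod M.model) E.tot.carrier
      ((Mfd.sphere i).carrier × M.carrier) ∞} (hg : ∀ z, (g z).1 = E.proj z)
    (hg' : ∀ s, g (E.disc (s, 0)) = (s, e.toFun 0) ∧ ∀ w : EuclideanSpace ℝ (Fin d),
      (mfderiv (𝓡 d) M.model (fun x => (g (E.disc (s, x))).2) 0 w : M.V) =
        mfderiv (𝓡 d) M.model e.toFun 0 (rotE (φ.toFun s).1 w))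
    (x : (Mfd.sphere i).carrier) (v : (Mfd.sphere i).T x) (w : EuclideanSpace ℝ (Fin d)) :
    (mfderiv E.tot.model ((𝓡 i).prod M.model) g (E.disc (x, 0))
      (mfderiv ((𝓡 i).prod (𝓡 d)) E.tot.model E.disc (x, 0) (v, w)) :
        EuclideanSpace ℝ (Fin i) × M.V) =
      (v, mfderiv (𝓡 d) M.model e.toFun 0 (rotE (φ.toFun x).1 w)) := by
  have hd : ContMDiff ((𝓡 i).prod (𝓡 d)) E.tot.model ∞ E.disc := E.embedding.smooth
  have hG : ContMDiff ((𝓡 i).prod (𝓡 d)) ((𝓡 i).prod M.model) ∞ (g ∘ E.disc) :=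
    g.contMDiff.comp hd
  have h1 := mfderiv_comp_apply (I := (𝓡 i).prod (𝓡 d)) (I' := E.tot.model)
    (I'' := (𝓡 i).prod M.model) (f := E.disc) (g := g)
    ((x, 0) : (Mfd.sphere i).carrier × EuclideanSpace ℝ (Fin d))
    (g.contMDiff.mdifferentiableAt (by simp)) (hd.mdifferentiableAt (by simp)) (v, w)
  refine (Eq.trans h1.symm ?_)
  have h2 := mfderiv_prod_eq_add_apply (I := 𝓡 i) (I' := 𝓡 d) (I'' := (𝓡 i).prod M.model)
    (f := g ∘ E.disc) (p := ((x, 0) : (Mfd.sphere i).carrier × EuclideanSpace ℝ (Fin d)))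
    (v := (v, w)) (hG.mdifferentiableAt (by simp))
  refine h2.trans ?_
  have h3 : HasMFDerivAt (𝓡 i) ((𝓡 i).prod M.model)
      (fun z : (Mfd.sphere i).carrier => (g ∘ E.disc) (z, 0)) x
        ((ContinuousLinearMap.id ℝ ((Mfd.sphere i).T x)).prod
          (0 : (Mfd.sphere i).T x →L[ℝ] M.T (e.toFun 0))) := by
    have h : (fun z : (Mfd.sphere i).carrier => (g ∘ E.disc) (z, 0)) =
      fun z => (z, e.toFun 0) := funext fun z => (hg' z).1
    rw [h]
    exact (hasMFDerivAt_id x).prodMk (hasMFDerivAt_const _ x)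
  have h4 : ContMDiff (𝓡 d) M.model ∞ fun y => (g (E.disc (x, y))).2 :=
    contMDiff_snd.comp (hG.comp (contMDiff_const.prodMk contMDiff_id))
  have h5 : HasMFDerivAt (𝓡 d) ((𝓡 i).prod M.model)
      (fun y : EuclideanSpace ℝ (Fin d) => (g ∘ E.disc) (x, y)) 0
        ((0 : EuclideanSpace ℝ (Fin d) →L[ℝ] EuclideanSpace ℝ (Fin i)).prod
          (mfderiv (𝓡 d) M.model (fun y => (g (E.disc (x, y))).2) 0)) := by
    have h : (fun y : EuclideanSpace ℝ (Fin d) => (g ∘ E.disc) (x, y)) =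
      fun y => (x, (g (E.disc (x, y))).2) :=
        funext fun y => Prod.ext ((hg _).trans (E.proj_disc x y)) rfl
    rw [h]
    exact (hasMFDerivAt_const x (0 : EuclideanSpace ℝ (Fin d))).prodMk
      (h4.mdifferentiableAt (by simp)).hasMFDerivAt
  have h6 := congrArg (fun A => (A v : EuclideanSpace ℝ (Fin i) × M.V)) h3.mfderiv
  have h7 := congrArg (fun A => (A w : EuclideanSpace ℝ (Fin i) × M.V)) h5.mfderiv
  refine (congrArg₂ (fun a b : EuclideanSpace ℝ (Fin i) × M.V => a + b) h6 h7).trans ?_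
  refine Prod.ext (add_zero v) ?_
  exact (zero_add _).trans ((hg' x).2 w)

/-- The product structure extends the standard one in the collar twist. -/
theorem extendsStandard_prod {n : ℕ} {𝔅 : ConnectedCover n} {c : ℕ} (hd : Even d)
    (μ : 𝔅.SumLift (rk i d) (rk d c)) [CompactSpace M.carrier]
    (ℓ : TangStr 𝔅 M (ℝ × (Fin c → ℝ)) (rk d c)) (hℓ : ℓ.IsOriented o)
    {g : Diffeomorph E.tot.model ((𝓡 i).prod M.model) E.tot.carrier
      ((Mfd.sphere i).carrier × M.carrier) ∞} (hg : ∀ z, (g z).1 = E.proj z)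
    (hg' : ∀ s, g (E.disc (s, 0)) = (s, e.toFun 0) ∧ ∀ w : EuclideanSpace ℝ (Fin d),
      (mfderiv (𝓡 d) M.model (fun x => (g (E.disc (s, x))).2) 0 w : M.V) =
        mfderiv (𝓡 d) M.model e.toFun 0 (rotE (φ.toFun s).1 w)) :
    E.ExtendsStandard (TangStr.pullbackDiffeo (Y := Mfd.prod rfl (Mfd.sphere i) M) g
      ((twistedSphere 𝔅 φ.toFun).prod μ ⟨M, ℓ⟩).str) := by
  let s₀ := ((twistedSphere 𝔅 φ.toFun).prod μ ⟨M, ℓ⟩).str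
  let D : EuclideanSpace ℝ (Fin d) ≃ₗ[ℝ] M.T (e.toFun 0) :=
    LinearEquiv.ofBijective (mfderiv (𝓡 d) M.model e.toFun 0).toLinearMap (e.embedding.bijective 0)
  -- The image of the standard basis under the derivative of the disc at its centre. It is oriented
  -- because the disc is, so that `hℓ` identifies the oriented subspace of `ℓ` with the span of the
  -- frame `Lℓ`.
  let b : Module.Basis (Fin d) ℝ (M.T (e.toFun 0)) :=
    (EuclideanSpace.basisFun (Fin d) ℝ).toBasis.map D
  have hb : b.orientation = o.orient (e.toFun 0) :=
    (Module.Basis.orientation_map _ _).trans (e.oriented 0)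
  have hb' : ∀ w : Fin d → ℝ, b.equivFun.symm w = D (WithLp.toLp 2 w) := fun w => by
    rw [Module.Basis.equivFun_symm_apply]
    simp only [b, Module.Basis.map_apply]
    simp_rw [← map_smul]
    rw [← map_sum]
    congr 1
    have h := (EuclideanSpace.basisFun (Fin d) ℝ).toBasis.sum_equivFun (WithLp.toLp 2 w)
    exact h
  let Lℓ : Frame (rk d c) := ⟨ℓ.gauss (e.toFun 0) ∘ₗ ((splitFin (rk_eq d c)).trans
    (b.equivFun.symm.prodCongr (splitOne c))).toLinearMap,
      (ℓ.injective_gauss (e.toFun 0)).comp (LinearEquiv.injective _)⟩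
  have hL : (ℓ.lift (e.toFun 0)).1.2 = BSOm.mk Lℓ := hℓ (e.toFun 0) b hb
  let L : Frame (rk (i + d) (d + (1 + c))) := Frame.sum (rk_add i d d c) (Frame.std _) Lℓ
  let q : 𝔅.Pull (rk (i + d) (d + (1 + c))) := s₀.lift (Mfd.basePt i, e.toFun 0)
  have hq : q.1.2 = BSOm.mk L :=
    congrArg (fun κ => BSOm.sum (rk_add i d d c) (BSOm.mk (Frame.std _)) κ) hL
  rw [extendsStandard_iff]
  refine Eq.mpr (congrArg (fun s => TangStr.Homotopic s _) ?_)
    (homotopic_pairFraming φ.toFun hd q L hq)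
  refine TangStr.ext_of_eq (fun x => ?_) ?_
  -- Along the centres the lift is constant: the point of `M` is always `e 0`, and the structure of
  -- a framed sphere has a constant lift.
  · exact (congrArg s₀.lift (hg' x).1).trans rfl
  · rintro x ⟨v, w, t, y⟩
    refine (TangStr.pullbackDiffeo_gauss (Y := Mfd.prod rfl (Mfd.sphere i) M) g s₀
      (E.core x) _ _).trans ?_
    have h1 := mfderiv_collar hg hg' x v w
    refine (congrArg₂ (fun (z : (Mfd.sphere i).carrier × M.carrier)
      (V : EuclideanSpace ℝ (Fin i) × M.V) => s₀.gauss z (V, (t, y))) (hg' x).1 h1).trans ?_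
    refine Eq.trans ?_ (congrArg L.1 (pairFraming_pi_div_two φ.toFun x v w t y)).symm
    rw [concatPairs_apply]
    change interleave ((Frame.std (rk i d)).1 (twistedFraming φ.toFun x (v, (t, (splitFin rfl y).1))),
      ℓ.gauss (e.toFun 0) (D (rotE (φ.toFun x).1 w), splitOne c (splitFin rfl y).2)) =
        interleave ((Frame.std (rk i d)).1 (splitFin (rk_add i d d c) ((splitFin
          (rk_add i d d c)).symm _)).1, Lℓ.1 (splitFin (rk_add i d d c) ((splitFin
          (rk_add i d d c)).symm _)).2)
    rw [LinearEquiv.apply_symm_apply]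
    congr 2
    change _ = ℓ.gauss (e.toFun 0) (b.equivFun.symm (splitFin (rk_eq d c) ((splitFin
      (rk_eq d c)).symm _)).1, splitOne c (splitFin (rk_eq d c) ((splitFin
      (rk_eq d c)).symm _)).2)
    rw [LinearEquiv.apply_symm_apply, hb']
    rfl

/-- The inverse isomorphism. -/
def Iso.symm {e : EuclideanSpace ℝ (Fin d) → M.carrier} {E E' : DiscBundle M e i}
    (f : E.Iso E') : E'.Iso E where
  diffeo := f.diffeo.symm
  proj z := by rw [← f.proj, f.diffeo.apply_symm_apply]
  disc s x hx := by rw [← f.disc s x hx, f.diffeo.symm_apply_apply]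
  fib x := by rw [← f.fib, f.diffeo.symm_apply_apply]

/-- An isomorphism respects the discs only for `‖x‖ ≤ 1`. This is a neighbourhood of the centre,
which suffices for the derivative there. -/
theorem IsCollarTwist.of_iso {E' : DiscBundle M e.toFun i} (h : E.IsCollarTwist e φ)
    (f : E'.Iso E) : E'.IsCollarTwist e φ := by
  obtain ⟨g, h1, h2, h3⟩ := h
  refine ⟨f.diffeo.trans g, fun z => (h1 _).trans (f.proj z), fun x => ?_, fun s => ⟨?_, fun w => ?_⟩⟩
  · exact (congrArg g (f.fib x)).trans (h2 x)
  · exact (congrArg g (f.disc s 0 (by simp))).trans (h3 s).1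
  · refine Eq.trans ?_ ((h3 s).2 w)
    have h4 : (fun x => ((f.diffeo.trans g) (E'.disc (s, x))).2) =ᶠ[𝓝 0]
        fun x => (g (E.disc (s, x))).2 := by
      filter_upwards [closedBall_mem_nhds (0 : EuclideanSpace ℝ (Fin d)) one_pos] with x hx
      exact congrArg (fun z => (g z).2) (f.disc s x (by simpa using hx))
    exact congrArg (fun A : EuclideanSpace ℝ (Fin d) →L[ℝ] M.V => A w)
      (h4.mfderiv_eq (I := 𝓡 d) (I' := M.model))

/-- Being a collar twist of `φ` is invariant under isomorphism, so it descends to the quotient, and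
chains of isomorphisms need not be considered. -/
theorem isCollarTwist_of_mk_eq {E' : DiscBundle M e.toFun i} (h : E.IsCollarTwist e φ)
    (hE : PiBDiff.mk E' = PiBDiff.mk E) : E'.IsCollarTwist e φ := by
  let P : PiBDiff M e.toFun i → Prop := Quot.lift (fun E => E.IsCollarTwist e φ) (by
    rintro E₁ E₂ ⟨f⟩
    exact propext ⟨fun h => h.of_iso f.symm, fun h => h.of_iso f⟩)
  have h1 : P (PiBDiff.mk E) := h
  rw [← hE] at h1
  exact h1

end DiscBundle

/-- Every representative of the class is again a collar twist of `φ`, so it carries the pulled-back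
product structure. That structure gives the asserted value; uniqueness of structures extending the
standard one shows that there is no other. -/
theorem lemma2p5 (n i c : ℕ) (hn : 1 ≤ n) (hi : 1 ≤ i) (𝔅 : ConnectedCover n)
    (μ : 𝔅.SumLift (rk i (2 * n)) (rk (2 * n) c))
    (M : Mfd (2 * n)) [CompactSpace M.carrier]
    (hM : ∀ k < n, ∀ x : M.carrier, Subsingleton (HomotopyGroup.Pi k M.carrier x))
    (o : Orient M) (ℓ : TangStr 𝔅 M (ℝ × (Fin c → ℝ)) (rk (2 * n) c)) (hℓ : ℓ.IsOriented o)
    (e : OrientedDisc M o) (φ : SmoothSO i (2 * n))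
    (E : DiscBundle M e.toFun i) (hE : E.IsCollarTwist e φ) :
    Phi 𝔅 (2 * n + (1 + c)) (PiBDiff.mk E) =
      {ClosedStr.mulRight μ ⟨M, ℓ⟩ (Jhom 𝔅 i (2 * n) φ.toPiSO)} := by
  ext y
  constructor
  · rintro ⟨E', hE', s, hs, rfl⟩
    obtain ⟨g, h1, -, h3⟩ := DiscBundle.isCollarTwist_of_mk_eq hE hE'
    have hs' := DiscBundle.extendsStandard_prod (even_two_mul n) μ ℓ hℓ h1 h3
    have h4 := DiscBundle.ExtendsStandard.mk_eq hn hi hM g.toHomeomorph (fun x => (h3 x).1) hs hs'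
    -- By definition, `mulRight` applied to the class of the twisted sphere is the class of the
    -- product of representatives, which the diffeomorphism `g` identifies with the total space.
    exact h4.trans (ClosedStr.mk_pullbackDiffeo (Y := Mfd.prod rfl (Mfd.sphere i) M) g _)
  · rintro rfl
    obtain ⟨g, h1, -, h3⟩ := hE
    refine ⟨E, rfl, _, DiscBundle.extendsStandard_prod (even_two_mul n) μ ℓ hℓ h1 h3, ?_⟩
    exact (ClosedStr.mk_pullbackDiffeo (Y := Mfd.prod rfl (Mfd.sphere i) M) g _).symm

end
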